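/- Let $n,m\in\mathbb N$ (both $\ge 1$), $s\in\mathbb R$, $1<p<\infty$, $1\le q\le\infty$, and let $E$ be a complex UMD Banach space, i.e. the Riesz projection $\sum_k e_k\otimes x_k\mapsto\sum_{k\ge 0}e_k\otimes x_k$ (where $e_k(x)=e^{ik\cdot x}$, and $k\ge0$ is meant componentwise) on $E$-valued trigonometric polynomials on $\mathbb T^n$ is bounded in the norm of $L^r(\mathbb T^n,E)$ for some $r\in(1,\infty)$. Let $A(t)=\sum_{|\alpha|\le m}a_\alpha(t)D^\alpha$, $t\ge 0$, where $D_j=-i\partial_j$ and $a_\alpha:[0,\infty)\to\mathcal L(E)$ satisfy $\sum_{|\alpha|\le m}\|a_\alpha\|_\infty\le C<\infty$. For $\theta\in[0,\pi)$ put $\Sigma_\theta=\{\lambda\in\mathbb C:|\arg\lambda|\le\theta\}\cup\{0\}$, and assume that $A$ is uniformly $(\kappa_0,\theta)$-elliptic for some $\kappa_0\ge1$ and $\theta\in[0,\pi)$: with $a^0(t,\xi)=\sum_{|\alpha|=m}a_\alpha(t)\xi^\alpha$ one has $\Sigma_\theta\subset\rho(-a^0(t,\xi))$ and $\|(\lambda+a^0(t,\xi))^{-1}\|_{\mathcal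 L(E)}\le\kappa_0/(1+|\lambda|)$ for all $\lambda\in\Sigma_\theta$, $t\ge0$ and $\xi\in\mathbb R^n$ with $|\xi|=1$. Let $B^s_{p,q}(\mathbb T^n,E)$ be the space of $E$-valued periodic distributions $u$ with finite norm $\big(\sum_{j\ge0}2^{sjq}\|\sum_{k\in\mathbb Z^n}e_k\otimes\phi_j(k)\hat u(k)\|_{L^p(\mathbb T^n,E)}^q\big)^{1/q}$ (a supremum over $j$ of $2^{sj}\|\cdots\|_{L^p(\mathbb T^n,E)}$ if $q=\infty$), where $(\phi_j)_{j\ge0}$ is any smooth dyadic resolution of unity on $\mathbb R^n$. Then $A(t)$ maps $B^{s+m}_{p,q}(\mathbb T^n,E)$, which is contained in $B^s_{p,q}(\mathbb T^n,E)$, into $B^{s}_{p,q}(\mathbb T^n,E)$ for every $t\ge0$. Let $\mathcal A(t)$ be its $B^s_{p,q}$-realization, i.e. the operator $u\mapsto A(t)u$ in $B^s_{p,q}(\mathbb T^n,E)$ with domain $B^{s+m}_{p,q}(\mathbb T^n,E)$. There exist $\kappa\ge1$ and $\omega_0>0$ such that $\omega_0+\Sigma_\theta\subset\rho(-\mathcal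 A(t))$ and $$\|(\lambda+\mathcal A(t))^{-1}\|_{\mathcal L(B^s_{p,q}(\mathbb T^n,E))}\le\frac{\kappa}{1+|\lambda|}\qquad\text{for all }\lambda\in\omega_0+\Sigma_\theta,\ t\ge0.$$ If, moreover, $A$ is uniformly normally elliptic (uniformly $(\kappa_1,\tfrac{\pi}{2})$-elliptic for some $\kappa_1\ge1$), then for each $t\ge0$ the operator $-\mathcal A(t)$ generates an analytic semigroup on $B^s_{p,q}(\mathbb T^n,E)$, that is, a semigroup holomorphic on an open sector around $(0,\infty)$, bounded near $0$ on smaller sectors, whose Laplace transform is the resolvent of $-\mathcal A(t)$; it is strongly continuous at $0$ if $q<\infty$. -/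

import Mathlib

open MeasureTheory Set Filter Topology
open scoped ENNReal NNReal SchwartzMap

noncomputable section

namespace TorusBesov

/-! ### The torus: points, measure, characters -/

/-- `ℝⁿ` with the Euclidean norm. -/
abbrev V (n : ℕ) : Type := EuclideanSpace ℝ (Fin n)

/-- The lattice point `k ∈ ℤⁿ`, seen in `ℝⁿ`. -/
def latticePt {n : ℕ} (k : Fin n → ℤ) : V n := WithLp.toLp 2 fun j => (k j : ℝ)

/-- The character `e_k(x) = exp(i k·x)`. -/
def char {n : ℕ} (k : Fin n → ℤ) (x : V n) : ℂ :=
  Complex.exp (Complex.I * ((∑ j, (k j : ℝ) * x j : ℝ) : ℂ))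

/-- The cube `[0,2π]ⁿ`. -/
def cube (n : ℕ) : Set (V n) := {x | ∀ j, x j ∈ Icc 0 (2 * Real.pi)}

/-- The normalized Lebesgue measure `(2π)⁻ⁿ dx` on `[0,2π]ⁿ`. -/
def torusMeasure (n : ℕ) : Measure (V n) :=
  (ENNReal.ofReal ((2 * Real.pi) ^ n))⁻¹ • (volume : Measure (V n)).restrict (cube n)

theorem isCompact_cube (n : ℕ) : IsCompact (cube n) := by
  have h : cube n = (EuclideanSpace.equiv (Fin n) ℝ).toHomeomorph ⁻¹'
      (Set.pi univ fun _ => Icc 0 (2 * Real.pi)) := by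
    ext x
    simp only [cube, Set.mem_preimage, Set.mem_pi, Set.mem_univ, true_imp_iff]
    rfl
  rw [h, Homeomorph.isCompact_preimage]
  exact isCompact_univ_pi fun _ => isCompact_Icc

instance (n : ℕ) : IsFiniteMeasure (torusMeasure n) := by
  constructor
  have h1 : (volume : Measure (V n)) (cube n) < ∞ := (isCompact_cube n).measure_lt_top
  have h2 : (0 : ℝ) < (2 * Real.pi) ^ n := by positivity
  simp only [torusMeasure, Measure.smul_apply, Measure.restrict_apply_univ, smul_eq_mul]
  exact ENNReal.mul_lt_top (ENNReal.inv_lt_top.2 (ENNReal.ofReal_pos.2 h2)) h1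

theorem contDiff_char {n : ℕ} (k : Fin n → ℤ) : ContDiff ℝ (⊤ : ℕ∞) (char k) := by
  unfold char
  refine Complex.contDiff_exp.comp (contDiff_const.mul (Complex.ofRealCLM.contDiff.comp ?_))
  have h : ∀ j ∈ (Finset.univ : Finset (Fin n)),
      ContDiff ℝ (⊤ : ℕ∞) (fun x : V n => (k j : ℝ) * x j) := fun j _ =>
    contDiff_const.mul (EuclideanSpace.proj (𝕜 := ℝ) j : V n →L[ℝ] ℝ).contDiff
  exact ContDiff.sum h

theorem norm_char {n : ℕ} (k : Fin n → ℤ) (x : V n) : ‖char k x‖ = 1 := by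
  rw [char, mul_comm, Complex.norm_exp_ofReal_mul_I]

theorem char_periodic {n : ℕ} (k : Fin n → ℤ) (x : V n) (i : Fin n) :
    char k (x + EuclideanSpace.single i (2 * Real.pi)) = char k x := by
  have h : (∑ j, (k j : ℝ) * (x + EuclideanSpace.single i (2 * Real.pi)) j : ℝ)
      = (∑ j, (k j : ℝ) * x j) + (k i : ℝ) * (2 * Real.pi) := by
    simp only [PiLp.add_apply, mul_add, Finset.sum_add_distrib]
    congr 1
    rw [Finset.sum_eq_single i] <;> simp +contextual
  rw [char, char, h, Complex.exp_eq_exp_iff_exists_int]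
  exact ⟨k i, by push_cast; ring⟩

/-! ### Periodic test functions and periodic distributions -/

/-- `C^∞(𝕋ⁿ)`: smooth functions `ℝⁿ → ℂ` that are `2π`-periodic in each variable. -/
def TestFun (n : ℕ) : Submodule ℂ (V n → ℂ) where
  carrier := {f | ContDiff ℝ (⊤ : ℕ∞) f ∧
    ∀ x j, f (x + EuclideanSpace.single j (2 * Real.pi)) = f x}
  add_mem' := fun hf hg => ⟨hf.1.add hg.1, fun x j => by simp [hf.2 x j, hg.2 x j]⟩
  zero_mem' := ⟨contDiff_const, fun _ _ => rfl⟩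
  smul_mem' := fun c f hf => ⟨hf.1.const_smul c, fun x j => by simp [hf.2 x j]⟩

/-- `e_k` as a test function. -/
def charTest {n : ℕ} (k : Fin n → ℤ) : TestFun n :=
  ⟨char k, contDiff_char k, char_periodic k⟩

/-- `D_j = -i ∂_j` on test functions. -/
def testD {n : ℕ} (j : Fin n) : Module.End ℂ (TestFun n) where
  toFun f := ⟨fun x => -Complex.I * fderiv ℝ (f : V n → ℂ) x (EuclideanSpace.single j 1),
    contDiff_const.mul ((f.2.1.fderiv_right (m := (⊤ : ℕ∞)) le_rfl).clm_apply contDiff_const),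
    fun x i => by
      have h : fderiv ℝ (f : V n → ℂ) (x + EuclideanSpace.single i (2 * Real.pi))
          = fderiv ℝ (f : V n → ℂ) x := by
        rw [← fderiv_comp_add_right]
        congr 1
        exact funext fun y => f.2.2 y i
      simp only [h]⟩
  map_add' f g := by
    ext x
    have hf : DifferentiableAt ℝ (f : V n → ℂ) x := f.2.1.differentiable (by simp) x
    have hg : DifferentiableAt ℝ (g : V n → ℂ) x := g.2.1.differentiable (by simp) x
    simp [fderiv_add hf hg, mul_add]
  map_smul' c f := by
    ext x
    have hf : DifferentiableAt ℝ (f : V n → ℂ) x := f.2.1.differentiable (by simp) x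
    simp [fderiv_const_smul hf c]
    ring

/-- `D^α = D_1^{α_1} ⋯ D_n^{α_n}` on test functions. -/
def testDpow {n : ℕ} (α : Fin n → ℕ) : Module.End ℂ (TestFun n) :=
  (List.ofFn fun j => testD j ^ α j).prod

/-- Continuity of a linear map `u : C^∞(𝕋ⁿ) → E` for the Fréchet topology of uniform convergence
of all derivatives: for some `N` and `C`, `‖u f‖ ≤ C * B` as soon as all derivatives of `f` of
order at most `N` are bounded by `B`. -/
def IsDistribution {n : ℕ} {E : Type*} [NormedAddCommGroup E] [NormedSpace ℂ E]
    (u : TestFun n →ₗ[ℂ] E) : Prop :=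
  ∃ (N : ℕ) (C : ℝ), ∀ (f : TestFun n) (B : ℝ),
    (∀ i ≤ N, ∀ x, ‖iteratedFDeriv ℝ i (f : V n → ℂ) x‖ ≤ B) → ‖u f‖ ≤ C * B

section Distributions

variable (n : ℕ) (E : Type*) [NormedAddCommGroup E] [NormedSpace ℂ E]

/-- `𝒟'(𝕋ⁿ, E)`: the `E`-valued periodic distributions. -/
def Distr : Submodule ℂ (TestFun n →ₗ[ℂ] E) where
  carrier := {u | IsDistribution u}
  add_mem' := by
    rintro u v ⟨N, C, hu⟩ ⟨M, K, hv⟩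
    refine ⟨max N M, C + K, fun f B hB => ?_⟩
    have h1 := hu f B fun i hi => hB i (hi.trans (le_max_left _ _))
    have h2 := hv f B fun i hi => hB i (hi.trans (le_max_right _ _))
    calc ‖(u + v) f‖ ≤ ‖u f‖ + ‖v f‖ := norm_add_le _ _
      _ ≤ (C + K) * B := by linarith
  zero_mem' := ⟨0, 0, fun f B _ => by simp⟩
  smul_mem' := by
    rintro c u ⟨N, C, hu⟩
    refine ⟨N, ‖c‖ * C, fun f B hB => ?_⟩
    have h1 := hu f B hB
    calc ‖(c • u) f‖ = ‖c‖ * ‖u f‖ := norm_smul _ _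
      _ ≤ ‖c‖ * C * B := by
        rw [mul_assoc]
        exact mul_le_mul_of_nonneg_left h1 (norm_nonneg c)

variable {n E}

/-- The Fourier coefficient `û(k) = u(e_{-k})`. -/
def fourierCoef (k : Fin n → ℤ) : Distr n E →ₗ[ℂ] E where
  toFun u := (u : TestFun n →ₗ[ℂ] E) (charTest (-k))
  map_add' _ _ := rfl
  map_smul' _ _ := rfl

theorem IsDistribution.comp_testD {u : TestFun n →ₗ[ℂ] E} (hu : IsDistribution u) (j : Fin n) :
    IsDistribution (u ∘ₗ testD j) := by
  obtain ⟨N, C, hu⟩ := hu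
  refine ⟨N + 1, C, fun f B hB => hu _ B fun i hi x => ?_⟩
  have hf : ContDiff ℝ (⊤ : ℕ∞) (fderiv ℝ (f : V n → ℂ)) := f.2.1.fderiv_right (m := (⊤ : ℕ∞)) le_rfl
  have hc : ContDiff ℝ (⊤ : ℕ∞)
      (fun y => fderiv ℝ (f : V n → ℂ) y (EuclideanSpace.single j 1)) :=
    hf.clm_apply contDiff_const
  have hi' : ((i : ℕ∞) : WithTop ℕ∞) ≤ (⊤ : ℕ∞) := by exact_mod_cast le_top
  have e : ((testD j f : TestFun n) : V n → ℂ) = (-Complex.I) •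
      (fun y => fderiv ℝ (f : V n → ℂ) y (EuclideanSpace.single j 1)) := rfl
  rw [e, iteratedFDeriv_const_smul_apply (hc.contDiffAt.of_le hi'), norm_smul, norm_neg,
    Complex.norm_I, one_mul]
  refine (norm_iteratedFDeriv_clm_apply_const (hf.contDiffAt) hi').trans ?_
  rw [norm_iteratedFDeriv_fderiv, EuclideanSpace.norm_single, norm_one, one_mul]
  exact hB (i + 1) (by omega) x

theorem IsDistribution.comp_testDpow {u : TestFun n →ₗ[ℂ] E} (hu : IsDistribution u)
    (α : Fin n → ℕ) : IsDistribution (u ∘ₗ testDpow α) := by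
  let S : Submonoid (Module.End ℂ (TestFun n)) :=
    { carrier := {L | ∀ v : TestFun n →ₗ[ℂ] E, IsDistribution v → IsDistribution (v ∘ₗ L)}
      one_mem' := fun v hv => hv
      mul_mem' := fun hL hM v hv => hM _ (hL v hv) }
  have hS : testDpow α ∈ S := by
    refine Submonoid.list_prod_mem S fun L hL => ?_
    obtain ⟨j, rfl⟩ := List.mem_ofFn.1 hL
    exact Submonoid.pow_mem S (fun v hv => hv.comp_testD j) _
  exact hS u hu

/-- `D^α` on distributions: `⟨D^α u, f⟩ = (-1)^{|α|} ⟨u, D^α f⟩`. -/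
def distrD (α : Fin n → ℕ) : Module.End ℂ (Distr n E) where
  toFun u := ⟨(-1 : ℂ) ^ (∑ j, α j) • ((u : TestFun n →ₗ[ℂ] E) ∘ₗ testDpow α),
    (Distr n E).smul_mem _ (u.2.comp_testDpow α)⟩
  map_add' u v := by
    ext f
    simp
  map_smul' c u := by
    ext f
    simp [smul_smul, mul_comm]

/-- A bounded operator `b` on `E` acting on distributions: `⟨b u, f⟩ = b ⟨u, f⟩`. -/
def distrCoeff (b : E →L[ℂ] E) : Module.End ℂ (Distr n E) where
  toFun u := ⟨(b : E →ₗ[ℂ] E) ∘ₗ (u : TestFun n →ₗ[ℂ] E), by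
    obtain ⟨N, C, hu⟩ := u.2
    refine ⟨N, ‖b‖ * C, fun f B hB => ?_⟩
    rw [mul_assoc]
    exact (b.le_opNorm _).trans (mul_le_mul_of_nonneg_left (hu f B hB) (norm_nonneg b))⟩
  map_add' u v := by
    ext f
    simp
  map_smul' c u := by
    ext f
    simp

end Distributions

/-! ### Besov spaces -/

/-- A (dyadic, smooth) resolution of unity on `ℝⁿ`. -/
structure ResolutionOfUnity (n : ℕ) where
  /-- the functions `φ_j` -/
  fn : ℕ → 𝓢(V n, ℂ)
  supp_zero : tsupport (fn 0) ⊆ {x | ‖x‖ ≤ 2}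
  supp_pos : ∀ j : ℕ, 1 ≤ j →
    tsupport (fn j) ⊆ {x | (2 : ℝ) ^ ((j : ℝ) - 1) ≤ ‖x‖ ∧ ‖x‖ ≤ (2 : ℝ) ^ ((j : ℝ) + 1)}
  sum_eq_one : ∀ ξ, HasSum (fun j => fn j ξ) 1
  deriv_le : ∀ N : ℕ, ∃ C : ℝ, ∀ (j : ℕ) (ξ : V n),
    ‖iteratedFDeriv ℝ N (fn j) ξ‖ ≤ C * (2 : ℝ) ^ (-((j : ℝ) * N))

section Besov

variable {n : ℕ} {E : Type*} [NormedAddCommGroup E] [NormedSpace ℂ E]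

/-- The dyadic block `∑_k e_k ⊗ φ_j(k) û(k)` (a finite sum, `φ_j` having compact support). -/
def block (φ : ResolutionOfUnity n) (j : ℕ) (u : Distr n E) (x : V n) : E :=
  ∑' k : Fin n → ℤ, (char k x * φ.fn j (latticePt k)) • fourierCoef k u

/-- A finite set of lattice points outside of which `φ_j` vanishes. -/
def box (n j : ℕ) : Finset (Fin n → ℤ) :=
  Fintype.piFinset fun _ => Finset.Icc (-(2 ^ (j + 1) : ℤ)) (2 ^ (j + 1))

theorem fn_eq_zero (φ : ResolutionOfUnity n) (j : ℕ) (k : Fin n → ℤ) (hk : k ∉ box n j) :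
    φ.fn j (latticePt k) = 0 := by
  by_contra h
  apply hk
  have hmem : latticePt k ∈ tsupport (φ.fn j) := subset_tsupport _ h
  have hn : ‖latticePt k‖ ≤ (2 : ℝ) ^ (j + 1) := by
    rcases Nat.eq_zero_or_pos j with rfl | hj
    · simpa using φ.supp_zero hmem
    · have := (φ.supp_pos j hj hmem).2
      rwa [show ((j : ℝ) + 1) = ((j + 1 : ℕ) : ℝ) by push_cast; ring, Real.rpow_natCast] at this
  simp only [box, Fintype.mem_piFinset, Finset.mem_Icc]
  intro i
  have h1 : |(k i : ℝ)| ≤ (2 : ℝ) ^ (j + 1) :=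
    (PiLp.norm_apply_le (latticePt k) i).trans hn
  have h2 := abs_le.1 h1
  exact ⟨by exact_mod_cast h2.1, by exact_mod_cast h2.2⟩

theorem block_eq_sum (φ : ResolutionOfUnity n) (j : ℕ) (u : Distr n E) :
    block φ j u = fun x =>
      ∑ k ∈ box n j, (char k x * φ.fn j (latticePt k)) • fourierCoef k u := by
  funext x
  exact tsum_eq_sum fun k hk => by simp [fn_eq_zero φ j k hk]

theorem memLp_block (φ : ResolutionOfUnity n) (p : ℝ≥0∞) (j : ℕ) (u : Distr n E) :
    MemLp (block φ j u) p (torusMeasure n) := by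
  have hc : Continuous (block φ j u) := by
    rw [block_eq_sum]
    exact continuous_finsetSum _ fun k _ =>
      (((contDiff_char k).continuous.mul continuous_const).smul continuous_const)
  refine MemLp.of_bound hc.aestronglyMeasurable
    (∑ k ∈ box n j, ‖φ.fn j (latticePt k)‖ * ‖fourierCoef k u‖) (ae_of_all _ fun x => ?_)
  rw [block_eq_sum]
  refine (norm_sum_le _ _).trans (Finset.sum_le_sum fun k _ => ?_)
  rw [norm_smul, norm_mul, norm_char, one_mul]

/-- The dyadic block as an element of `L^p(𝕋ⁿ, E)`. -/
def blockLp (φ : ResolutionOfUnity n) (p : ℝ≥0∞) (j : ℕ) :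
    Distr n E →ₗ[ℂ] Lp E p (torusMeasure n) where
  toFun u := (memLp_block φ p j u).toLp _
  map_add' u v := by
    rw [← MemLp.toLp_add]
    congr 1
    simp only [block_eq_sum, map_add, smul_add, Finset.sum_add_distrib]
    rfl
  map_smul' c u := by
    rw [RingHom.id_apply, ← MemLp.toLp_const_smul]
    congr 1
    simp only [block_eq_sum, map_smul, smul_comm _ c, ← Finset.smul_sum]
    rfl

variable (φ : ResolutionOfUnity n) (s : ℝ) (p q : ℝ≥0∞) [Fact (1 ≤ p)] [Fact (1 ≤ q)]

/-- The sequence `2^{sj} ∑_k e_k ⊗ φ_j(k) û(k)`, `j ∈ ℕ`, in `L^p(𝕋ⁿ, E)`. -/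
def besovSeq : Distr n E →ₗ[ℂ] (∀ _ : ℕ, Lp E p (torusMeasure n)) :=
  LinearMap.pi fun j => (((2 : ℝ) ^ (s * j) : ℝ) : ℂ) • blockLp φ p j

variable (E) in
/-- The Besov space `B^s_{p,q}(𝕋ⁿ, E)`: the distributions `u` for which
`(2^{sj} ‖∑_k e_k ⊗ φ_j(k) û(k)‖_{L^p})_j` is in `ℓ^q`. -/
def Besov : Submodule ℂ (Distr n E) where
  carrier := {u | Memℓp (besovSeq φ s p u) q}
  add_mem' hu hv := by
    simpa only [Set.mem_ofPred_eq, map_add] using Memℓp.add hu hv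
  zero_mem' := by
    simpa only [Set.mem_ofPred_eq, map_zero] using
      (zero_memℓp (E := fun _ : ℕ => Lp E p (torusMeasure n)) (p := q))
  smul_mem' c u hu := by
    simpa only [Set.mem_ofPred_eq, map_smul] using Memℓp.const_smul hu c

/-- The Besov space as a space of `ℓ^q` sequences in `L^p(𝕋ⁿ, E)`. -/
def besovToLp : Besov E φ s p q →ₗ[ℂ] lp (fun _ : ℕ => Lp E p (torusMeasure n)) q where
  toFun u := ⟨besovSeq φ s p u.1, u.2⟩
  map_add' u v := by
    ext1
    exact map_add (besovSeq φ s p) u.1 v.1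
  map_smul' c u := by
    ext1
    exact map_smul (besovSeq φ s p) c u.1

/-- The Besov norm
`(∑_j (2^{sj} ‖∑_k e_k ⊗ φ_j(k) û(k)‖_{L^p})^q)^{1/q}`, a supremum for `q = ∞`. -/
instance : SeminormedAddCommGroup (Besov E φ s p q) :=
  SeminormedAddCommGroup.induced _ _ (besovToLp φ s p q)

instance : NormedSpace ℂ (Besov E φ s p q) :=
  NormedSpace.induced ℂ _ _ (besovToLp φ s p q)

end Besov

/-! ### UMD spaces -/

/-- `E` is a UMD space: the Riesz projection `∑_k e_k ⊗ x_k ↦ ∑_{k ≥ 0} e_k ⊗ x_k` on `E`-valued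
trigonometric polynomials is bounded in `L^p(𝕋ⁿ, E)` for some `p ∈ (1,∞)`. -/
def IsUMD (n : ℕ) (E : Type*) [NormedAddCommGroup E] [NormedSpace ℂ E] : Prop :=
  ∃ p : ℝ≥0∞, 1 < p ∧ p < ∞ ∧ ∃ C : ℝ≥0, ∀ (S : Finset (Fin n → ℤ)) (x : (Fin n → ℤ) → E),
    eLpNorm (fun y => ∑ k ∈ S with ∀ j, 0 ≤ k j, char k y • x k) p (torusMeasure n) ≤
      C * eLpNorm (fun y => ∑ k ∈ S, char k y • x k) p (torusMeasure n)

/-! ### Differential operators, symbols, ellipticity -/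

/-- The multi-indices of order `i` in dimension `n`. -/
def multiIdx (n i : ℕ) : Finset (Fin n → ℕ) := Finset.piAntidiag Finset.univ i

/-- The closed sector `Σ_θ`. -/
def sector (θ : ℝ) : Set ℂ := {z | |z.arg| ≤ θ} ∪ {0}

section Operators

variable {n : ℕ} {E : Type*} [NormedAddCommGroup E] [NormedSpace ℂ E]

/-- The operator `∑_{|α| ≤ m} a_α D^α` on distributions. -/
def diffOp (m : ℕ) (a : (Fin n → ℕ) → E →L[ℂ] E) : Distr n E →ₗ[ℂ] Distr n E :=
  ∑ i ∈ Finset.range (m + 1), ∑ α ∈ multiIdx n i, distrCoeff (a α) ∘ₗ distrD α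

/-- The principal symbol `∑_{|α| = m} a_α ξ^α`. -/
def principalSymbol (m : ℕ) (a : (Fin n → ℕ) → E →L[ℂ] E) (ξ : V n) : E →L[ℂ] E :=
  ∑ α ∈ multiIdx n m, ((∏ j, ξ j ^ α j : ℝ) : ℂ) • a α

/-- Uniform `(κ, θ)`-ellipticity of `∑_{|α| ≤ m} a_α(t) D^α`, `t ≥ 0`. -/
structure IsElliptic (m : ℕ) (a : (Fin n → ℕ) → ℝ≥0 → E →L[ℂ] E) (κ θ : ℝ) : Prop where
  one_le : 1 ≤ κ
  angle_nonneg : 0 ≤ θ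
  angle_lt : θ < Real.pi
  sector_subset : ∀ (t : ℝ≥0) (ξ : V n), ‖ξ‖ = 1 →
    sector θ ⊆ resolventSet ℂ (-principalSymbol m (fun α => a α t) ξ)
  norm_resolvent_le : ∀ (t : ℝ≥0) (ξ : V n), ‖ξ‖ = 1 → ∀ z ∈ sector θ,
    ‖resolvent (-principalSymbol m (fun α => a α t) ξ) z‖ ≤ κ / (1 + ‖z‖)

/-- Uniform normal ellipticity: uniform `(κ, π/2)`-ellipticity for some `κ`. -/
def IsNormallyElliptic (m : ℕ) (a : (Fin n → ℕ) → ℝ≥0 → E →L[ℂ] E) : Prop :=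
  ∃ κ : ℝ, IsElliptic m a κ (Real.pi / 2)

/-- The `B^s_{p,q}`-realization of `∑_{|α| ≤ m} a_α D^α`, as an unbounded operator in `B^s_{p,q}`
with domain the set of `u ∈ B^{s+m}_{p,q}` (for which `u` and its image are in `B^s_{p,q}`). -/
def realization (φ : ResolutionOfUnity n) (s : ℝ) (p q : ℝ≥0∞) [Fact (1 ≤ p)] [Fact (1 ≤ q)]
    (m : ℕ) (a : (Fin n → ℕ) → E →L[ℂ] E) : Besov E φ s p q →ₗ.[ℂ] Besov E φ s p q where
  domain := (Besov E φ (s + m) p q).comap (Besov E φ s p q).subtype ⊓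
    (Besov E φ s p q).comap (diffOp m a ∘ₗ (Besov E φ s p q).subtype)
  toFun :=
    { toFun := fun u => ⟨diffOp m a u.1.1, u.2.2⟩
      map_add' := fun u v => Subtype.ext (map_add (diffOp m a) u.1.1 v.1.1)
      map_smul' := fun c u => Subtype.ext (map_smul (diffOp m a) c u.1.1) }

end Operators

/-! ### Resolvents of unbounded operators, analytic semigroups -/

section Semigroups

variable {X : Type*} [SeminormedAddCommGroup X] [NormedSpace ℂ X]

/-- `R` is the bounded inverse of `z - B : D(B) → X`. -/
def IsResolvent (B : X →ₗ.[ℂ] X) (z : ℂ) (R : X →L[ℂ] X) : Prop :=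
  (∀ x : X, ∃ h : R x ∈ B.domain, z • R x - B ⟨R x, h⟩ = x) ∧
    ∀ u : B.domain, R (z • (u : X) - B u) = u

/-- The resolvent set of an unbounded operator. -/
def rho (B : X →ₗ.[ℂ] X) : Set ℂ := {z | ∃ R : X →L[ℂ] X, IsResolvent B z R}

/-- The open sector of half-angle `δ`. -/
def openSector (δ : ℝ) : Set ℂ := {z | z ≠ 0 ∧ |z.arg| < δ}

/-- `T` is the analytic semigroup of angle `δ ∈ (0, π/2]` generated by `B`: it is holomorphic on
the open sector, satisfies the semigroup law, is bounded near `0` on each smaller sector, and the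
resolvent of `B` is its Laplace transform (the integral being taken weakly). The domain of `B`
need not be dense and `T` need not be strongly continuous at `0`. -/
structure IsAnalyticSemigroup (B : X →ₗ.[ℂ] X) (δ : ℝ) (T : ℂ → X →L[ℂ] X) : Prop where
  angle_pos : 0 < δ
  angle_le : δ ≤ Real.pi / 2
  holomorphic : DifferentiableOn ℂ T (openSector δ)
  map_add : ∀ z ∈ openSector δ, ∀ w ∈ openSector δ, T (z + w) = T z ∘L T w
  bounded : ∀ δ' < δ, ∃ M : ℝ, ∀ z ∈ openSector δ', ‖z‖ ≤ 1 → ‖T z‖ ≤ M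
  laplace : ∃ w : ℝ, ∀ z : ℂ, w < z.re → ∃ R : X →L[ℂ] X, IsResolvent B z R ∧
    ∀ (x : X) (l : StrongDual ℂ X),
      IntegrableOn (fun r : ℝ => Complex.exp (-(z * r)) * l (T r x)) (Ioi 0) ∧
      ∫ r in Ioi (0 : ℝ), Complex.exp (-(z * r)) * l (T r x) = l (R x)

end Semigroups

end TorusBesov

end

open TorusBesov

noncomputable section

/-! ### The cube with normalized Lebesgue measure as a model of the compact group (ℝ/ℤ)ⁿ. -/

namespace TorusBesov

-- Everything is a Fourier multiplier. By `Distr.ext_coef` and `exists_distr_of_coef`, a periodic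
-- distribution amounts to a sequence of Fourier coefficients of polynomial growth. A differential
-- operator multiplies the k-th coefficient by its full symbol a(k) ∈ L(E), so resolvent and
-- semigroup have to be the multipliers (z + a(k))⁻¹ and exp(-z a(k)). The work lies in bounding
-- them on Besov spaces with the right constants.
--
-- The multiplier theorem is elementary because a Besov norm asks for an estimate on one dyadic
-- block at a time. If g is smooth, L(E)-valued and supported in a fixed ball, then g(tk) = ∫
-- exp(2πi t k·w) ĝ(w) dw. The multiplier is thus a superposition of translations, which are
-- isometric on L^p, composed with the operators ĝ(w) of E. Its norm is at most ∫ ‖ĝ‖, which n + 1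
-- derivatives of g control (`exists_multiplier_const`). Rescaling the j-th shell to unit size gives
-- an `IsBlockMultiplier` with bound b j, and the finite overlap of the shells turns block bounds
-- into Besov bounds (`IsBlockMultiplier.exists_norm_le`).
--
-- For the resolvent, homogeneity and a Neumann series give ‖(z + a(ξ))⁻¹‖ ≤ 2κ/(|ξ|^m + |z|) for
-- large z in the sector. On the j-th rescaled shell the derivatives of a are O(2^{jm}), so relative
-- to the inverse they are bounded uniformly in j and z, and the inverse becomes a block multiplier
-- with bound K/(2^{jm} + |z|) (`exists_isBlockMultiplier_resSymbol`). This single bound contains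
-- both the estimate K/|z| on B^s and the mapping property from B^s to B^{s+m}. The shift by ω₀
-- keeps z large.
--
-- For the semigroup, ellipticity on the half-plane persists on a slightly larger sector. For fixed
-- k and B = a(k), r exp(-rB) is 1/(2πi) times the integral of exp(zr)(z + B)⁻² over a vertical
-- line, which converges absolutely since the resolvent enters squared (`exp_eq_integral`). The line
-- Re z = ω + 1/r, the same for all k, gives a block bound for exp(-r a(k)), and rotating a gives it
-- for complex times. Holomorphy then comes from Cauchy estimates, the semigroup law and the Laplace
-- transform from identities between symbols, and strong continuity for q < ∞ from dominated
-- convergence over the blocks. All limits and integrals are taken in L(E), in L^p or after applying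
-- a functional, so completeness of the Besov space plays no role.

local instance unitAddCircleMeasureSpace : MeasureSpace UnitAddCircle := ⟨AddCircle.haarAddCircle⟩

local instance : Measure.IsAddHaarMeasure (volume : Measure UnitAddCircle) :=
  inferInstanceAs (Measure.IsAddHaarMeasure AddCircle.haarAddCircle)

local instance : IsProbabilityMeasure (volume : Measure UnitAddCircle) :=
  inferInstanceAs (IsProbabilityMeasure AddCircle.haarAddCircle)

/-- The projection `ℝⁿ → (ℝ/ℤ)ⁿ`, `x ↦ x / 2π`. -/
def torusProj {n : ℕ} (x : V n) : UnitAddTorus (Fin n) := fun j => ((x j / (2 * Real.pi) : ℝ) : UnitAddCircle)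

theorem continuous_torusProj {n : ℕ} : Continuous (torusProj (n := n)) := by
  refine continuous_pi fun j => ?_
  refine (AddCircle.continuous_mk' 1).comp ?_
  have : Continuous fun x : V n => x j := (EuclideanSpace.proj (𝕜 := ℝ) j : V n →L[ℝ] ℝ).continuous
  exact this.div_const _

/-- Up to the null endpoint 0, the interval is the image under multiplication by 2π of the
fundamental domain (0, 1], which accounts for the factor 2π. -/
theorem volume_Icc_inter_proj (s : Set UnitAddCircle) (hs : MeasurableSet s) :
    (volume : Measure ℝ) (Icc 0 (2 * Real.pi) ∩ {x | ((x / (2 * Real.pi) : ℝ) : UnitAddCircle) ∈ s})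
      = ENNReal.ofReal (2 * Real.pi) * (volume : Measure UnitAddCircle) s := by
  have hpi : (0 : ℝ) < 2 * Real.pi := by positivity
  have h1 := (UnitAddCircle.measurePreserving_mk 0).map_eq
  have h2 : (volume : Measure ℝ) (((↑) : ℝ → UnitAddCircle) ⁻¹' s ∩ Ioc 0 1) =
      (volume : Measure UnitAddCircle) s := by
    have : Measurable ((↑) : ℝ → UnitAddCircle) := AddCircle.measurable_mk'
    have h3 := congrArg (fun μ => μ s) h1
    simp only [zero_add] at h3
    rw [Measure.map_apply this hs, Measure.restrict_apply (this hs)] at h3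
    rw [h3]
    simp [volume, AddCircle.haarAddCircle]
  have h4 : Ioc 0 (2 * Real.pi) ∩ {x : ℝ | ((x / (2 * Real.pi) : ℝ) : UnitAddCircle) ∈ s}
      = (fun x => (2 * Real.pi)⁻¹ * x) ⁻¹' (((↑) : ℝ → UnitAddCircle) ⁻¹' s ∩ Ioc 0 1) := by
    ext x
    simp only [mem_inter_iff, mem_Ioc, mem_ofPred_eq, mem_preimage]
    rw [inv_mul_eq_div, and_comm]
    refine and_congr_right fun _ => ?_
    rw [div_pos_iff_of_pos_right hpi, div_le_one hpi]
  have h5 : (volume : Measure ℝ) (Icc 0 (2 * Real.pi) ∩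
      {x | ((x / (2 * Real.pi) : ℝ) : UnitAddCircle) ∈ s}) =
      volume (Ioc 0 (2 * Real.pi) ∩ {x : ℝ | ((x / (2 * Real.pi) : ℝ) : UnitAddCircle) ∈ s}) :=
    measure_congr ((Ioc_ae_eq_Icc (μ := volume)).symm.inter (ae_eq_refl _))
  rw [h5, h4, Real.volume_preimage_mul_left (inv_ne_zero hpi.ne'), h2, inv_inv, abs_of_pos hpi]

/-- This transfers L^p norms and integrals over the cube to Haar measure on a compact group, where
translation invariance and Fourier series are at hand. -/
theorem measurePreserving_torusProj (n : ℕ) :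
    MeasurePreserving (torusProj (n := n)) (torusMeasure n) (volume : Measure (UnitAddTorus (Fin n))) := by
  refine ⟨continuous_torusProj.measurable, ?_⟩
  symm
  refine Measure.pi_eq fun s hs => ?_
  have hpi : (0 : ℝ) < 2 * Real.pi := by positivity
  rw [Measure.map_apply continuous_torusProj.measurable (MeasurableSet.univ_pi hs), torusMeasure,
    Measure.smul_apply, Measure.restrict_apply
    (continuous_torusProj.measurable (MeasurableSet.univ_pi hs))]
  have h1 : torusProj ⁻¹' (univ.pi s) ∩ cube n = (MeasurableEquiv.toLp 2 (Fin n → ℝ)).symm ⁻¹'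
      (univ.pi fun i => Icc 0 (2 * Real.pi) ∩
        {x : ℝ | ((x / (2 * Real.pi) : ℝ) : UnitAddCircle) ∈ s i}) := by
    ext x
    simp only [mem_inter_iff, mem_preimage, Set.mem_pi, mem_univ, true_imp_iff, cube, mem_ofPred_eq,
      forall_and, torusProj]
    exact and_comm
  rw [h1, (EuclideanSpace.volume_preserving_symm_measurableEquiv_toLp (Fin n)).measure_preimage_equiv,
    volume_pi_pi]
  simp only [volume_Icc_inter_proj _ (hs _), Finset.prod_mul_distrib, Finset.prod_const,
    Finset.card_univ, Fintype.card_fin, smul_eq_mul]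
  rw [ENNReal.ofReal_pow hpi.le, ← mul_assoc, ENNReal.inv_mul_cancel, one_mul]
  · simp [Real.pi_pos]
  · exact ENNReal.pow_ne_top ENNReal.ofReal_ne_top

instance (n : ℕ) : IsProbabilityMeasure (torusMeasure n) :=
  ⟨by rw [← preimage_univ (f := torusProj), (measurePreserving_torusProj n).measure_preimage
    MeasurableSet.univ.nullMeasurableSet, measure_univ]⟩

theorem char_eq_mFourier {n : ℕ} (k : Fin n → ℤ) (x : V n) :
    char k x = UnitAddTorus.mFourier k (torusProj x) := by
  simp only [UnitAddTorus.mFourier, torusProj, ContinuousMap.coe_mk, fourier_coe_apply, char]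
  rw [← Complex.exp_sum]
  congr 1
  push_cast
  rw [Finset.mul_sum]
  refine Finset.sum_congr rfl fun j _ => ?_
  have : (Real.pi : ℂ) ≠ 0 := by exact_mod_cast Real.pi_ne_zero
  field_simp

theorem char_add {n : ℕ} (k : Fin n → ℤ) (x h : V n) : char k (x + h) = char k x * char k h := by
  simp only [char]
  rw [← Complex.exp_add]
  congr 1
  simp only [PiLp.add_apply, mul_add, Finset.sum_add_distrib]
  push_cast
  ring

/-! ### Vector-valued trigonometric polynomials in L^p. -/

section Mono

variable {n : ℕ} {E : Type*} [NormedAddCommGroup E] [NormedSpace ℂ E] (p : ℝ≥0∞)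

theorem memLp_char_smul (k : Fin n → ℤ) (x : E) :
    MemLp (fun y => char k y • x) p (torusMeasure n) := by
  refine MemLp.of_bound ((contDiff_char k).continuous.smul continuous_const).aestronglyMeasurable
    ‖x‖ (ae_of_all _ fun y => ?_)
  rw [norm_smul, norm_char, one_mul]

variable [Fact (1 ≤ p)]

/-- `x ↦ e_k ⊗ x`, as a map into `L^p(𝕋ⁿ, E)`. -/
def mono (k : Fin n → ℤ) : E →L[ℂ] Lp E p (torusMeasure n) :=
  LinearMap.mkContinuous
    { toFun := fun x => (memLp_char_smul p k x).toLp _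
      map_add' := fun x y => by
        rw [← MemLp.toLp_add]
        congr 1
        funext z
        simp
      map_smul' := fun c x => by
        rw [RingHom.id_apply, ← MemLp.toLp_const_smul]
        congr 1
        funext z
        simp [smul_comm c] } 1 fun x => by
    simp only [LinearMap.coe_mk, AddHom.coe_mk, Lp.norm_toLp, one_mul]
    have : eLpNorm (fun y => char k y • x) p (torusMeasure n) = eLpNorm (fun _ : V n => x) p (torusMeasure n) :=
      eLpNorm_congr_norm_ae (ae_of_all _ fun y => by rw [norm_smul, norm_char, one_mul])
    have hp : p ≠ 0 := (lt_of_lt_of_le one_pos (Fact.out : 1 ≤ p)).ne'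
    rw [this, eLpNorm_const _ hp (NeZero.ne _)]
    simp

theorem norm_mono (k : Fin n → ℤ) (x : E) : ‖mono p k x‖ = ‖x‖ := by
  change ‖(memLp_char_smul p k x).toLp _‖ = _
  rw [Lp.norm_toLp]
  have : eLpNorm (fun y => char k y • x) p (torusMeasure n) = eLpNorm (fun _ : V n => x) p (torusMeasure n) :=
    eLpNorm_congr_norm_ae (ae_of_all _ fun y => by rw [norm_smul, norm_char, one_mul])
  have hp : p ≠ 0 := (lt_of_lt_of_le one_pos (Fact.out : 1 ≤ p)).ne'
  rw [this, eLpNorm_const _ hp (NeZero.ne _)]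
  simp

theorem coeFn_sum_mono (S : Finset (Fin n → ℤ)) (x : (Fin n → ℤ) → E) :
    ((∑ k ∈ S, mono p k (x k) : Lp E p (torusMeasure n)) : V n → E) =ᵐ[torusMeasure n] fun y => ∑ k ∈ S, char k y • x k := by
  classical
  induction S using Finset.induction_on with
  | empty =>
    simp only [Finset.sum_empty]
    exact Lp.coeFn_zero E p (torusMeasure n)
  | insert k S hk ih =>
    rw [Finset.sum_insert hk]
    filter_upwards [Lp.coeFn_add (mono p k (x k)) (∑ k ∈ S, mono p k (x k)), ih,
      (memLp_char_smul p k (x k)).coeFn_toLp] with y h1 h2 h3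
    rw [h1, Finset.sum_insert hk, Pi.add_apply, h2]
    congr 1

theorem norm_sum_mono (S : Finset (Fin n → ℤ)) (x : (Fin n → ℤ) → E) :
    ‖∑ k ∈ S, mono p k (x k)‖ =
      (eLpNorm (fun y => ∑ k ∈ S, char k y • x k) p (torusMeasure n)).toReal := by
  rw [Lp.norm_def, eLpNorm_congr_ae (coeFn_sum_mono p S x)]

/-- Translations act isometrically on trigonometric polynomials. -/
theorem norm_sum_mono_translate (S : Finset (Fin n → ℤ)) (x : (Fin n → ℤ) → E) (h : V n) :
    ‖∑ k ∈ S, mono p k (char k h • x k)‖ = ‖∑ k ∈ S, mono p k (x k)‖ := by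
  rw [norm_sum_mono, norm_sum_mono]
  congr 1
  -- The cube is not invariant under translations, but the torus is: both polynomials are pulled
  -- back from it, and there they differ by a measure-preserving translation.
  let F : UnitAddTorus (Fin n) → E := fun y => ∑ k ∈ S, UnitAddTorus.mFourier k y • x k
  have hF : Continuous F := continuous_finsetSum _ fun k _ =>
    (UnitAddTorus.mFourier k).continuous.smul continuous_const
  have e1 : (fun y => ∑ k ∈ S, char k y • x k) = F ∘ torusProj := by
    funext y
    simp only [F, Function.comp_apply, char_eq_mFourier]
  have hadd : ∀ y : V n, torusProj (y + h) = torusProj y + torusProj h := by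
    intro y
    funext j
    simp only [torusProj, PiLp.add_apply, Pi.add_apply, add_div]
    exact AddCircle.coe_add _ _ _
  have e2 : (fun y => ∑ k ∈ S, char k y • char k h • x k) =
      (F ∘ fun y => y + torusProj h) ∘ torusProj := by
    funext y
    simp only [F, Function.comp_apply, ← hadd, ← char_eq_mFourier, char_add, mul_smul]
  have hm := measurePreserving_torusProj n
  have hG : AEStronglyMeasurable (F ∘ fun y => y + torusProj h) (volume : Measure (UnitAddTorus (Fin n))) := by
    have := hF.comp (continuous_add_const (torusProj h))
    exact this.aestronglyMeasurable
  rw [e1, e2, eLpNorm_comp_measurePreserving hG hm,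
    eLpNorm_comp_measurePreserving hF.aestronglyMeasurable hm]
  exact eLpNorm_comp_measurePreserving hF.aestronglyMeasurable
    (measurePreserving_add_right (volume : Measure (UnitAddTorus (Fin n))) (torusProj h))

end Mono

/-! ### Multiplier estimate for compactly supported smooth operator-valued symbols. -/

section Multiplier

variable {n : ℕ} {E : Type*} [NormedAddCommGroup E] [NormedSpace ℂ E]

/-- A bounded operator acts on `E`-valued trigonometric polynomials with its operator norm. -/
theorem norm_sum_mono_clm_le (p : ℝ≥0∞) [Fact (1 ≤ p)] (L : E →L[ℂ] E) (S : Finset (Fin n → ℤ))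
    (x : (Fin n → ℤ) → E) :
    ‖∑ k ∈ S, mono p k (L (x k))‖ ≤ ‖L‖ * ‖∑ k ∈ S, mono p k (x k)‖ := by
  refine Lp.norm_le_mul_norm_of_ae_le_mul ?_
  filter_upwards [coeFn_sum_mono p S x, coeFn_sum_mono p S (fun k => L (x k))] with y h1 h2
  rw [h1, h2]
  have : ∑ k ∈ S, char k y • L (x k) = L (∑ k ∈ S, char k y • x k) := by
    rw [map_sum]
    exact Finset.sum_congr rfl fun k _ => (map_smul L _ _).symm
  rw [this]
  exact L.le_opNorm _

variable [CompleteSpace E]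

/-- The Fourier transform of a smooth function supported in a ball of radius `4` is integrable,
with an `L¹` norm controlled by the derivatives of order at most `n + 1`. -/
theorem exists_integral_norm_fourier_le (n : ℕ) : ∃ K : ℝ, 0 ≤ K ∧
    ∀ {F : Type*} [NormedAddCommGroup F] [NormedSpace ℂ F] [CompleteSpace F] (g : V n → F),
      ContDiff ℝ (⊤ : ℕ∞) g → Function.support g ⊆ Metric.closedBall 0 4 →
      ∀ B : ℝ, (∀ i ≤ n + 1, ∀ ξ, ‖iteratedFDeriv ℝ i g ξ‖ ≤ B) →
        Integrable g ∧ Integrable (FourierTransform.fourier g) ∧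
          ∫ w, ‖FourierTransform.fourier g w‖ ≤ K * B := by
  set vol := (volume : Measure (V n)).real (Metric.closedBall 0 4) with hvol
  set J := ∫ w : V n, (1 + ‖w‖) ^ (-((n + 1 : ℕ) : ℝ)) with hJ
  have hJ0 : 0 ≤ J := integral_nonneg fun w => by positivity
  -- Decay of order n + 1, just above the dimension, makes the Fourier transform integrable. The
  -- factor 2^n comes from (1 + |w|)^(n+1) ≤ 2^n (1 + |w|^(n+1)), and the 2 from bounding the two
  -- resulting terms separately.
  set C : ℝ := 2 ^ n * (2 * (2 ^ (n + 1) * ((n + 2) * vol))) with hC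
  have hC0 : 0 ≤ C := by positivity
  refine ⟨C * J, by positivity, fun {F} _ _ _ g hg hsupp B hB => ?_⟩
  have hts : tsupport g ⊆ Metric.closedBall 0 4 :=
    closure_minimal hsupp Metric.isClosed_closedBall
  have hcs : HasCompactSupport g :=
    (isCompact_closedBall (0 : V n) 4).of_isClosed_subset (isClosed_tsupport g) hts
  have hgi : Integrable g := hg.continuous.integrable_of_hasCompactSupport hcs
  have hDs : ∀ i x, x ∉ Metric.closedBall (0 : V n) 4 → iteratedFDeriv ℝ i g x = 0 := fun i x hx => by
    by_contra h
    exact hx (hts (support_iteratedFDeriv_subset i h))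
  have hDc : ∀ i : ℕ, Continuous (iteratedFDeriv ℝ i g) := fun i =>
    hg.continuous_iteratedFDeriv (by exact_mod_cast le_top)
  have hDi : ∀ i : ℕ, Integrable (fun v => ‖v‖ ^ 0 * ‖iteratedFDeriv ℝ i g v‖) := by
    intro i
    simp only [pow_zero, one_mul]
    exact ((hDc i).integrable_of_hasCompactSupport (hcs.iteratedFDeriv i)).norm
  have hDint : ∀ i ≤ n + 1, ∫ v, ‖iteratedFDeriv ℝ i g v‖ ≤ vol * B := by
    intro i hi
    have h1 : ∫ v, ‖iteratedFDeriv ℝ i g v‖ =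
        ∫ v in Metric.closedBall (0 : V n) 4, ‖iteratedFDeriv ℝ i g v‖ := by
      rw [setIntegral_eq_integral_of_forall_compl_eq_zero]
      exact fun x hx => by rw [hDs i x hx, norm_zero]
    have h2 := norm_setIntegral_le_of_norm_le_const (μ := (volume : Measure (V n)))
      (s := Metric.closedBall (0 : V n) 4)
      (f := fun v => ‖iteratedFDeriv ℝ i g v‖) (C := B) (isCompact_closedBall _ _).measure_lt_top
      (fun x _ => by simpa using hB i hi x)
    rw [h1, mul_comm]
    exact (le_abs_self _).trans h2
  have hB0 : 0 ≤ B := (norm_nonneg _).trans (hB 0 (by omega) 0)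
  have hpow : ∀ N ≤ n + 1, ∀ w : V n, ‖w‖ ^ N * ‖FourierTransform.fourier g w‖ ≤
      2 ^ (n + 1) * ((n + 2) * vol) * B := by
    intro N hN w
    have h := Real.pow_mul_norm_iteratedFDeriv_fourier_le (f := g) (K := 0) (N := (n + 1 : ℕ))
      (hg.of_le (by exact_mod_cast le_top))
      (fun k i hk _ => by
        have : k = 0 := by simpa using hk
        subst this
        exact hDi i) (k := 0) (n := N) (by simp) (by exact_mod_cast hN) w
    simp only [norm_iteratedFDeriv_zero, pow_zero, Nat.cast_zero, mul_zero, zero_add, one_mul,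
      Finset.range_one, Finset.singleton_product, Finset.sum_map, Function.Embedding.coeFn_mk] at h
    refine h.trans ?_
    have h3 : ∑ i ∈ Finset.range (N + 1), ∫ v, ‖iteratedFDeriv ℝ i g v‖ ≤ (n + 2) * (vol * B) := by
      refine (Finset.sum_le_sum fun i hi => hDint i ?_).trans ?_
      · have := Finset.mem_range.1 hi; omega
      · rw [Finset.sum_const, Finset.card_range, nsmul_eq_mul]
        have : ((N + 1 : ℕ) : ℝ) ≤ n + 2 := by exact_mod_cast (by omega : N + 1 ≤ n + 2)
        gcongr
    have h4 : (2 : ℝ) ^ N ≤ 2 ^ (n + 1) := pow_le_pow_right₀ (by norm_num) hN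
    calc (2 : ℝ) ^ N * ∑ i ∈ Finset.range (N + 1), ∫ v, ‖iteratedFDeriv ℝ i g v‖
        ≤ 2 ^ (n + 1) * ((n + 2) * (vol * B)) := by gcongr
      _ = _ := by ring
  have hbd : ∀ w : V n, ‖FourierTransform.fourier g w‖ ≤
      C * B * (1 + ‖w‖) ^ (-((n + 1 : ℕ) : ℝ)) := by
    intro w
    have hw : (0 : ℝ) < 1 + ‖w‖ := by positivity
    rw [Real.rpow_neg hw.le, Real.rpow_natCast, ← div_eq_mul_inv, le_div_iff₀ (by positivity)]
    have h0 := hpow 0 (by omega) w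
    have h1 := hpow (n + 1) le_rfl w
    have h2 := add_pow_le zero_le_one (norm_nonneg w) (n + 1)
    simp only [one_pow, Nat.add_sub_cancel] at h2
    calc ‖FourierTransform.fourier g w‖ * (1 + ‖w‖) ^ (n + 1)
        ≤ ‖FourierTransform.fourier g w‖ * (2 ^ n * (1 + ‖w‖ ^ (n + 1))) := by gcongr
      _ = 2 ^ n * (‖w‖ ^ 0 * ‖FourierTransform.fourier g w‖ +
          ‖w‖ ^ (n + 1) * ‖FourierTransform.fourier g w‖) := by ring
      _ ≤ 2 ^ n * (2 ^ (n + 1) * ((n + 2) * vol) * B + 2 ^ (n + 1) * ((n + 2) * vol) * B) := by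
          gcongr
      _ = C * B := by rw [hC]; ring
  have hJi : Integrable (fun w : V n => C * B * (1 + ‖w‖) ^ (-((n + 1 : ℕ) : ℝ))) := by
    refine (integrable_one_add_norm ?_).const_mul _
    simp
  have hcont : Continuous (FourierTransform.fourier g) :=
    VectorFourier.fourierIntegral_continuous Real.continuous_fourierChar
      (innerSL ℝ).continuous₂ hgi
  have hFi : Integrable (FourierTransform.fourier g) :=
    hJi.mono' hcont.aestronglyMeasurable (ae_of_all _ hbd)
  refine ⟨hgi, hFi, ?_⟩
  refine (integral_mono hFi.norm hJi hbd).trans ?_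
  rw [integral_const_mul]
  exact le_of_eq (by ring)

/-- The Fourier multiplier theorem on dyadic scales: a smooth operator-valued symbol supported in
a ball of radius `4`, restricted to a dilated lattice, is a multiplier on trigonometric polynomials
in `L^p(𝕋ⁿ, E)`. -/
theorem exists_multiplier_const (n : ℕ) : ∃ K : ℝ, 0 ≤ K ∧
    ∀ {E : Type*} [NormedAddCommGroup E] [NormedSpace ℂ E] [CompleteSpace E] (p : ℝ≥0∞)
      [Fact (1 ≤ p)] (g : V n → E →L[ℂ] E),
      ContDiff ℝ (⊤ : ℕ∞) g → Function.support g ⊆ Metric.closedBall 0 4 →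
      ∀ B : ℝ, (∀ i ≤ n + 1, ∀ ξ, ‖iteratedFDeriv ℝ i g ξ‖ ≤ B) →
        ∀ (t : ℝ) (S : Finset (Fin n → ℤ)) (x : (Fin n → ℤ) → E),
          ‖∑ k ∈ S, mono p k (g (t • latticePt k) (x k))‖ ≤ K * B * ‖∑ k ∈ S, mono p k (x k)‖ := by
  obtain ⟨K, hK, h⟩ := exists_integral_norm_fourier_le n
  refine ⟨K, hK, fun {E} _ _ _ p _ g hg hs B hB t S x => ?_⟩
  obtain ⟨hgi, hFi, hle⟩ := h g hg hs B hB
  set G := FourierTransform.fourier g with hG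
  -- Fourier inversion: the factor `char k` at the point 2πt·w is exactly what translation by that
  -- point does to the k-th frequency, so the multiplier is an average of translations with operator
  -- weights `G w`.
  have hinv : ∀ k, g (t • latticePt k) = ∫ w, char k ((2 * Real.pi * t) • w) • G w := by
    intro k
    conv_lhs => rw [← hg.continuous.fourierInv_fourier_eq hgi hFi]
    rw [Real.fourierInv_eq']
    refine integral_congr_ae (ae_of_all _ fun w => ?_)
    simp only [hG]
    congr 1
    simp only [char, PiLp.smul_apply, smul_eq_mul, latticePt, inner_smul_right, PiLp.inner_apply,
      RCLike.inner_apply, conj_trivial]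
    congr 1
    push_cast
    rw [mul_comm _ Complex.I]
    simp only [Finset.mul_sum]
    refine Finset.sum_congr rfl fun j _ => by ring
  have hint : ∀ k, Integrable fun w => mono p k (char k ((2 * Real.pi * t) • w) • G w (x k)) := by
    intro k
    have hc : Continuous fun w : V n => char k ((2 * Real.pi * t) • w) :=
      (contDiff_char k).continuous.comp (continuous_const_smul _)
    have h1 : Integrable fun w => char k ((2 * Real.pi * t) • w) • G w := by
      refine hFi.norm.mono' (hc.aestronglyMeasurable.smul hFi.aestronglyMeasurable)
        (ae_of_all _ fun w => ?_)
      rw [norm_smul, norm_char, one_mul]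
    exact ((mono p k).comp (ContinuousLinearMap.apply ℂ E (x k))).integrable_comp h1
  have hsum : ∑ k ∈ S, mono p k (g (t • latticePt k) (x k)) =
      ∫ w, ∑ k ∈ S, mono p k (char k ((2 * Real.pi * t) • w) • G w (x k)) := by
    rw [integral_finsetSum _ fun k _ => hint k]
    refine Finset.sum_congr rfl fun k _ => ?_
    rw [hinv]
    have hc : Continuous fun w : V n => char k ((2 * Real.pi * t) • w) :=
      (contDiff_char k).continuous.comp (continuous_const_smul _)
    have h1 : Integrable fun w => char k ((2 * Real.pi * t) • w) • G w := by
      refine hFi.norm.mono' (hc.aestronglyMeasurable.smul hFi.aestronglyMeasurable)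
        (ae_of_all _ fun w => ?_)
      rw [norm_smul, norm_char, one_mul]
    exact (((mono p k).comp (ContinuousLinearMap.apply ℂ E (x k))).integral_comp_comm h1).symm
  rw [hsum]
  refine (norm_integral_le_integral_norm _).trans ?_
  calc ∫ w, ‖∑ k ∈ S, mono p k (char k ((2 * Real.pi * t) • w) • G w (x k))‖
      ≤ ∫ w, ‖G w‖ * ‖∑ k ∈ S, mono p k (x k)‖ := by
        refine integral_mono (integrable_finsetSum _ fun k _ => hint k).norm
          (hFi.norm.mul_const _) fun w => ?_
        dsimp only
        rw [norm_sum_mono_translate]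
        exact norm_sum_mono_clm_le p (G w) S x
    _ ≤ K * B * ‖∑ k ∈ S, mono p k (x k)‖ := by
        rw [integral_mul_const]
        gcongr

end Multiplier

/-! ### Lattice sums and periodic functions. -/

section Series

variable {n : ℕ}

theorem abs_le_norm_latticePt (k : Fin n → ℤ) (j : Fin n) : |(k j : ℝ)| ≤ ‖latticePt k‖ :=
  PiLp.norm_apply_le (latticePt k) j

theorem summable_int_inv_one_add_sq : Summable fun k : ℤ => (1 + (k : ℝ) ^ 2)⁻¹ := by
  have h1 : Summable fun k : ℤ => 1 / (k : ℝ) ^ 2 :=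
    Real.summable_one_div_int_pow.2 (by norm_num)
  refine Summable.of_norm_bounded_eventually h1 ?_
  have : ({0} : Set ℤ)ᶜ ∈ (cofinite : Filter ℤ) := (Set.finite_singleton 0).compl_mem_cofinite
  filter_upwards [this] with k hk
  have hk0 : (0 : ℝ) < (k : ℝ) ^ 2 := by
    have : (k : ℝ) ≠ 0 := by exact_mod_cast hk
    positivity
  rw [Real.norm_of_nonneg (by positivity), one_div]
  exact inv_anti₀ hk0 (by linarith)

/-- The exponent 2n is convenient because (1 + |k|)^{2n} dominates ∏(1 + k_j²), so the series is
bounded by a product of n one-dimensional convergent series. -/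
theorem summable_one_add_norm_latticePt (n : ℕ) :
    Summable fun k : Fin n → ℤ => ((1 + ‖latticePt k‖) ^ (2 * n))⁻¹ := by
  set f : ℤ → ℝ := fun k => (1 + (k : ℝ) ^ 2)⁻¹ with hf
  have hf0 : ∀ k, 0 ≤ f k := fun k => by positivity
  refine Summable.of_nonneg_of_le (f := fun k => ∏ j, f (k j)) (fun k => by positivity)
    (fun k => ?_) ?_
  · simp only [hf, Finset.prod_inv_distrib]
    refine inv_anti₀ (Finset.prod_pos fun j _ => by positivity) ?_
    calc ∏ j, (1 + (k j : ℝ) ^ 2) ≤ ∏ _j : Fin n, (1 + ‖latticePt k‖) ^ 2 := by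
          refine Finset.prod_le_prod (fun j _ => by positivity) fun j _ => ?_
          have h1 := abs_le_norm_latticePt k j
          have h2 : (k j : ℝ) ^ 2 ≤ ‖latticePt k‖ ^ 2 := by
            rw [← sq_abs]
            gcongr
          nlinarith [norm_nonneg (latticePt k)]
      _ = (1 + ‖latticePt k‖) ^ (2 * n) := by simp [pow_mul]
  · classical
    refine summable_of_sum_le (c := (∑' k, f k) ^ n) (fun k => Finset.prod_nonneg fun j _ => hf0 _)
      fun S => ?_
    calc ∑ k ∈ S, ∏ j, f (k j)
        ≤ ∑ k ∈ Fintype.piFinset fun j => S.image (fun k => k j), ∏ j, f (k j) := by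
          refine Finset.sum_le_sum_of_subset_of_nonneg (fun k hk => ?_)
            fun k _ _ => Finset.prod_nonneg fun j _ => hf0 _
          exact Fintype.mem_piFinset.2 fun j => Finset.mem_image_of_mem _ hk
      _ = ∏ j : Fin n, ∑ k ∈ S.image (fun k => k j), f k :=
          (Finset.prod_univ_sum _ _).symm
      _ ≤ ∏ _j : Fin n, ∑' k, f k := by
          refine Finset.prod_le_prod (fun j _ => Finset.sum_nonneg fun k _ => hf0 k) fun j _ => ?_
          exact summable_int_inv_one_add_sq.sum_le_tsum _ fun k _ => hf0 k
      _ = (∑' k, f k) ^ n := by simp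

/-- A continuous periodic function factors through the torus. -/
theorem exists_comp_torusProj {F : Type*} [TopologicalSpace F] {f : V n → F} (hf : Continuous f)
    (hp : ∀ x j, f (x + EuclideanSpace.single j (2 * Real.pi)) = f x) :
    ∃ g : C(UnitAddTorus (Fin n), F), ∀ x, g (torusProj x) = f x := by
  have hpi : (2 * Real.pi) ≠ 0 := by positivity
  have hint : ∀ (j : Fin n) (l : ℤ) x, f (x + EuclideanSpace.single j (l * (2 * Real.pi))) = f x := by
    intro j l
    induction l using Int.induction_on with
    | zero =>
      intro x
      have : EuclideanSpace.single j (((0 : ℤ) : ℝ) * (2 * Real.pi)) = (0 : V n) := by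
        ext i
        simp
      rw [this, add_zero]
    | succ l ih =>
      intro x
      have e : x + EuclideanSpace.single j (((l + 1 : ℤ) : ℝ) * (2 * Real.pi)) =
          x + EuclideanSpace.single j (((l : ℤ) : ℝ) * (2 * Real.pi)) +
            EuclideanSpace.single j (2 * Real.pi) := by
        rw [add_assoc, ← PiLp.single_add]
        congr 2
        push_cast
        ring
      rw [e, hp, ih]
    | pred l ih =>
      intro x
      have e : x + EuclideanSpace.single j (((-l - 1 : ℤ) : ℝ) * (2 * Real.pi)) +
          EuclideanSpace.single j (2 * Real.pi) =
          x + EuclideanSpace.single j (((-l : ℤ) : ℝ) * (2 * Real.pi)) := by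
        rw [add_assoc, ← PiLp.single_add]
        congr 2
        push_cast
        ring
      rw [← hp _ j, e, ih]
  have hsum : ∀ (S : Finset (Fin n)) (l : Fin n → ℤ) x,
      f (x + ∑ j ∈ S, EuclideanSpace.single j (l j * (2 * Real.pi))) = f x := by
    intro S l
    classical
    induction S using Finset.induction_on with
    | empty => simp
    | insert j S hj ih =>
      intro x
      rw [Finset.sum_insert hj, ← add_assoc, ih, hint]
  have hfac : ∀ x y : V n, torusProj x = torusProj y → f x = f y := by
    intro x y hxy
    have h1 : ∀ j, ∃ l : ℤ, l • (1 : ℝ) = x j / (2 * Real.pi) - y j / (2 * Real.pi) := fun j => by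
      have h2 := congrFun hxy j
      simp only [torusProj] at h2
      have h3 := (QuotientAddGroup.eq_iff_sub_mem).1 h2
      exact AddSubgroup.mem_zmultiples_iff.1 h3
    choose l hl using h1
    rw [← hsum Finset.univ l y]
    congr 1
    ext i
    have := hl i
    simp only [zsmul_eq_mul, mul_one] at this
    simp only [PiLp.add_apply, WithLp.ofLp_sum, Finset.sum_apply, PiLp.single_apply,
      Finset.sum_ite_eq, Finset.mem_univ, if_true]
    rw [this]
    field_simp
    ring
  let sec : UnitAddTorus (Fin n) → V n := fun y =>
    WithLp.toLp 2 fun j => 2 * Real.pi * (Quotient.out (y j))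
  have hsec : ∀ y, torusProj (sec y) = y := by
    intro y
    funext j
    simp only [torusProj, sec]
    rw [mul_div_cancel_left₀ _ hpi]
    exact Quotient.out_eq (y j)
  -- The section `sec` is not continuous. Continuity of the induced function is obtained from the
  -- projection being a quotient map.
  have hq : IsOpenQuotientMap (torusProj (n := n)) := by
    have h1 : IsOpenQuotientMap (fun (x : Fin n → ℝ) (j : Fin n) => ((x j : ℝ) : UnitAddCircle)) :=
      IsOpenQuotientMap.piMap fun _ => QuotientAddGroup.isOpenQuotientMap_mk
    let e : V n ≃ₜ (Fin n → ℝ) := (PiLp.homeomorph 2 (fun _ : Fin n => ℝ)).trans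
      (Homeomorph.smulOfNeZero (2 * Real.pi)⁻¹ (inv_ne_zero hpi))
    have h2 : (torusProj (n := n)) = (fun (x : Fin n → ℝ) (j : Fin n) => ((x j : ℝ) : UnitAddCircle)) ∘ e := by
      funext x j
      simp only [torusProj, Function.comp_apply, e, div_eq_inv_mul]
      rfl
    rw [h2]
    exact h1.comp e.isOpenQuotientMap
  refine ⟨⟨fun y => f (sec y), ?_⟩, fun x => hfac _ _ (hsec _)⟩
  rw [hq.isQuotientMap.continuous_iff]
  convert hf using 1
  funext x
  exact hfac _ _ (hsec _)

/-- Compactness of the torus: a continuous periodic function factors through it. -/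
theorem TestFun.exists_norm_le {F : Type*} [NormedAddCommGroup F] {f : V n → F} (hf : Continuous f)
    (hp : ∀ x j, f (x + EuclideanSpace.single j (2 * Real.pi)) = f x) : ∃ M, ∀ x, ‖f x‖ ≤ M := by
  obtain ⟨g, hg⟩ := exists_comp_torusProj hf hp
  exact ⟨‖g‖, fun x => hg x ▸ g.norm_coe_le_norm _⟩

theorem integrable_testFun (f : TestFun n) : Integrable (f : V n → ℂ) (torusMeasure n) := by
  obtain ⟨M, hM⟩ := TestFun.exists_norm_le f.2.1.continuous f.2.2
  exact Integrable.of_bound f.2.1.continuous.aestronglyMeasurable M (ae_of_all _ hM)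

end Series

/-! ### Fourier coefficients and Fourier series of test functions. -/

section TestFunctions

variable {n : ℕ}

theorem torusProj_add (x y : V n) : torusProj (x + y) = torusProj x + torusProj y := by
  funext j
  simp only [torusProj, PiLp.add_apply, Pi.add_apply, add_div]
  exact AddCircle.coe_add _ _ _

theorem integral_comp_torusProj {F : Type*} [NormedAddCommGroup F] [NormedSpace ℝ F]
    (g : C(UnitAddTorus (Fin n), F)) :
    ∫ x, g (torusProj x) ∂(torusMeasure n) = ∫ y, g y := by
  rw [← (measurePreserving_torusProj n).map_eq,
    integral_map continuous_torusProj.measurable.aemeasurable g.continuous.aestronglyMeasurable]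

theorem integral_testFun_translate (f : TestFun n) (h : V n) :
    ∫ x, (f : V n → ℂ) (x + h) ∂(torusMeasure n) = ∫ x, (f : V n → ℂ) x ∂(torusMeasure n) := by
  obtain ⟨g, hg⟩ := exists_comp_torusProj f.2.1.continuous f.2.2
  simp only [← hg, torusProj_add]
  rw [integral_comp_torusProj]
  refine (integral_comp_torusProj (g.comp ⟨fun y => y + torusProj h, continuous_add_const _⟩)).trans ?_
  exact integral_add_right_eq_self (μ := (volume : Measure (UnitAddTorus (Fin n)))) g (torusProj h)

theorem fderiv_testFun_periodic (f : TestFun n) (x : V n) (i : Fin n) :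
    fderiv ℝ (f : V n → ℂ) (x + EuclideanSpace.single i (2 * Real.pi)) =
      fderiv ℝ (f : V n → ℂ) x := by
  rw [← fderiv_comp_add_right]
  congr 1
  exact funext fun y => f.2.2 y i

/-- The integral of a partial derivative of a periodic function vanishes. -/
theorem integral_fderiv_testFun (f : TestFun n) (v : V n) :
    ∫ x, fderiv ℝ (f : V n → ℂ) x v ∂(torusMeasure n) = 0 := by
  have hc : Continuous (fderiv ℝ (f : V n → ℂ)) := f.2.1.continuous_fderiv (by simp)
  obtain ⟨M, hM⟩ := TestFun.exists_norm_le hc (fderiv_testFun_periodic f)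
  have hd : ∀ x, HasFDerivAt (f : V n → ℂ) (fderiv ℝ (f : V n → ℂ) x) x := fun x =>
    (f.2.1.differentiable (by simp) x).hasFDerivAt
  -- The integral of x ↦ f(x + h v) does not depend on h. Differentiating it under the integral sign
  -- at h = 0 yields the claim.
  have h := hasDerivAt_integral_of_dominated_loc_of_deriv_le (μ := torusMeasure n) (𝕜 := ℝ)
    (F := fun (h : ℝ) x => (f : V n → ℂ) (x + h • v)) (x₀ := 0) (s := univ)
    (F' := fun h x => fderiv ℝ (f : V n → ℂ) (x + h • v) v) (bound := fun _ => M * ‖v‖)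
    univ_mem (Eventually.of_forall fun h =>
      (f.2.1.continuous.comp (continuous_add_const _)).aestronglyMeasurable)
    (by simpa using integrable_testFun f)
    ((hc.comp (continuous_add_const _)).clm_apply continuous_const).aestronglyMeasurable
    (ae_of_all _ fun x h _ => ((fderiv ℝ (f : V n → ℂ) _).le_opNorm v).trans
      (mul_le_mul_of_nonneg_right (hM _) (norm_nonneg v)))
    (integrable_const _)
    (ae_of_all _ fun x h _ => by
      have h1 : HasDerivAt (fun h : ℝ => x + h • v) v h := by
        simpa using ((hasDerivAt_id h).smul_const v).const_add x
      exact (hd _).comp_hasDerivAt h h1)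
  have h2 := h.2
  simp only [integral_testFun_translate, zero_smul, add_zero] at h2
  exact h2.unique (hasDerivAt_const _ _)

/-- The `k`-th Fourier coefficient of a test function. -/
def testCoef (k : Fin n → ℤ) : TestFun n →ₗ[ℂ] ℂ where
  toFun f := ∫ x, char (-k) x * (f : V n → ℂ) x ∂(torusMeasure n)
  map_add' f g := by
    have hi : ∀ f : TestFun n, Integrable (fun x => char (-k) x * (f : V n → ℂ) x)
        (torusMeasure n) := fun f =>
      (integrable_testFun f).bdd_mul (contDiff_char _).continuous.aestronglyMeasurable
        (ae_of_all _ fun x => (norm_char (-k) x).le)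
    simp only [Submodule.coe_add, Pi.add_apply, mul_add]
    exact integral_add (hi f) (hi g)
  map_smul' c f := by
    simp only [Submodule.coe_smul, Pi.smul_apply, smul_eq_mul, RingHom.id_apply]
    rw [← integral_const_mul]
    congr 1
    funext x
    ring

theorem norm_testCoef_le (k : Fin n → ℤ) (f : TestFun n) (B : ℝ) (hB : ∀ x, ‖(f : V n → ℂ) x‖ ≤ B) :
    ‖testCoef k f‖ ≤ B := by
  have := norm_integral_le_of_norm_le_const (μ := torusMeasure n)
    (f := fun x => char (-k) x * (f : V n → ℂ) x) (C := B) (ae_of_all _ fun x => by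
      rw [norm_mul, norm_char, one_mul]; exact hB x)
  rw [probReal_univ, mul_one] at this
  exact this

/-- The linear functional `v ↦ i k·v`. -/
def charDeriv (k : Fin n → ℤ) : V n →L[ℝ] ℂ :=
  Complex.I • Complex.ofRealCLM.comp (innerSL ℝ (latticePt k))

theorem charDeriv_apply (k : Fin n → ℤ) (v : V n) :
    charDeriv k v = Complex.I * ((∑ j, (k j : ℝ) * v j : ℝ) : ℂ) := by
  simp [charDeriv, latticePt, PiLp.inner_apply, mul_comm]

theorem norm_charDeriv_le (k : Fin n → ℤ) : ‖charDeriv k‖ ≤ ‖latticePt k‖ := by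
  refine ContinuousLinearMap.opNorm_le_bound _ (norm_nonneg _) fun v => ?_
  have : ‖charDeriv k v‖ = ‖inner ℝ (latticePt k) v‖ := by
    simp [charDeriv]
  rw [this]
  exact norm_inner_le_norm _ _

theorem hasFDerivAt_char (k : Fin n → ℤ) (x : V n) :
    HasFDerivAt (char k) (char k x • charDeriv k) x := by
  have h : char k = fun x => Complex.exp (charDeriv k x) := by
    funext x
    rw [charDeriv_apply, char]
  rw [h]
  exact (charDeriv k).hasFDerivAt.cexp

theorem norm_iteratedFDeriv_char_le (k : Fin n → ℤ) (i : ℕ) (x : V n) :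
    ‖iteratedFDeriv ℝ i (char k) x‖ ≤ ‖latticePt k‖ ^ i := by
  induction i with
  | zero => simp [norm_char]
  | succ i ih =>
    rw [← norm_iteratedFDeriv_fderiv]
    have h : fderiv ℝ (char k) =
        (ContinuousLinearMap.smulRight (1 : ℂ →L[ℝ] ℂ) (charDeriv k)) ∘ char k := by
      funext y
      rw [(hasFDerivAt_char k y).fderiv]
      rfl
    rw [h]
    refine (ContinuousLinearMap.norm_iteratedFDeriv_comp_left _
      ((contDiff_char k).contDiffAt (x := x)) (n := i) (by exact_mod_cast le_top)).trans ?_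
    rw [pow_succ']
    gcongr
    refine ContinuousLinearMap.opNorm_le_bound _ (norm_nonneg _) fun c => ?_
    change ‖c • charDeriv k‖ ≤ _
    rw [norm_smul, mul_comm]
    gcongr
    exact norm_charDeriv_le k

theorem testD_charTest (j : Fin n) (k : Fin n → ℤ) :
    testD j (charTest k) = (k j : ℂ) • charTest k := by
  ext x
  change -Complex.I * fderiv ℝ (char k) x (EuclideanSpace.single j 1) = (k j : ℂ) * char k x
  rw [(hasFDerivAt_char k x).fderiv, smul_apply, charDeriv_apply]
  simp only [PiLp.single_apply, mul_ite, mul_one, mul_zero, Finset.sum_ite_eq', Finset.mem_univ,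
    if_true, smul_eq_mul]
  push_cast
  linear_combination (-(k j : ℂ) * char k x) * Complex.I_mul_I

/-- Integration by parts, in the form that the partial derivative of the periodic function e_{-k} f
has integral 0. -/
theorem testCoef_testD (k : Fin n → ℤ) (j : Fin n) (f : TestFun n) :
    testCoef k (testD j f) = (k j : ℂ) * testCoef k f := by
  let G : TestFun n := ⟨fun x => char (-k) x * (f : V n → ℂ) x, (contDiff_char _).mul f.2.1,
    fun x i => by simp only [char_periodic, f.2.2]⟩
  have h := integral_fderiv_testFun G (EuclideanSpace.single j 1)
  have h1 : ∀ x, fderiv ℝ (G : V n → ℂ) x (EuclideanSpace.single j 1) =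
      Complex.I * (char (-k) x * (testD j f : V n → ℂ) x - (k j : ℂ) *
        (char (-k) x * (f : V n → ℂ) x)) := by
    intro x
    have h2 : HasFDerivAt (G : V n → ℂ) _ x := (hasFDerivAt_char (-k) x).mul
      (f.2.1.differentiable (by simp) x).hasFDerivAt
    rw [h2.fderiv]
    change _ = Complex.I * (char (-k) x * (-Complex.I * fderiv ℝ (f : V n → ℂ) x
      (EuclideanSpace.single j 1)) - _)
    simp only [add_apply, smul_apply, charDeriv_apply,
      PiLp.single_apply, mul_ite, mul_one, mul_zero, Finset.sum_ite_eq', Finset.mem_univ,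
      if_true, smul_eq_mul, Pi.neg_apply]
    push_cast
    linear_combination ((char (-k) x) * fderiv ℝ (f : V n → ℂ) x
      (EuclideanSpace.single j 1)) * Complex.I_mul_I
  have hi : ∀ f : TestFun n, Integrable (fun x => char (-k) x * (f : V n → ℂ) x)
      (torusMeasure n) := fun f =>
    (integrable_testFun f).bdd_mul (contDiff_char _).continuous.aestronglyMeasurable
      (ae_of_all _ fun x => (norm_char (-k) x).le)
  simp only [h1] at h
  rw [integral_const_mul, integral_sub (hi _) ((hi f).const_mul _), integral_const_mul,
    mul_eq_zero, or_iff_right Complex.I_ne_zero, sub_eq_zero] at h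
  exact h

/-- Off the diagonal no integral is computed: evaluating the coefficient of D_j e_l in two ways
gives (l_j - k_j) times the coefficient equal to 0, for a j with k_j ≠ l_j. -/
theorem testCoef_charTest (k l : Fin n → ℤ) :
    testCoef k (charTest l) = if k = l then 1 else 0 := by
  split_ifs with h
  · subst h
    have : ∀ x : V n, char (-k) x * char k x = 1 := fun x => by
      simp only [char]
      rw [← Complex.exp_add]
      simp [Finset.sum_neg_distrib]
    change ∫ x, char (-k) x * char k x ∂(torusMeasure n) = 1
    simp [this]
  · obtain ⟨j, hj⟩ := Function.ne_iff.1 h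
    have h1 := testCoef_testD k j (charTest l)
    rw [testD_charTest, map_smul, smul_eq_mul, ← sub_eq_zero, ← sub_mul, mul_eq_zero] at h1
    refine h1.resolve_left fun h2 => hj ?_
    exact_mod_cast (sub_eq_zero.1 h2).symm

theorem norm_iteratedFDeriv_testD_le (j : Fin n) (f : TestFun n) (i : ℕ) (x : V n) :
    ‖iteratedFDeriv ℝ i (testD j f : V n → ℂ) x‖ ≤ ‖iteratedFDeriv ℝ (i + 1) (f : V n → ℂ) x‖ := by
  have hf : ContDiff ℝ (⊤ : ℕ∞) (fderiv ℝ (f : V n → ℂ)) := f.2.1.fderiv_right (m := (⊤ : ℕ∞)) le_rfl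
  have hc : ContDiff ℝ (⊤ : ℕ∞)
      (fun y => fderiv ℝ (f : V n → ℂ) y (EuclideanSpace.single j 1)) :=
    hf.clm_apply contDiff_const
  have hi' : ((i : ℕ∞) : WithTop ℕ∞) ≤ (⊤ : ℕ∞) := by exact_mod_cast le_top
  have e : ((testD j f : TestFun n) : V n → ℂ) = (-Complex.I) •
      (fun y => fderiv ℝ (f : V n → ℂ) y (EuclideanSpace.single j 1)) := rfl
  rw [e, iteratedFDeriv_const_smul_apply (hc.contDiffAt.of_le hi'), norm_smul, norm_neg,
    Complex.norm_I, one_mul]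
  refine (norm_iteratedFDeriv_clm_apply_const (hf.contDiffAt) hi').trans ?_
  rw [norm_iteratedFDeriv_fderiv, PiLp.norm_single, norm_one, one_mul]

theorem testCoef_testD_pow (k : Fin n → ℤ) (j : Fin n) (a : ℕ) (f : TestFun n) :
    testCoef k ((testD j ^ a) f) = (k j : ℂ) ^ a * testCoef k f := by
  induction a with
  | zero => simp
  | succ a ih => rw [pow_succ', Module.End.mul_apply, testCoef_testD, ih, pow_succ', mul_assoc]

theorem norm_testD_pow_le (j : Fin n) (a i : ℕ) (f : TestFun n) (x : V n) :
    ‖iteratedFDeriv ℝ i ((testD j ^ a) f : V n → ℂ) x‖ ≤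
      ‖iteratedFDeriv ℝ (i + a) (f : V n → ℂ) x‖ := by
  induction a generalizing i with
  | zero => simp
  | succ a ih =>
    rw [pow_succ', Module.End.mul_apply]
    refine (norm_iteratedFDeriv_testD_le j _ i x).trans ((ih (i + 1)).trans (le_of_eq ?_))
    rw [show i + 1 + a = i + (a + 1) by ring]

theorem norm_latticePt_le (k : Fin n → ℤ) : ‖latticePt k‖ ≤ ∑ j, |(k j : ℝ)| := by
  have h : latticePt k = ∑ j, EuclideanSpace.single j (k j : ℝ) := by
    ext i
    simp [latticePt]
  rw [h]
  refine (norm_sum_le _ _).trans (le_of_eq ?_)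
  simp

/-- Fourier coefficients of test functions decay rapidly, with control by finitely many
derivatives. -/
theorem exists_norm_testCoef_le (n N : ℕ) : ∃ C : ℝ, 0 ≤ C ∧ ∀ (f : TestFun n) (B : ℝ),
    (∀ i ≤ N, ∀ x, ‖iteratedFDeriv ℝ i (f : V n → ℂ) x‖ ≤ B) →
      ∀ k, ‖testCoef k f‖ ≤ C * B * ((1 + ‖latticePt k‖) ^ N)⁻¹ := by
  refine ⟨((n : ℝ) + 1) ^ N, by positivity, fun f B hB k => ?_⟩
  have hB0 : 0 ≤ B := (norm_nonneg _).trans (hB 0 (by omega) 0)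
  have h1 : ∀ j, |(k j : ℝ)| ^ N * ‖testCoef k f‖ ≤ B := by
    intro j
    have h2 := norm_testCoef_le k ((testD j ^ N) f) B fun x => by
      have := norm_testD_pow_le j N 0 f x
      rw [norm_iteratedFDeriv_zero, zero_add] at this
      exact this.trans (hB N le_rfl x)
    rw [testCoef_testD_pow, norm_mul, norm_pow] at h2
    simpa using h2
  have h0 : ‖testCoef k f‖ ≤ B := norm_testCoef_le k f B fun x => by
    simpa using hB 0 (by omega) x
  rw [← div_eq_mul_inv, le_div_iff₀ (by positivity)]
  -- Here b = max(1, max_j |k_j|): the derivative in the direction of the largest coordinate yields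
  -- the decay, and 1 + |k| ≤ (n + 1) b. In dimension 0 there is no coordinate and b = 1.
  obtain ⟨b, hb1, hbn, hb⟩ : ∃ b : ℝ, (1 : ℝ) ≤ b ∧ (∀ j, |(k j : ℝ)| ≤ b) ∧
      ‖testCoef k f‖ * b ^ N ≤ B := by
    rcases isEmpty_or_nonempty (Fin n) with he | he
    · exact ⟨1, le_rfl, fun j => he.elim j, by simpa using h0⟩
    · obtain ⟨j, hj⟩ := Finite.exists_max fun j => |(k j : ℝ)|
      refine ⟨max 1 |(k j : ℝ)|, le_max_left _ _, fun i => (hj i).trans (le_max_right _ _), ?_⟩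
      rcases max_choice 1 |(k j : ℝ)| with h | h <;> rw [h]
      · simpa using h0
      · rw [mul_comm]; exact h1 j
  have h3 : 1 + ‖latticePt k‖ ≤ (n + 1) * b := by
    have h4 : ∑ j, |(k j : ℝ)| ≤ n * b := by
      refine (Finset.sum_le_sum fun j _ => hbn j).trans ?_
      simp
    linarith [norm_latticePt_le k]
  calc ‖testCoef k f‖ * (1 + ‖latticePt k‖) ^ N ≤ ‖testCoef k f‖ * ((n + 1) * b) ^ N := by gcongr
    _ = (n + 1) ^ N * (‖testCoef k f‖ * b ^ N) := by rw [mul_pow]; ring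
    _ ≤ (n + 1) ^ N * B := by gcongr

theorem exists_testFun_bound (f : TestFun n) (N : ℕ) :
    ∃ B : ℝ, ∀ i ≤ N, ∀ x, ‖iteratedFDeriv ℝ i (f : V n → ℂ) x‖ ≤ B := by
  have h : ∀ i : ℕ, ∃ M, ∀ x, ‖iteratedFDeriv ℝ i (f : V n → ℂ) x‖ ≤ M := fun i =>
    TestFun.exists_norm_le (f.2.1.continuous_iteratedFDeriv (by exact_mod_cast le_top))
      fun x j => by
        rw [← iteratedFDeriv_comp_add_right]
        congr 1
        exact funext fun y => f.2.2 y j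
  choose M hM using h
  refine ⟨∑ i ∈ Finset.range (N + 1), M i, fun i hi x => (hM i x).trans ?_⟩
  exact Finset.single_le_sum (fun i _ => (norm_nonneg _).trans (hM i 0))
    (Finset.mem_range.2 (by omega))

/-- Decay of order 2n + N leaves the summable weight (1 + |k|)^{-2n} after multiplication by (1 +
|k|)^N. This is what makes the Fourier series converge with all derivatives. -/
theorem summable_testCoef (f : TestFun n) (N : ℕ) :
    Summable fun k => ‖testCoef k f‖ * (1 + ‖latticePt k‖) ^ N := by
  obtain ⟨C, hC, h⟩ := exists_norm_testCoef_le n (2 * n + N)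
  obtain ⟨B, hB⟩ := exists_testFun_bound f (2 * n + N)
  refine Summable.of_nonneg_of_le (fun k => by positivity) (fun k => ?_)
    ((summable_one_add_norm_latticePt n).mul_left (C * B))
  refine (mul_le_mul_of_nonneg_right (h f B hB k) (by positivity)).trans (le_of_eq ?_)
  have : (0 : ℝ) < 1 + ‖latticePt k‖ := by positivity
  rw [pow_add]
  field_simp

theorem hasSum_testCoef (f : TestFun n) (x : V n) :
    HasSum (fun k => testCoef k f * char k x) ((f : V n → ℂ) x) := by
  obtain ⟨g, hg⟩ := exists_comp_torusProj f.2.1.continuous f.2.2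
  have hc : ∀ k, UnitAddTorus.mFourierCoeff (⇑g) k = testCoef k f := by
    intro k
    change ∫ y, UnitAddTorus.mFourier (-k) y • g y = _
    have := integral_comp_torusProj (UnitAddTorus.mFourier (-k) * g)
    simp only [ContinuousMap.mul_apply, ← char_eq_mFourier, hg] at this
    exact this.symm
  have hs : Summable (UnitAddTorus.mFourierCoeff (⇑g)) := by
    have h1 := summable_testCoef f 0
    simp only [pow_zero, mul_one] at h1
    refine Summable.of_norm ?_
    simpa only [hc] using h1
  have h := UnitAddTorus.hasSum_mFourier_series_apply_of_summable hs (torusProj x)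
  simpa only [hc, ← char_eq_mFourier, hg, smul_eq_mul] using h

end TestFunctions

/-! ### Periodic distributions as coefficient sequences of polynomial growth. -/

section DistributionCoefficients

variable {n : ℕ} {E : Type*} [NormedAddCommGroup E] [NormedSpace ℂ E]

/-- The Fourier series of a test function converges in `C^∞`. -/
theorem norm_iteratedFDeriv_sub_sum_testCoef_le (f : TestFun n) (S : Finset (Fin n → ℤ)) (N i : ℕ)
    (hi : i ≤ N) (x : V n) :
    ‖iteratedFDeriv ℝ i ((f - ∑ k ∈ S, testCoef k f • charTest k : TestFun n) : V n → ℂ) x‖ ≤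
      ∑' k : {k // k ∉ S}, ‖testCoef k.1 f‖ * (1 + ‖latticePt k.1‖) ^ N := by
  have hsum : ((f - ∑ k ∈ S, testCoef k f • charTest k : TestFun n) : V n → ℂ) =
      fun x => ∑' k : {k // k ∉ S}, testCoef k.1 f * char k.1 x := by
    funext y
    have h1 := hasSum_testCoef f y
    have h2 := h1.summable.sum_add_tsum_subtype_compl S
    rw [h1.tsum_eq] at h2
    have h3 : ((f - ∑ k ∈ S, testCoef k f • charTest k : TestFun n) : V n → ℂ) y =
        (f : V n → ℂ) y - ∑ k ∈ S, testCoef k f * char k y := by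
      simp only [Submodule.coe_sub, Submodule.coe_sum, Submodule.coe_smul, Pi.sub_apply,
        Finset.sum_apply, Pi.smul_apply, smul_eq_mul]
      rfl
    rw [h3, ← h2]
    simp
  have hder : ∀ (i : ℕ) (k : Fin n → ℤ) (x : V n),
      ‖iteratedFDeriv ℝ i (fun x => testCoef k f * char k x) x‖ ≤
        ‖testCoef k f‖ * (1 + ‖latticePt k‖) ^ i := by
    intro i k x
    have e : (fun x => testCoef k f * char k x) = testCoef k f • char k := rfl
    rw [e, iteratedFDeriv_const_smul_apply
      ((contDiff_char k).contDiffAt.of_le (by exact_mod_cast le_top)), norm_smul]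
    gcongr
    refine (norm_iteratedFDeriv_char_le k i x).trans ?_
    gcongr
    linarith
  have hS : ∀ i : ℕ, Summable fun k : {k // k ∉ S} =>
      ‖testCoef k.1 f‖ * (1 + ‖latticePt k.1‖) ^ i := fun i =>
    (summable_testCoef f i).subtype _
  rw [hsum, iteratedFDeriv_tsum_apply (N := ⊤)
    (v := fun i (k : {k // k ∉ S}) => ‖testCoef k.1 f‖ * (1 + ‖latticePt k.1‖) ^ i)
    (fun k => contDiff_const.mul (contDiff_char k.1)) (fun i _ => hS i)
    (fun i k x _ => hder i k.1 x) le_top]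
  refine (tsum_of_norm_bounded (hS i).hasSum fun k => hder i k.1 x).trans ?_
  refine (hS i).tsum_le_tsum (fun k => ?_) (hS N)
  gcongr
  linarith [norm_nonneg (latticePt k.1)]

/-- A distribution is continuous for the convergence of Fourier series in C^∞, so it can be applied
termwise. The sign in `fourierCoef (-k)` arises because the coefficient at k is the value on e_{-k}.
-/
theorem hasSum_distr (u : Distr n E) (f : TestFun n) :
    HasSum (fun k => testCoef k f • fourierCoef (-k) u) ((u : TestFun n →ₗ[ℂ] E) f) := by
  obtain ⟨N, C, hu⟩ := u.2
  have h0 := (tendsto_tsum_compl_atTop_zero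
    fun k : Fin n → ℤ => ‖testCoef k f‖ * (1 + ‖latticePt k‖) ^ N).const_mul C
  rw [mul_zero] at h0
  rw [HasSum, SummationFilter.unconditional_filter, tendsto_iff_norm_sub_tendsto_zero]
  refine squeeze_zero (fun S => norm_nonneg _) (fun S => ?_) h0
  have h1 : ∑ k ∈ S, testCoef k f • fourierCoef (-k) u =
      (u : TestFun n →ₗ[ℂ] E) (∑ k ∈ S, testCoef k f • charTest k) := by
    rw [map_sum]
    refine Finset.sum_congr rfl fun k _ => ?_
    rw [map_smul]
    change _ • (u : TestFun n →ₗ[ℂ] E) (charTest (- -k)) = _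
    rw [neg_neg]
  rw [h1, norm_sub_rev, ← map_sub]
  exact hu _ _ fun i hi x => norm_iteratedFDeriv_sub_sum_testCoef_le f S N i hi x

/-- A periodic distribution is determined by its Fourier coefficients. -/
theorem Distr.ext_coef {u v : Distr n E} (h : ∀ k, fourierCoef k u = fourierCoef k v) : u = v := by
  refine Subtype.ext (LinearMap.ext fun f => ?_)
  have h1 := hasSum_distr u f
  simp only [h] at h1
  exact h1.unique (hasSum_distr v f)

theorem norm_latticePt_neg (k : Fin n → ℤ) : ‖latticePt (-k)‖ = ‖latticePt k‖ := by
  have : latticePt (-k) = -latticePt k := by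
    ext i
    simp [latticePt]
  rw [this, norm_neg]

/-- The Fourier coefficients of a distribution grow at most polynomially. -/
theorem exists_norm_fourierCoef_le (u : Distr n E) :
    ∃ (N : ℕ) (C : ℝ), ∀ k, ‖fourierCoef k u‖ ≤ C * (1 + ‖latticePt k‖) ^ N := by
  obtain ⟨N, C, hu⟩ := u.2
  refine ⟨N, C, fun k => hu _ _ fun i hi x => ?_⟩
  refine (norm_iteratedFDeriv_char_le (-k) i x).trans ?_
  rw [norm_latticePt_neg]
  calc ‖latticePt k‖ ^ i ≤ (1 + ‖latticePt k‖) ^ i := by gcongr; linarith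
    _ ≤ (1 + ‖latticePt k‖) ^ N := by
      gcongr
      linarith [norm_nonneg (latticePt k)]

/-- A sequence of polynomial growth is the sequence of Fourier coefficients of a distribution. -/
theorem exists_distr_of_coef [CompleteSpace E] (c : (Fin n → ℤ) → E) (N : ℕ) (C : ℝ)
    (hc : ∀ k, ‖c k‖ ≤ C * (1 + ‖latticePt k‖) ^ N) : ∃ u : Distr n E, ∀ k, fourierCoef k u = c k := by
  have hC : 0 ≤ C := by
    have h := (norm_nonneg _).trans (hc 0)
    exact nonneg_of_mul_nonneg_left h (by positivity)
  have hb : ∀ f : TestFun n, ∀ k, ‖testCoef k f • c (-k)‖ ≤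
      C * (‖testCoef k f‖ * (1 + ‖latticePt k‖) ^ N) := fun f k => by
    rw [norm_smul, mul_left_comm]
    gcongr
    exact norm_latticePt_neg k ▸ hc (-k)
  have hs : ∀ f : TestFun n, Summable fun k => testCoef k f • c (-k) := fun f =>
    Summable.of_norm_bounded ((summable_testCoef f N).mul_left C) (hb f)
  let u : TestFun n →ₗ[ℂ] E :=
    { toFun := fun f => ∑' k, testCoef k f • c (-k)
      map_add' := fun f g => by
        simp only [map_add, add_smul]
        exact (hs f).tsum_add (hs g)
      map_smul' := fun a f => by
        simp only [map_smul, smul_eq_mul, mul_smul, RingHom.id_apply]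
        exact (hs f).tsum_const_smul a }
  -- The distribution has order at most 2n + N: N derivatives absorb the growth of the coefficients
  -- and 2n make the series converge.
  obtain ⟨D, hD, hdec⟩ := exists_norm_testCoef_le n (2 * n + N)
  have hu : IsDistribution u := by
    refine ⟨2 * n + N, C * D * ∑' k : Fin n → ℤ, ((1 + ‖latticePt k‖) ^ (2 * n))⁻¹,
      fun f B hB => ?_⟩
    have h1 : ∀ k, ‖testCoef k f • c (-k)‖ ≤ C * D * B * ((1 + ‖latticePt k‖) ^ (2 * n))⁻¹ := by
      intro k
      refine (hb f k).trans ?_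
      have h2 := mul_le_mul_of_nonneg_right (hdec f B hB k)
        (show 0 ≤ (1 + ‖latticePt k‖) ^ N by positivity)
      rw [mul_assoc C D, mul_assoc C]
      refine mul_le_mul_of_nonneg_left (h2.trans (le_of_eq ?_)) hC
      have : (0 : ℝ) < 1 + ‖latticePt k‖ := by positivity
      rw [pow_add]
      field_simp
    refine (tsum_of_norm_bounded
      ((summable_one_add_norm_latticePt n).mul_left _).hasSum h1).trans (le_of_eq ?_)
    rw [tsum_mul_left]
    ring
  refine ⟨⟨u, hu⟩, fun k => ?_⟩
  change ∑' l, testCoef l (charTest (-k)) • c (-l) = c k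
  rw [tsum_eq_single (-k)]
  · rw [testCoef_charTest, if_pos rfl, one_smul, neg_neg]
  · intro l hl
    rw [testCoef_charTest, if_neg hl, zero_smul]

/-- The Fourier multiplier with bounded symbol `M`, acting on distributions. -/
theorem exists_multiplierOp [CompleteSpace E] (M : (Fin n → ℤ) → E →L[ℂ] E) (C : ℝ)
    (hM : ∀ k, ‖M k‖ ≤ C) :
    ∃ T : Distr n E →ₗ[ℂ] Distr n E, ∀ u k, fourierCoef k (T u) = M k (fourierCoef k u) := by
  have h : ∀ u : Distr n E, ∃ v : Distr n E, ∀ k, fourierCoef k v = M k (fourierCoef k u) := by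
    intro u
    obtain ⟨N, K, hu⟩ := exists_norm_fourierCoef_le u
    refine exists_distr_of_coef _ N (C * K) fun k => ?_
    refine ((M k).le_opNorm _).trans ?_
    rw [mul_assoc]
    have := (norm_nonneg _).trans (hM k)
    gcongr
    exacts [hM k, hu k]
  choose T hT using h
  refine ⟨{ toFun := T, map_add' := fun u v => ?_, map_smul' := fun c u => ?_ }, hT⟩
  · exact Distr.ext_coef fun k => by simp only [map_add, hT]
  · exact Distr.ext_coef fun k => by simp only [map_smul, hT, RingHom.id_apply]

/-! #### Fourier coefficients of differential operators -/

theorem testDpow_charTest (α : Fin n → ℕ) (k : Fin n → ℤ) :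
    testDpow α (charTest k) = (∏ j, (k j : ℂ) ^ α j) • charTest k := by
  have hpow : ∀ (j : Fin n) (a : ℕ), (testD j ^ a) (charTest k) = (k j : ℂ) ^ a • charTest k := by
    intro j a
    induction a with
    | zero => simp
    | succ a ih =>
      rw [pow_succ', Module.End.mul_apply, ih, map_smul, testD_charTest, smul_smul, pow_succ]
  have hl : ∀ l : List (Fin n), ((l.map fun j => testD j ^ α j).prod) (charTest k) =
      (l.map fun j => (k j : ℂ) ^ α j).prod • charTest k := by
    intro l
    induction l with
    | nil => simp
    | cons j l ih =>
      simp only [List.map_cons, List.prod_cons, Module.End.mul_apply, ih, map_smul, hpow, smul_smul]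
      rw [mul_comm]
  rw [testDpow, List.ofFn_eq_map, hl, ← List.ofFn_eq_map, List.prod_ofFn]

/-- The sign (-1)^{|α|} of the transposed derivative cancels the one in (-k)^α, which comes from
evaluating on e_{-k}. -/
theorem fourierCoef_distrD (α : Fin n → ℕ) (u : Distr n E) (k : Fin n → ℤ) :
    fourierCoef k (distrD α u) = (∏ j, (k j : ℂ) ^ α j) • fourierCoef k u := by
  change (-1 : ℂ) ^ (∑ j, α j) • (u : TestFun n →ₗ[ℂ] E) (testDpow α (charTest (-k))) = _
  rw [testDpow_charTest, map_smul, smul_smul]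
  congr 1
  rw [← Finset.prod_pow_eq_pow_sum, ← Finset.prod_mul_distrib]
  refine Finset.prod_congr rfl fun j _ => ?_
  rw [← mul_pow]
  simp

/-- The full symbol `∑_{|α| ≤ m} a_α ξ^α`. -/
def fullSymbol (m : ℕ) (a : (Fin n → ℕ) → E →L[ℂ] E) (ξ : V n) : E →L[ℂ] E :=
  ∑ i ∈ Finset.range (m + 1), principalSymbol i a ξ

theorem fourierCoef_diffOp (m : ℕ) (a : (Fin n → ℕ) → E →L[ℂ] E) (u : Distr n E)
    (k : Fin n → ℤ) :
    fourierCoef k (diffOp m a u) = fullSymbol m a (latticePt k) (fourierCoef k u) := by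
  simp only [diffOp, fullSymbol, principalSymbol, LinearMap.sum_apply, map_sum,
    sum_apply]
  refine Finset.sum_congr rfl fun i _ => Finset.sum_congr rfl fun α _ => ?_
  have h1 : fourierCoef k ((distrCoeff (a α) ∘ₗ distrD α) u) =
      a α (fourierCoef k (distrD α u)) := rfl
  rw [h1, fourierCoef_distrD, map_smul]
  simp [latticePt]

end DistributionCoefficients

/-! ### Finite overlap estimates in ℓ^q. -/

section Sequences

/-- The dyadic indices at distance at most `2` from `j`. -/
def nbhd (j : ℕ) : Finset ℕ := Finset.Icc (j - 2) (j + 2)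

theorem mem_nbhd {i j : ℕ} : i ∈ nbhd j ↔ j ≤ i + 2 ∧ i ≤ j + 2 := by
  simp only [nbhd, Finset.mem_Icc]
  omega

theorem mem_nbhd_comm {i j : ℕ} : i ∈ nbhd j ↔ j ∈ nbhd i := by
  simp only [mem_nbhd]
  omega

theorem card_nbhd_le (j : ℕ) : (nbhd j).card ≤ 5 := by
  simp only [nbhd, Nat.card_Icc]
  omega

theorem sum_nbhd_le (f : ℕ → ℝ) (c : ℝ) (hc : 0 ≤ c) (j : ℕ) (hf : ∀ i ∈ nbhd j, f i ≤ c) :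
    ∑ i ∈ nbhd j, f i ≤ 5 * c := by
  refine (Finset.sum_le_card_nsmul _ _ c hf).trans ?_
  rw [nsmul_eq_mul]
  gcongr
  exact_mod_cast card_nbhd_le j

/-- Each of the at most five terms is bounded by the r-th root of the sum of r-th powers. This crude
form, with 5^r, is valid for all r > 0. -/
theorem rpow_sum_nbhd_le (a : ℕ → ℝ) (ha : ∀ i, 0 ≤ a i) (r : ℝ) (hr : 0 < r) (j : ℕ) :
    (∑ i ∈ nbhd j, a i) ^ r ≤ 5 ^ r * ∑ i ∈ nbhd j, a i ^ r := by
  have hS : 0 ≤ ∑ i ∈ nbhd j, a i ^ r := Finset.sum_nonneg fun i _ => Real.rpow_nonneg (ha i) r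
  have h1 : ∑ i ∈ nbhd j, a i ≤ 5 * (∑ i ∈ nbhd j, a i ^ r) ^ r⁻¹ := by
    refine sum_nbhd_le a _ (Real.rpow_nonneg hS _) j fun i hi => ?_
    rw [Real.le_rpow_inv_iff_of_pos (ha i) hS hr]
    exact Finset.single_le_sum (f := fun i => a i ^ r) (fun i _ => Real.rpow_nonneg (ha i) r) hi
  refine (Real.rpow_le_rpow (Finset.sum_nonneg fun i _ => ha i) h1 hr.le).trans ?_
  rw [Real.mul_rpow (by norm_num) (Real.rpow_nonneg hS _), Real.rpow_inv_rpow hS hr.ne']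

/-- After exchanging the sums, each index i is counted at most five times, since being neighbours is
a symmetric relation. -/
theorem sum_sum_nbhd_le (h : ℕ → ℝ) (hh : ∀ i, 0 ≤ h i) (A : ℝ)
    (hA : ∀ T : Finset ℕ, ∑ i ∈ T, h i ≤ A) (s : Finset ℕ) :
    ∑ j ∈ s, ∑ i ∈ nbhd j, h i ≤ 5 * A := by
  have : ∑ j ∈ s, ∑ i ∈ nbhd j, h i =
      ∑ i ∈ s.biUnion nbhd, ∑ _j ∈ s.filter (fun j => j ∈ nbhd i), h i := by
    refine Finset.sum_comm' fun j i => ?_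
    simp only [Finset.mem_filter, Finset.mem_biUnion]
    constructor
    · rintro ⟨hj, hi⟩
      exact ⟨⟨hj, mem_nbhd_comm.1 hi⟩, j, hj, hi⟩
    · rintro ⟨⟨hj, hi⟩, -⟩
      exact ⟨hj, mem_nbhd_comm.1 hi⟩
  rw [this]
  refine le_trans (Finset.sum_le_sum (g := fun i => 5 * h i) fun i _ => ?_) ?_
  · rw [Finset.sum_const, nsmul_eq_mul]
    refine mul_le_mul_of_nonneg_right ?_ (hh i)
    have h1 : (s.filter (fun j => j ∈ nbhd i)).card ≤ (nbhd i).card :=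
      Finset.card_le_card fun j hj => (Finset.mem_filter.1 hj).2
    exact_mod_cast h1.trans (card_nbhd_le i)
  · rw [← Finset.mul_sum]
    exact mul_le_mul_of_nonneg_left (hA _) (by norm_num)

theorem rpow_toReal_exponent {q : ℝ≥0∞} [hq : Fact (1 ≤ q)] (h : q ≠ ∞) : 1 ≤ q.toReal := by
  have := ENNReal.toReal_mono h hq.out
  simpa using this

/-- A sequence dominated by sums of neighbours of an `ℓ^q` sequence is in `ℓ^q`. -/
theorem memℓp_of_le_sum_nbhd {X Y : Type*} [NormedAddCommGroup X] [NormedAddCommGroup Y]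
    (q : ℝ≥0∞) [Fact (1 ≤ q)] (f : lp (fun _ : ℕ => X) q) (g : ℕ → Y) (c : ℝ) (hc : 0 ≤ c)
    (hg : ∀ j, ‖g j‖ ≤ c * ∑ i ∈ nbhd j, ‖f i‖) :
    ∃ hm : Memℓp g q, ‖(⟨g, hm⟩ : lp (fun _ : ℕ => Y) q)‖ ≤ 25 * c * ‖f‖ := by
  have hq0 : q ≠ 0 := (lt_of_lt_of_le one_pos (Fact.out : 1 ≤ q)).ne'
  by_cases hq : q = ∞
  · subst hq
    have hb : ∀ j, ‖g j‖ ≤ 25 * c * ‖f‖ := fun j => by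
      have h1 := sum_nbhd_le (fun i => ‖f i‖) ‖f‖ (norm_nonneg f) j
        fun i _ => lp.norm_apply_le_norm hq0 f i
      calc ‖g j‖ ≤ c * (5 * ‖f‖) := (hg j).trans (mul_le_mul_of_nonneg_left h1 hc)
        _ ≤ 25 * c * ‖f‖ := by nlinarith [norm_nonneg f, mul_nonneg hc (norm_nonneg f)]
    have hm : Memℓp g ∞ := memℓp_infty ⟨25 * c * ‖f‖, by
      rintro _ ⟨j, rfl⟩
      exact hb j⟩
    exact ⟨hm, lp.norm_le_of_forall_le (by positivity) hb⟩
  · have hr1 := rpow_toReal_exponent hq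
    set r := q.toReal
    have hr : 0 < r := by linarith
    have hb : ∀ s : Finset ℕ, ∑ j ∈ s, ‖g j‖ ^ r ≤ (25 * c * ‖f‖) ^ r := by
      intro s
      have h1 : ∀ j, ‖g j‖ ^ r ≤ c ^ r * 5 ^ r * ∑ i ∈ nbhd j, ‖f i‖ ^ r := by
        intro j
        refine (Real.rpow_le_rpow (norm_nonneg _) (hg j) hr.le).trans ?_
        rw [Real.mul_rpow hc (Finset.sum_nonneg fun i _ => norm_nonneg _), mul_assoc]
        exact mul_le_mul_of_nonneg_left
          (rpow_sum_nbhd_le (fun i => ‖f i‖) (fun i => norm_nonneg _) r hr j)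
          (Real.rpow_nonneg hc r)
      calc ∑ j ∈ s, ‖g j‖ ^ r ≤ ∑ j ∈ s, c ^ r * 5 ^ r * ∑ i ∈ nbhd j, ‖f i‖ ^ r :=
            Finset.sum_le_sum fun j _ => h1 j
        _ = c ^ r * 5 ^ r * ∑ j ∈ s, ∑ i ∈ nbhd j, ‖f i‖ ^ r := by rw [Finset.mul_sum]
        _ ≤ c ^ r * 5 ^ r * (5 * ‖f‖ ^ r) := by
            refine mul_le_mul_of_nonneg_left ?_ (by positivity)
            exact sum_sum_nbhd_le (fun i => ‖f i‖ ^ r) (fun i => by positivity) _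
              (fun T => lp.sum_rpow_le_norm_rpow hr f T) s
        -- The overlap factor 5 is enlarged to 5^r, which r ≥ 1 allows, so that the r-th root gives
        -- 25 = 5 · 5 independently of q.
        _ ≤ c ^ r * 5 ^ r * (5 ^ r * ‖f‖ ^ r) := by
            gcongr
            exact Real.self_le_rpow_of_one_le (by norm_num) hr1
        _ = (25 * c * ‖f‖) ^ r := by
            rw [Real.mul_rpow (by positivity) (norm_nonneg f), Real.mul_rpow (by norm_num) hc,
              show (25 : ℝ) = 5 * 5 by norm_num, Real.mul_rpow (by norm_num) (by norm_num)]
            ring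
    have hm : Memℓp g q := memℓp_gen' hb
    exact ⟨hm, lp.norm_le_of_forall_sum_le hr (by positivity) hb⟩

end Sequences

/-! ### From estimates on dyadic blocks to operators between Besov spaces. -/

section BlockMultipliers

variable {n : ℕ} {E : Type*} [NormedAddCommGroup E] [NormedSpace ℂ E] (φ : ResolutionOfUnity n)

/-- For i ≥ j + 3 the outer radius 2^(j+1) of the j-th support lies strictly below the inner radius
2^(i-1) of the i-th. -/
theorem ResolutionOfUnity.le_add_two {ξ : V n} {i j : ℕ} (hi : φ.fn i ξ ≠ 0) (hj : φ.fn j ξ ≠ 0) :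
    i ≤ j + 2 := by
  by_contra! h
  have h1 := φ.supp_pos i (by omega) (subset_tsupport _ hi)
  have h2 : ‖ξ‖ ≤ (2 : ℝ) ^ ((j : ℝ) + 1) := by
    rcases Nat.eq_zero_or_pos j with rfl | h0
    · simpa using φ.supp_zero (subset_tsupport _ hj)
    · exact (φ.supp_pos j h0 (subset_tsupport _ hj)).2
  have h3 : (2 : ℝ) ^ ((j : ℝ) + 1) < (2 : ℝ) ^ ((i : ℝ) - 1) := by
    refine Real.rpow_lt_rpow_of_exponent_lt (by norm_num) ?_
    have : (j : ℝ) + 3 ≤ i := by exact_mod_cast h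
    linarith
  exact absurd (h1.1.trans h2) (not_le.2 h3)

/-- The neighbouring functions add up to 1 wherever φ_j does not vanish. They serve as a cutoff that
can be inserted next to φ_j for free. -/
theorem ResolutionOfUnity.sum_nbhd {ξ : V n} {j : ℕ} (hj : φ.fn j ξ ≠ 0) :
    ∑ i ∈ nbhd j, φ.fn i ξ = 1 := by
  have h := hasSum_sum_of_ne_finset_zero (f := fun i => φ.fn i ξ) (s := nbhd j)
    (L := .unconditional ℕ) fun i hi => by
    by_contra h
    exact hi (mem_nbhd.2 ⟨φ.le_add_two hj h, φ.le_add_two h hj⟩)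
  exact h.unique (φ.sum_eq_one ξ)

theorem box_mono {i j : ℕ} (h : i ≤ j) : box n i ⊆ box n j := by
  intro k hk
  simp only [box, Fintype.mem_piFinset, Finset.mem_Icc] at hk ⊢
  have h1 : (2 : ℤ) ^ (i + 1) ≤ 2 ^ (j + 1) := pow_le_pow_right₀ (by norm_num) (by omega)
  intro l
  have := hk l
  constructor <;> linarith [this.1, this.2]

variable (p : ℝ≥0∞) [Fact (1 ≤ p)]

/-- The freedom in the index set lets neighbouring blocks be summed over one common finite set of
frequencies. -/
theorem blockLp_eq_sum (j : ℕ) (u : Distr n E) (S : Finset (Fin n → ℤ)) (hS : box n j ⊆ S) :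
    blockLp φ p j u = ∑ k ∈ S, mono p k (φ.fn j (latticePt k) • fourierCoef k u) := by
  have h1 : ∑ k ∈ S, mono p k (φ.fn j (latticePt k) • fourierCoef k u) =
      ∑ k ∈ box n j, mono p k (φ.fn j (latticePt k) • fourierCoef k u) := by
    refine (Finset.sum_subset hS fun k _ hk => ?_).symm
    rw [fn_eq_zero φ j k hk, zero_smul, map_zero]
  rw [h1]
  refine Lp.ext ?_
  refine ((memLp_block φ p j u).coeFn_toLp).trans ?_
  refine EventuallyEq.trans (Eventually.of_forall fun x => ?_) (coeFn_sum_mono p _ _).symm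
  rw [block_eq_sum]
  simp only [mul_smul]

/-- The operators with symbols `φ_j M` are bounded by `b j` on trigonometric polynomials. -/
def IsBlockMultiplier (M : (Fin n → ℤ) → E →L[ℂ] E) (b : ℕ → ℝ) : Prop :=
  ∀ (j : ℕ) (S : Finset (Fin n → ℤ)) (x : (Fin n → ℤ) → E),
    ‖∑ k ∈ S, mono p k (φ.fn j (latticePt k) • M k (x k))‖ ≤ b j * ‖∑ k ∈ S, mono p k (x k)‖

variable {φ p}

theorem IsBlockMultiplier.mono_bound {M : (Fin n → ℤ) → E →L[ℂ] E} {b c : ℕ → ℝ}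
    (h : IsBlockMultiplier φ p M b) (hbc : ∀ j, b j ≤ c j) : IsBlockMultiplier φ p M c :=
  fun j S x => (h j S x).trans (mul_le_mul_of_nonneg_right (hbc j) (norm_nonneg _))

theorem IsBlockMultiplier.add {M N : (Fin n → ℤ) → E →L[ℂ] E} {b c : ℕ → ℝ}
    (h : IsBlockMultiplier φ p M b) (h' : IsBlockMultiplier φ p N c) :
    IsBlockMultiplier φ p (fun k => M k + N k) (fun j => b j + c j) := fun j S x => by
  simp only [add_apply, smul_add, map_add, Finset.sum_add_distrib, add_mul]
  exact (norm_add_le _ _).trans (add_le_add (h j S x) (h' j S x))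

theorem IsBlockMultiplier.smul {M : (Fin n → ℤ) → E →L[ℂ] E} {b : ℕ → ℝ}
    (h : IsBlockMultiplier φ p M b) (z : ℂ) :
    IsBlockMultiplier φ p (fun k => z • M k) (fun j => ‖z‖ * b j) := fun j S x => by
  have : ∑ k ∈ S, mono p k (φ.fn j (latticePt k) • (z • M k) (x k)) =
      z • ∑ k ∈ S, mono p k (φ.fn j (latticePt k) • M k (x k)) := by
    rw [Finset.smul_sum]
    refine Finset.sum_congr rfl fun k _ => ?_
    rw [smul_apply, smul_comm, map_smul]
  rw [this, norm_smul, mul_assoc]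
  exact mul_le_mul_of_nonneg_left (h j S x) (norm_nonneg z)

/-- A single φ_j has to serve two factors, so the cutoff ∑ φ_i over neighbours is inserted between M
and N. The at most five summands, each estimated by c, give the factor 5. -/
theorem IsBlockMultiplier.mul {M N : (Fin n → ℤ) → E →L[ℂ] E} {b : ℕ → ℝ} {c : ℝ} (hc : 0 ≤ c)
    (hb : ∀ j, 0 ≤ b j)
    (h : IsBlockMultiplier φ p M b) (h' : IsBlockMultiplier φ p N fun _ => c) :
    IsBlockMultiplier φ p (fun k => M k * N k) (fun j => b j * (5 * c)) := fun j S x => by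
  have e : ∑ k ∈ S, mono p k (φ.fn j (latticePt k) • (M k * N k) (x k)) =
      ∑ k ∈ S, mono p k (φ.fn j (latticePt k) • M k
        (∑ i ∈ nbhd j, φ.fn i (latticePt k) • N k (x k))) := by
    refine Finset.sum_congr rfl fun k _ => ?_
    by_cases h0 : φ.fn j (latticePt k) = 0
    · simp [h0]
    · rw [← Finset.sum_smul, φ.sum_nbhd h0, one_smul]
      rfl
  rw [e, mul_assoc]
  refine (h j S _).trans (mul_le_mul_of_nonneg_left ?_ (hb j))
  simp only [map_sum]
  rw [Finset.sum_comm, mul_assoc]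
  refine (norm_sum_le _ _).trans (sum_nbhd_le _ _ (by positivity) j fun i _ => h' i S x)

/-- The blockwise estimate for a Fourier multiplier. -/
theorem IsBlockMultiplier.norm_blockLp_le {M : (Fin n → ℤ) → E →L[ℂ] E} {b : ℕ → ℝ}
    (h : IsBlockMultiplier φ p M b) (hb : ∀ j, 0 ≤ b j) {u v : Distr n E}
    (huv : ∀ k, fourierCoef k v = M k (fourierCoef k u)) (j : ℕ) :
    ‖blockLp φ p j v‖ ≤ b j * ∑ i ∈ nbhd j, ‖blockLp φ p i u‖ := by
  have hbox : ∀ i ∈ nbhd j, box n i ⊆ box n (j + 2) := fun i hi => box_mono (mem_nbhd.1 hi).2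
  rw [blockLp_eq_sum φ p j v (box n (j + 2)) (box_mono (by omega))]
  have e : ∑ k ∈ box n (j + 2), mono p k (φ.fn j (latticePt k) • fourierCoef k v) =
      ∑ k ∈ box n (j + 2), mono p k (φ.fn j (latticePt k) • M k
        (∑ i ∈ nbhd j, φ.fn i (latticePt k) • fourierCoef k u)) := by
    refine Finset.sum_congr rfl fun k _ => ?_
    by_cases h0 : φ.fn j (latticePt k) = 0
    · simp [h0]
    · rw [← Finset.sum_smul, φ.sum_nbhd h0, one_smul, huv]
  rw [e]
  refine (h j _ _).trans (mul_le_mul_of_nonneg_left ?_ (hb j))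
  simp only [map_sum]
  rw [Finset.sum_comm]
  refine (norm_sum_le _ _).trans (Finset.sum_le_sum fun i hi => le_of_eq ?_)
  rw [blockLp_eq_sum φ p i u _ (hbox i hi)]

/-- The weights of neighbouring blocks are comparable because the indices differ by at most 2,
whatever the sign of s. -/
theorem two_rpow_mul_le (s : ℝ) {i j : ℕ} (h : i ∈ nbhd j) :
    (2 : ℝ) ^ (s * j) ≤ 2 ^ (2 * |s|) * 2 ^ (s * i) := by
  rw [← Real.rpow_add (by norm_num)]
  refine Real.rpow_le_rpow_of_exponent_le (by norm_num) ?_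
  obtain ⟨h1, h2⟩ := mem_nbhd.1 h
  have h3 : (j : ℝ) ≤ i + 2 := by exact_mod_cast h1
  have h4 : (i : ℝ) ≤ j + 2 := by exact_mod_cast h2
  have h5 : s * ((j : ℝ) - i) ≤ |s| * 2 := by
    refine (le_abs_self _).trans ?_
    rw [abs_mul]
    exact mul_le_mul_of_nonneg_left (abs_le.2 ⟨by linarith, by linarith⟩) (abs_nonneg s)
  linarith

theorem norm_besovSeq (s : ℝ) (j : ℕ) (u : Distr n E) :
    ‖besovSeq φ s p u j‖ = 2 ^ (s * j) * ‖blockLp φ p j u‖ := by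
  change ‖(((2 : ℝ) ^ (s * j) : ℝ) : ℂ) • blockLp φ p j u‖ = _
  rw [norm_smul, Complex.norm_real, Real.norm_of_nonneg (by positivity)]

/-- The hypothesis `hbc` is the exchange rate between block bounds and smoothness: b j of size
2^{(s-s')j} means a multiplier from smoothness s to smoothness s'. -/
theorem IsBlockMultiplier.norm_besovSeq_le {M : (Fin n → ℤ) → E →L[ℂ] E} {b : ℕ → ℝ} {c s s' : ℝ}
    (h : IsBlockMultiplier φ p M b) (hb : ∀ j, 0 ≤ b j) (hc : 0 ≤ c)
    (hbc : ∀ j : ℕ, 2 ^ (s' * j) * b j ≤ c * 2 ^ (s * j)) {u v : Distr n E}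
    (huv : ∀ k, fourierCoef k v = M k (fourierCoef k u)) (j : ℕ) :
    ‖besovSeq φ s' p v j‖ ≤ (c * 2 ^ (2 * |s|)) * ∑ i ∈ nbhd j, ‖besovSeq φ s p u i‖ := by
  rw [norm_besovSeq]
  calc (2 : ℝ) ^ (s' * j) * ‖blockLp φ p j v‖
      ≤ 2 ^ (s' * j) * (b j * ∑ i ∈ nbhd j, ‖blockLp φ p i u‖) := by
        gcongr
        exact h.norm_blockLp_le hb huv j
    _ = 2 ^ (s' * j) * b j * ∑ i ∈ nbhd j, ‖blockLp φ p i u‖ := by ring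
    _ ≤ c * 2 ^ (s * j) * ∑ i ∈ nbhd j, ‖blockLp φ p i u‖ := by
        exact mul_le_mul_of_nonneg_right (hbc j) (Finset.sum_nonneg fun i _ => norm_nonneg _)
    _ ≤ (c * 2 ^ (2 * |s|)) * ∑ i ∈ nbhd j, ‖besovSeq φ s p u i‖ := by
        rw [Finset.mul_sum, Finset.mul_sum]
        refine Finset.sum_le_sum fun i hi => ?_
        rw [norm_besovSeq]
        have := mul_le_mul_of_nonneg_left (two_rpow_mul_le s hi)
          (mul_nonneg hc (norm_nonneg (blockLp φ p i u)))
        linarith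

variable (q : ℝ≥0∞) [Fact (1 ≤ q)]

/-- Fourier multipliers between Besov spaces. -/
theorem IsBlockMultiplier.exists_norm_le {M : (Fin n → ℤ) → E →L[ℂ] E} {b : ℕ → ℝ} {c s s' : ℝ}
    (h : IsBlockMultiplier φ p M b) (hb : ∀ j, 0 ≤ b j) (hc : 0 ≤ c)
    (hbc : ∀ j : ℕ, 2 ^ (s' * j) * b j ≤ c * 2 ^ (s * j)) (u : Besov E φ s p q) (v : Distr n E)
    (huv : ∀ k, fourierCoef k v = M k (fourierCoef k u.1)) :
    ∃ hv : v ∈ Besov E φ s' p q,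
      ‖(⟨v, hv⟩ : Besov E φ s' p q)‖ ≤ 25 * 2 ^ (2 * |s|) * c * ‖u‖ := by
  obtain ⟨hm, hn⟩ := memℓp_of_le_sum_nbhd q (besovToLp φ s p q u) (besovSeq φ s' p v)
    (c * 2 ^ (2 * |s|)) (by positivity) (h.norm_besovSeq_le hb hc hbc huv)
  refine ⟨hm, hn.trans (le_of_eq ?_)⟩
  change _ = _ * ‖besovToLp φ s p q u‖
  ring

end BlockMultipliers

/-! ### Rescaling the dyadic shells to unit size. -/

section DyadicSymbols

variable {n : ℕ}

theorem norm_iteratedFDeriv_comp_smul_le {F : Type*} [NormedAddCommGroup F] [NormedSpace ℝ F]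
    {f : V n → F} (hf : ContDiff ℝ (⊤ : ℕ∞) f) (c : ℝ) (hc : 0 ≤ c) (i : ℕ) (x : V n) :
    ‖iteratedFDeriv ℝ i (fun x => f (c • x)) x‖ ≤ c ^ i * ‖iteratedFDeriv ℝ i f (c • x)‖ := by
  have h := ContinuousLinearMap.iteratedFDeriv_comp_right (c • ContinuousLinearMap.id ℝ (V n)) hf x
    (i := i) (by exact_mod_cast le_top)
  have e : (fun x => f (c • x)) = f ∘ (c • ContinuousLinearMap.id ℝ (V n)) := rfl
  rw [e, h]
  refine (ContinuousMultilinearMap.norm_compContinuousLinearMap_le _ _).trans ?_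
  rw [Finset.prod_const, Finset.card_univ, Fintype.card_fin, mul_comm]
  have : ‖c • ContinuousLinearMap.id ℝ (V n)‖ ≤ c := by
    rw [norm_smul, Real.norm_of_nonneg hc]
    exact mul_le_of_le_one_right hc ContinuousLinearMap.norm_id_le
  gcongr
  exact le_rfl

/-- After dilation all supports lie in one compact set, independent of j. The lower bound is absent
for j = 0, whose support contains low frequencies. -/
theorem norm_le_of_mem_tsupport (φ : ResolutionOfUnity n) {j : ℕ} {η : V n}
    (h : (2 : ℝ) ^ j • η ∈ tsupport (φ.fn j)) : ‖η‖ ≤ 2 ∧ (1 ≤ j → 1 / 2 ≤ ‖η‖) := by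
  have h2 : (0 : ℝ) < 2 ^ j := by positivity
  have hn : ‖(2 : ℝ) ^ j • η‖ = 2 ^ j * ‖η‖ := by
    rw [norm_smul, Real.norm_of_nonneg h2.le]
  rcases Nat.eq_zero_or_pos j with rfl | hj
  · refine ⟨?_, fun h => absurd h (by norm_num)⟩
    simpa using φ.supp_zero h
  · obtain ⟨h3, h4⟩ := φ.supp_pos j hj h
    rw [hn] at h3 h4
    rw [Real.rpow_add (by norm_num), Real.rpow_natCast, Real.rpow_one] at h4
    rw [Real.rpow_sub (by norm_num), Real.rpow_natCast, Real.rpow_one, div_eq_mul_one_div] at h3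
    exact ⟨le_of_mul_le_mul_left h4 h2, fun _ => le_of_mul_le_mul_left h3 h2⟩

/-- A smooth symbol with dyadic derivative bounds is a block multiplier. -/
theorem exists_isBlockMultiplier_of_symbol (φ : ResolutionOfUnity n) : ∃ K : ℝ, 0 ≤ K ∧
    ∀ {E : Type*} [NormedAddCommGroup E] [NormedSpace ℂ E] [CompleteSpace E] (p : ℝ≥0∞)
      [Fact (1 ≤ p)] (G : V n → E →L[ℂ] E) (b : ℕ → ℝ), ContDiff ℝ (⊤ : ℕ∞) G → (∀ j, 0 ≤ b j) →
      (∀ (j : ℕ) (η : V n), ‖η‖ ≤ 2 → (1 ≤ j → 1 / 2 ≤ ‖η‖) → ∀ i ≤ n + 1,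
        ‖iteratedFDeriv ℝ i (fun η => G ((2 : ℝ) ^ j • η)) η‖ ≤ b j) →
      IsBlockMultiplier φ p (fun k => G (latticePt k)) (fun j => K * b j) := by
  obtain ⟨K₀, hK₀, hmul⟩ := exists_multiplier_const n
  choose D hD using φ.deriv_le
  set D' : ℝ := ∑ i ∈ Finset.range (n + 2), |D i| with hD'
  have hD0 : 0 ≤ D' := Finset.sum_nonneg fun i _ => abs_nonneg _
  refine ⟨K₀ * (2 ^ (n + 1) * D'), by positivity, fun {E} _ _ _ p _ G b hG hb hder j S x => ?_⟩
  have h2 : (0 : ℝ) < 2 ^ j := by positivity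
  have hφs : ContDiff ℝ (⊤ : ℕ∞) (φ.fn j) := (φ.fn j).smooth _
  have hφs' : ContDiff ℝ (⊤ : ℕ∞) (fun η : V n => φ.fn j ((2 : ℝ) ^ j • η)) :=
    hφs.comp (contDiff_const_smul _)
  have hGs : ContDiff ℝ (⊤ : ℕ∞) (fun η : V n => G ((2 : ℝ) ^ j • η)) :=
    hG.comp (contDiff_const_smul _)
  have hφd : ∀ i ≤ n + 1, ∀ η : V n,
      ‖iteratedFDeriv ℝ i (fun η : V n => φ.fn j ((2 : ℝ) ^ j • η)) η‖ ≤ D' := by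
    intro i hi η
    refine (norm_iteratedFDeriv_comp_smul_le hφs _ h2.le i η).trans ?_
    have h3 := hD i j ((2 : ℝ) ^ j • η)
    -- The chain rule factor 2^{ji} cancels the decay 2^{-ji} in `deriv_le`, so the rescaled φ_j
    -- have derivative bounds independent of j.
    have h4 : ((2 : ℝ) ^ j) ^ i * 2 ^ (-((j : ℝ) * i)) = 1 := by
      rw [← pow_mul, ← Real.rpow_natCast, ← Real.rpow_add (by norm_num)]
      push_cast
      rw [add_neg_cancel, Real.rpow_zero]
    calc ((2 : ℝ) ^ j) ^ i * ‖iteratedFDeriv ℝ i (φ.fn j) ((2 : ℝ) ^ j • η)‖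
        ≤ ((2 : ℝ) ^ j) ^ i * (D i * 2 ^ (-((j : ℝ) * i))) := by gcongr
      _ = D i * (((2 : ℝ) ^ j) ^ i * 2 ^ (-((j : ℝ) * i))) := by ring
      _ = D i := by rw [h4, mul_one]
      _ ≤ |D i| := le_abs_self _
      _ ≤ D' := Finset.single_le_sum (f := fun i => |D i|) (fun i _ => abs_nonneg _)
          (Finset.mem_range.2 (by omega))
  set g : V n → E →L[ℂ] E := fun η => φ.fn j ((2 : ℝ) ^ j • η) • G ((2 : ℝ) ^ j • η) with hg
  have hgs : ContDiff ℝ (⊤ : ℕ∞) g := hφs'.smul hGs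
  have hgd : ∀ i ≤ n + 1, ∀ η, ‖iteratedFDeriv ℝ i g η‖ ≤ 2 ^ (n + 1) * D' * b j := by
    intro i hi η
    have hle := norm_iteratedFDeriv_smul_le hφs' hGs η (n := i) (by exact_mod_cast le_top)
    refine hle.trans ?_
    have hterm : ∀ l ∈ Finset.range (i + 1), (i.choose l : ℝ) *
        ‖iteratedFDeriv ℝ l (fun η : V n => φ.fn j ((2 : ℝ) ^ j • η)) η‖ *
        ‖iteratedFDeriv ℝ (i - l) (fun η : V n => G ((2 : ℝ) ^ j • η)) η‖ ≤
        (i.choose l : ℝ) * (D' * b j) := by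
      intro l hl
      have hl' : l ≤ n + 1 := by
        have := Finset.mem_range.1 hl
        omega
      -- Bounds on G are available only near the shell. Off the closed support all derivatives of
      -- φ_j vanish and none is needed.
      by_cases hs : (2 : ℝ) ^ j • η ∈ tsupport (φ.fn j)
      · obtain ⟨h5, h6⟩ := norm_le_of_mem_tsupport φ hs
        rw [mul_assoc]
        refine mul_le_mul_of_nonneg_left ?_ (by positivity)
        exact mul_le_mul (hφd l hl' η) (hder j η h5 h6 (i - l) (by omega)) (norm_nonneg _) hD0
      · have h7 : iteratedFDeriv ℝ l (φ.fn j) ((2 : ℝ) ^ j • η) = 0 := by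
          by_contra h
          exact hs (support_iteratedFDeriv_subset l h)
        have h8 := norm_iteratedFDeriv_comp_smul_le hφs _ h2.le l η
        rw [h7, norm_zero, mul_zero] at h8
        rw [le_antisymm h8 (norm_nonneg _), mul_zero, zero_mul]
        have := hb j
        positivity
    refine (Finset.sum_le_sum hterm).trans ?_
    rw [← Finset.sum_mul]
    have h9 : ∑ l ∈ Finset.range (i + 1), (i.choose l : ℝ) = 2 ^ i := by
      exact_mod_cast Nat.sum_range_choose i
    rw [h9, mul_assoc]
    have := hb j
    gcongr
    norm_num
  have hsupp : Function.support g ⊆ Metric.closedBall 0 4 := by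
    intro η hη
    have h5 : φ.fn j ((2 : ℝ) ^ j • η) ≠ 0 := fun h => hη (by simp only [hg, h, zero_smul])
    have h6 := (norm_le_of_mem_tsupport φ (subset_tsupport _ h5)).1
    simp only [Metric.mem_closedBall, dist_zero_right]
    linarith
  -- The dilation t = 2^{-j} undoes the rescaling of the symbol on the lattice, and the constant of
  -- the multiplier estimate does not depend on t.
  have hfin := hmul p g hgs hsupp _ hgd ((2 : ℝ) ^ j)⁻¹ S x
  have e : ∀ k, g (((2 : ℝ) ^ j)⁻¹ • latticePt k) = φ.fn j (latticePt k) • G (latticePt k) := by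
    intro k
    simp only [hg, smul_smul, mul_inv_cancel₀ h2.ne', one_smul]
  simp only [e, smul_apply] at hfin
  refine hfin.trans (le_of_eq ?_)
  ring

end DyadicSymbols

/-! ### Derivatives of the inverse of an operator-valued function. -/

section Inversion

variable {R : Type*} [NormedRing R] [NormedAlgebra ℝ R] [CompleteSpace R]

/-- Derivative bounds for the inverse of a function, from relative derivative bounds. The constant
depends only on the algebra, the order `N` and the relative bound `D`. -/
theorem exists_norm_iteratedFDeriv_inverse_le (R : Type*) [NormedRing R] [NormedAlgebra ℝ R]
    [CompleteSpace R] (N : ℕ) (D : ℝ) (hD : 1 ≤ D) : ∃ K : ℝ, 0 ≤ K ∧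
    ∀ {W : Type*} [NormedAddCommGroup W] [NormedSpace ℝ W] (T : W → R),
      ContDiff ℝ (⊤ : ℕ∞) T → (∀ x, IsUnit (T x)) → ∀ x : W,
      (∀ i, 1 ≤ i → i ≤ N → ‖Ring.inverse (T x)‖ * ‖iteratedFDeriv ℝ i T x‖ ≤ D) →
      ∀ i ≤ N, ‖iteratedFDeriv ℝ i (fun y => Ring.inverse (T y)) x‖ ≤
        K * ‖Ring.inverse (T x)‖ := by
  set t : Set R := {r | IsUnit r}
  have ht : IsOpen t := Units.isOpen
  set B : ℝ := ∑ i ∈ Finset.range (N + 1), ‖iteratedFDerivWithin ℝ i Ring.inverse t (1 : R)‖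
  have hB : 0 ≤ B := Finset.sum_nonneg fun i _ => norm_nonneg _
  refine ⟨N.factorial * B * D ^ N, by positivity, fun {W} _ _ T hT hu x hx i hi => ?_⟩
  set c := Ring.inverse (T x) with hc
  have hcu : IsUnit c := (hu x).ringInverse
  have hinv : ContDiffOn ℝ (⊤ : ℕ∞) (Ring.inverse : R → R) t := by
    rintro _ ⟨u, rfl⟩
    exact (contDiffAt_ringInverse ℝ u).contDiffWithinAt
  set f : W → R := fun y => c * T y with hf
  have hfs : ContDiff ℝ (⊤ : ℕ∞) f := contDiff_const.mul hT
  have hfu : ∀ y, IsUnit (f y) := fun y => hcu.mul (hu y)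
  have hfx : f x = 1 := Ring.inverse_mul_cancel _ (hu x)
  -- Normalization at the point x: T(y)⁻¹ = (c T(y))⁻¹ c with c = T(x)⁻¹. The inner function equals
  -- 1 at x, so only the derivatives of inversion at the point 1 enter, and these depend on the
  -- algebra alone.
  have hfact : (fun y => Ring.inverse (T y)) = (ContinuousLinearMap.mul ℝ R).flip c ∘ (Ring.inverse ∘ f) := by
    funext y
    simp only [Function.comp_apply, ContinuousLinearMap.flip_apply, ContinuousLinearMap.mul_apply', hf]
    rw [Ring.inverse_mul (Or.inl hcu), mul_assoc, Ring.inverse_mul_cancel _ hcu, mul_one]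
  have hcomp : ‖iteratedFDeriv ℝ i (Ring.inverse ∘ f) x‖ ≤ i.factorial * B * D ^ i := by
    refine norm_iteratedFDeriv_comp_le' (t := t) (N := ((⊤ : ℕ∞) : WithTop ℕ∞)) ?_ ht.uniqueDiffOn hinv hfs
      (by exact_mod_cast le_top) x ?_ ?_
    · rintro _ ⟨y, rfl⟩
      exact hfu y
    · intro l hl
      rw [hfx]
      exact Finset.single_le_sum (f := fun i => ‖iteratedFDerivWithin ℝ i Ring.inverse t (1 : R)‖)
        (fun i _ => norm_nonneg _) (Finset.mem_range.2 (by omega))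
    · intro l hl1 hl
      have h1 : ‖iteratedFDeriv ℝ l f x‖ ≤ ‖c‖ * ‖iteratedFDeriv ℝ l T x‖ := by
        have := ContinuousLinearMap.norm_iteratedFDeriv_comp_left (ContinuousLinearMap.mul ℝ R c)
          (hT.contDiffAt (x := x)) (n := l) (by exact_mod_cast le_top)
        refine this.trans ?_
        gcongr
        exact ContinuousLinearMap.opNorm_mul_apply_le ℝ R c
      refine (h1.trans (hx l hl1 (hl.trans hi))).trans ?_
      -- The bound for derivatives of compositions wants the l-th inner derivative at most D^l.
      -- Since D ≥ 1 and l ≥ 1, the bound D is enough.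
      exact le_self_pow₀ hD (by omega)
  rw [hfact]
  have hIs : ContDiffAt ℝ (⊤ : ℕ∞) (Ring.inverse ∘ f) x := by
    obtain ⟨u, hu'⟩ := hfu x
    have h3 : ContDiffAt ℝ (⊤ : ℕ∞) (Ring.inverse : R → R) (f x) := hu' ▸ contDiffAt_ringInverse ℝ u
    exact h3.comp x hfs.contDiffAt
  refine (ContinuousLinearMap.norm_iteratedFDeriv_comp_left _ hIs
    (by exact_mod_cast le_top)).trans ?_
  have h4 : ‖(ContinuousLinearMap.mul ℝ R).flip c‖ ≤ ‖c‖ := by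
    refine ContinuousLinearMap.opNorm_le_bound _ (norm_nonneg _) fun r => ?_
    simp only [ContinuousLinearMap.flip_apply, ContinuousLinearMap.mul_apply']
    rw [mul_comm]
    exact norm_mul_le _ _
  rw [mul_comm]
  gcongr
  refine hcomp.trans ?_
  gcongr

end Inversion

/-! ### Geometry of sectors. -/

section Sectors

/-- The cosine decreases strictly on [0, π], so the condition on the argument becomes an inequality
between real part and modulus. Later arguments about sectors are algebra with this inequality. -/
theorem mem_sector_iff {θ : ℝ} (h0 : 0 ≤ θ) (hπ : θ ≤ Real.pi) (z : ℂ) :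
    z ∈ sector θ ↔ Real.cos θ * ‖z‖ ≤ z.re := by
  by_cases hz : z = 0
  · subst hz
    simp [sector]
  · have hn : 0 < ‖z‖ := norm_pos_iff.2 hz
    have h1 : z.re = Real.cos |z.arg| * ‖z‖ := by
      rw [Real.cos_abs, Complex.cos_arg hz, div_mul_cancel₀ _ hn.ne']
    have h2 : z ∈ sector θ ↔ |z.arg| ≤ θ := by simp [sector, hz]
    rw [h2, h1, mul_le_mul_iff_left₀ hn]
    exact (Real.strictAntiOn_cos.le_iff_ge ⟨h0, hπ⟩
      ⟨abs_nonneg _, abs_le.2 ⟨(Complex.neg_pi_lt_arg z).le, Complex.arg_le_pi z⟩⟩).symm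

theorem smul_mem_sector {θ : ℝ} (h0 : 0 ≤ θ) (hπ : θ ≤ Real.pi) {z : ℂ} (hz : z ∈ sector θ) {c : ℝ}
    (hc : 0 ≤ c) : (c : ℂ) * z ∈ sector θ := by
  rw [mem_sector_iff h0 hπ] at hz ⊢
  rw [norm_mul, Complex.norm_real, Real.norm_of_nonneg hc, Complex.re_ofReal_mul]
  nlinarith

theorem one_add_cos_pos {θ : ℝ} (h0 : 0 ≤ θ) (hπ : θ < Real.pi) : 0 < 1 + Real.cos θ := by
  have := Real.strictAntiOn_cos ⟨h0, hπ.le⟩ ⟨Real.pi_pos.le, le_rfl⟩ hπ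
  rw [Real.cos_pi] at this
  linarith

/-- A shifted sector is contained in the sector, at a distance from the origin. -/
theorem add_mem_sector {θ ω : ℝ} (h0 : 0 ≤ θ) (hπ : θ < Real.pi) (hω : 0 ≤ ω) {z : ℂ}
    (hz : z ∈ sector θ) :
    (ω : ℂ) + z ∈ sector θ ∧ (1 + Real.cos θ) / 2 * ω ^ 2 ≤ ‖(ω : ℂ) + z‖ ^ 2 := by
  rw [mem_sector_iff h0 hπ.le] at hz ⊢
  have hc := one_add_cos_pos h0 hπ
  have hc1 := Real.cos_le_one θ
  set c := Real.cos θ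
  have hsq : ‖(ω : ℂ) + z‖ ^ 2 = (ω + z.re) ^ 2 + z.im ^ 2 := by
    rw [Complex.sq_norm, Complex.normSq_apply]
    simp
    ring
  have hsz : ‖z‖ ^ 2 = z.re ^ 2 + z.im ^ 2 := by
    rw [Complex.sq_norm, Complex.normSq_apply]
    ring
  have hre : ((ω : ℂ) + z).re = ω + z.re := by simp
  constructor
  · rw [hre]
    by_cases hcs : 0 ≤ c
    · have h1 : ‖(ω : ℂ) + z‖ ≤ ω + ‖z‖ := by
        refine (norm_add_le _ _).trans ?_
        rw [Complex.norm_real, Real.norm_of_nonneg hω]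
      nlinarith
    · push Not at hcs
      by_cases hpos : 0 ≤ ω + z.re
      · nlinarith [norm_nonneg ((ω : ℂ) + z)]
      · push Not at hpos
        -- With negative cosine and negative real part both sides change sign, so squares are
        -- compared. By `h4` the inequality only improves when the real part moves from z.re towards
        -- 0.
        have h2 : (-(ω + z.re)) ^ 2 ≤ (-c * ‖(ω : ℂ) + z‖) ^ 2 := by
          rw [mul_pow, hsq]
          have h3 : (-z.re) ^ 2 ≤ (-c * ‖z‖) ^ 2 := by
            have : 0 ≤ -z.re := by linarith
            gcongr
            linarith
          rw [mul_pow, hsz] at h3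
          have h4 : 0 ≤ (1 - c ^ 2) * (z.re ^ 2 - (ω + z.re) ^ 2) := by
            apply mul_nonneg <;> nlinarith
          nlinarith
        have h5 := abs_le_of_sq_le_sq h2 (mul_nonneg (by linarith) (norm_nonneg _))
        linarith [(abs_le.1 h5).2]
  · rw [hsq]
    -- The left side is (1+c)/2 (ω + |z|)² + (1-c)/2 (ω - |z|)², which is at least (1+c)/2 ω².
    have h6 : ω ^ 2 + 2 * ω * (c * ‖z‖) + ‖z‖ ^ 2 ≤ (ω + z.re) ^ 2 + z.im ^ 2 := by
      nlinarith
    have h7 : 0 ≤ (1 - c) / 2 * (ω - ‖z‖) ^ 2 := by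
      apply mul_nonneg <;> nlinarith [sq_nonneg (ω - ‖z‖)]
    have h8 : 0 ≤ (1 + c) / 2 * (2 * ω * ‖z‖ + ‖z‖ ^ 2) := by positivity
    nlinarith

end Sectors

/-! ### Perturbation and scaling of inverses. -/

section InverseLemmas

variable {R : Type*} [NormedRing R] [CompleteSpace R]

/-- T + b = T(1 + T⁻¹b) is invertible by the Neumann series. The factor 2 results from absorbing
half of ‖(T+b)⁻¹‖ in the identity (T+b)⁻¹ = T⁻¹ - T⁻¹ b (T+b)⁻¹, which does not need ‖1‖ = 1. -/
theorem isUnit_add_of_inverse (T b : R) (hT : IsUnit T) (δ : ℝ) (hδ : ‖Ring.inverse T‖ ≤ δ)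
    (hb : δ * ‖b‖ ≤ 1 / 2) :
    IsUnit (T + b) ∧ ‖Ring.inverse (T + b)‖ ≤ 2 * δ := by
  have h1 : ‖-(Ring.inverse T * b)‖ < 1 := by
    rw [norm_neg]
    have : ‖Ring.inverse T * b‖ ≤ 1 / 2 :=
      (norm_mul_le _ _).trans ((mul_le_mul_of_nonneg_right hδ (norm_nonneg b)).trans hb)
    linarith
  have h2 : IsUnit (1 - -(Ring.inverse T * b)) := ⟨Units.oneSub _ h1, rfl⟩
  have h3 : T + b = T * (1 - -(Ring.inverse T * b)) := by
    rw [sub_neg_eq_add, mul_add, mul_one, ← mul_assoc, Ring.mul_inverse_cancel _ hT, one_mul]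
  have hu : IsUnit (T + b) := h3 ▸ hT.mul h2
  refine ⟨hu, ?_⟩
  have h4 : Ring.inverse (T + b) = Ring.inverse T - Ring.inverse T * b * Ring.inverse (T + b) := by
    have h5 : Ring.inverse T * ((T + b) * Ring.inverse (T + b)) = Ring.inverse T := by
      rw [Ring.mul_inverse_cancel _ hu, mul_one]
    rw [← mul_assoc, mul_add, Ring.inverse_mul_cancel _ hT, add_mul, one_mul] at h5
    exact eq_sub_of_add_eq h5
  have h6 : ‖Ring.inverse (T + b)‖ ≤ δ + 1 / 2 * ‖Ring.inverse (T + b)‖ := by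
    calc ‖Ring.inverse (T + b)‖
        = ‖Ring.inverse T - Ring.inverse T * b * Ring.inverse (T + b)‖ := by rw [← h4]
      _ ≤ ‖Ring.inverse T‖ + ‖Ring.inverse T‖ * ‖b‖ * ‖Ring.inverse (T + b)‖ := by
          refine (norm_sub_le _ _).trans (add_le_add_right ?_ _)
          exact (norm_mul_le _ _).trans (mul_le_mul_of_nonneg_right (norm_mul_le _ _) (norm_nonneg _))
      _ ≤ δ + 1 / 2 * ‖Ring.inverse (T + b)‖ := by
          gcongr
          exact (mul_le_mul_of_nonneg_right hδ (norm_nonneg b)).trans hb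
  linarith

theorem ring_inverse_smul {R : Type*} [Ring R] [Algebra ℂ R] (c : ℂ) (hc : c ≠ 0) (T : R)
    (hT : IsUnit T) : IsUnit (c • T) ∧ Ring.inverse (c • T) = c⁻¹ • Ring.inverse T := by
  have h1 : c • T * (c⁻¹ • Ring.inverse T) = 1 := by
    rw [smul_mul_smul_comm, mul_inv_cancel₀ hc, Ring.mul_inverse_cancel _ hT, one_smul]
  have h2 : c⁻¹ • Ring.inverse T * c • T = 1 := by
    rw [smul_mul_smul_comm, inv_mul_cancel₀ hc, Ring.inverse_mul_cancel _ hT, one_smul]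
  exact ⟨⟨⟨_, _, h1, h2⟩, rfl⟩, Ring.inverse_unit ⟨_, _, h1, h2⟩⟩

end InverseLemmas

/-! ### Ellipticity of the principal and the full symbol. -/

section Symbols

variable {n : ℕ} {E : Type*} [NormedAddCommGroup E] [NormedSpace ℂ E]

theorem principalSymbol_smul (i : ℕ) (a : (Fin n → ℕ) → E →L[ℂ] E) (c : ℝ) (ξ : V n) :
    principalSymbol i a (c • ξ) = ((c ^ i : ℝ) : ℂ) • principalSymbol i a ξ := by
  simp only [principalSymbol, Finset.smul_sum, smul_smul]
  refine Finset.sum_congr rfl fun α hα => ?_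
  have hα' : ∑ j, α j = i := (Finset.mem_piAntidiag.1 hα).1
  congr 1
  rw [← Complex.ofReal_mul]
  congr 1
  simp only [PiLp.smul_apply, smul_eq_mul, mul_pow, Finset.prod_mul_distrib,
    Finset.prod_pow_eq_pow_sum, hα']

theorem norm_principalSymbol_le (i : ℕ) (a : (Fin n → ℕ) → E →L[ℂ] E) (ξ : V n) :
    ‖principalSymbol i a ξ‖ ≤ ‖ξ‖ ^ i * ∑ α ∈ multiIdx n i, ‖a α‖ := by
  rw [Finset.mul_sum]
  refine (norm_sum_le _ _).trans (Finset.sum_le_sum fun α hα => ?_)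
  have hα' : ∑ j, α j = i := (Finset.mem_piAntidiag.1 hα).1
  rw [norm_smul, Complex.norm_real]
  refine mul_le_mul_of_nonneg_right ?_ (norm_nonneg _)
  rw [norm_prod, ← hα', ← Finset.prod_pow_eq_pow_sum]
  refine Finset.prod_le_prod (fun j _ => norm_nonneg _) fun j _ => ?_
  rw [norm_pow]
  exact pow_le_pow_left₀ (norm_nonneg _) (PiLp.norm_apply_le ξ j) _

/-- `∑_{|α| ≤ m} ‖a_α‖`. -/
def coeffNorm (m : ℕ) (a : (Fin n → ℕ) → E →L[ℂ] E) : ℝ :=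
  ∑ i ∈ Finset.range (m + 1), ∑ α ∈ multiIdx n i, ‖a α‖

theorem coeffNorm_nonneg (m : ℕ) (a : (Fin n → ℕ) → E →L[ℂ] E) : 0 ≤ coeffNorm m a :=
  Finset.sum_nonneg fun _ _ => Finset.sum_nonneg fun _ _ => norm_nonneg _

/-- Pointwise `(κ, θ)`-ellipticity of the principal symbol. -/
def SymbolElliptic (m : ℕ) (a : (Fin n → ℕ) → E →L[ℂ] E) (κ θ : ℝ) : Prop :=
  ∀ ξ : V n, ‖ξ‖ = 1 → ∀ z ∈ sector θ, IsUnit (z • (1 : E →L[ℂ] E) + principalSymbol m a ξ) ∧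
    ‖Ring.inverse (z • (1 : E →L[ℂ] E) + principalSymbol m a ξ)‖ ≤ κ / (1 + ‖z‖)

theorem IsElliptic.symbolElliptic {m : ℕ} {a : (Fin n → ℕ) → ℝ≥0 → E →L[ℂ] E} {κ θ : ℝ}
    (h : IsElliptic m a κ θ) (t : ℝ≥0) : SymbolElliptic m (fun α => a α t) κ θ := by
  intro ξ hξ z hz
  have e : z • (1 : E →L[ℂ] E) + principalSymbol m (fun α => a α t) ξ =
      algebraMap ℂ (E →L[ℂ] E) z - -principalSymbol m (fun α => a α t) ξ := by
    rw [sub_neg_eq_add, Algebra.algebraMap_eq_smul_one]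
  rw [e]
  exact ⟨h.sector_subset t ξ hξ hz, h.norm_resolvent_le t ξ hξ z hz⟩

/-- Dividing by |ξ|^m reduces to the unit sphere, with spectral parameter z/|ξ|^m still in the
sector. At ξ = 0 the symbol vanishes and z ≠ 0 and κ ≥ 1 suffice. -/
theorem SymbolElliptic.homogeneous {m : ℕ} (hm : 1 ≤ m) {a : (Fin n → ℕ) → E →L[ℂ] E} {κ θ : ℝ}
    (h : SymbolElliptic m a κ θ) (hκ : 1 ≤ κ) (h0 : 0 ≤ θ) (hπ : θ ≤ Real.pi) (ξ : V n) {z : ℂ}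
    (hz : z ∈ sector θ) (hz0 : z ≠ 0) :
    IsUnit (z • (1 : E →L[ℂ] E) + principalSymbol m a ξ) ∧
      ‖Ring.inverse (z • (1 : E →L[ℂ] E) + principalSymbol m a ξ)‖ ≤ κ / (‖ξ‖ ^ m + ‖z‖) := by
  have hzn : 0 < ‖z‖ := norm_pos_iff.2 hz0
  by_cases hξ : ξ = 0
  · subst hξ
    have h1 : principalSymbol m a 0 = 0 := by
      have := principalSymbol_smul m a 0 0
      rwa [zero_smul, zero_pow (by omega), Complex.ofReal_zero, zero_smul] at this
    obtain ⟨h2, h3⟩ := ring_inverse_smul z hz0 (1 : E →L[ℂ] E) isUnit_one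
    rw [h1, add_zero]
    refine ⟨h2, ?_⟩
    rw [h3, Ring.inverse_one, norm_smul, norm_inv, norm_zero, zero_pow (by omega), zero_add,
      inv_mul_eq_div]
    gcongr
    exact ContinuousLinearMap.norm_id_le.trans hκ
  · set r := ‖ξ‖ with hr
    have hr0 : 0 < r := norm_pos_iff.2 hξ
    have hrm : 0 < r ^ m := by positivity
    have hc : ((r ^ m : ℝ) : ℂ) ≠ 0 := by exact_mod_cast hrm.ne'
    have hun : ‖r⁻¹ • ξ‖ = 1 := by
      rw [norm_smul, norm_inv, norm_norm, inv_mul_cancel₀ hr0.ne']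
    obtain ⟨h1, h2⟩ := h _ hun (((r ^ m)⁻¹ : ℝ) * z) (smul_mem_sector h0 hπ hz (by positivity))
    have e : z • (1 : E →L[ℂ] E) + principalSymbol m a ξ = ((r ^ m : ℝ) : ℂ) •
        ((((r ^ m)⁻¹ : ℝ) * z : ℂ) • (1 : E →L[ℂ] E) + principalSymbol m a (r⁻¹ • ξ)) := by
      rw [smul_add, smul_smul, ← principalSymbol_smul, smul_smul, mul_inv_cancel₀ hr0.ne', one_smul,
        ← mul_assoc, ← Complex.ofReal_mul, mul_inv_cancel₀ hrm.ne', Complex.ofReal_one, one_mul]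
    obtain ⟨h3, h4⟩ := ring_inverse_smul _ hc _ h1
    rw [e]
    refine ⟨h3, ?_⟩
    rw [h4, norm_smul, norm_inv, Complex.norm_real, Real.norm_of_nonneg hrm.le]
    calc (r ^ m)⁻¹ * ‖Ring.inverse ((((r ^ m)⁻¹ : ℝ) * z : ℂ) • (1 : E →L[ℂ] E) +
          principalSymbol m a (r⁻¹ • ξ))‖
        ≤ (r ^ m)⁻¹ * (κ / (1 + ‖(((r ^ m)⁻¹ : ℝ) * z : ℂ)‖)) := by gcongr
      _ = κ / (r ^ m + ‖z‖) := by
          rw [norm_mul, Complex.norm_real, Real.norm_of_nonneg (by positivity)]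
          field_simp

/-- Lower order terms are dominated by `ε(r^m + ω)`. -/
theorem exists_lower_order_le (m : ℕ) (C ε : ℝ) (hC : 0 ≤ C) (hε : 0 < ε) :
    ∃ ω : ℝ, 1 ≤ ω ∧ ∀ r : ℝ, 0 ≤ r → C * ∑ i ∈ Finset.range m, r ^ i ≤ ε * (r ^ m + ω) := by
  -- Beyond R₀ the power ε r^m alone dominates the lower powers. On [0, R₀] they are bounded by the
  -- constant A, which ω = A/ε absorbs.
  set R₀ := max 1 (C * m / ε)
  have hR : 1 ≤ R₀ := le_max_left _ _
  set A := C * ∑ i ∈ Finset.range m, R₀ ^ i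
  refine ⟨max 1 (A / ε), le_max_left _ _, fun r hr => ?_⟩
  rcases le_total r R₀ with h | h
  · have h1 : C * ∑ i ∈ Finset.range m, r ^ i ≤ A := by
      refine mul_le_mul_of_nonneg_left (Finset.sum_le_sum fun i _ => ?_) hC
      exact pow_le_pow_left₀ hr h i
    have h2 : A ≤ ε * max 1 (A / ε) := by
      rw [← div_le_iff₀' hε]
      exact le_max_right _ _
    have h3 : 0 ≤ ε * r ^ m := by positivity
    rw [mul_add]
    linarith
  · have hr1 : 1 ≤ r := hR.trans h
    have hω : 0 ≤ ε * max 1 (A / ε) := by positivity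
    rcases m with _ | m
    · simp only [Finset.range_zero, Finset.sum_empty, mul_zero]
      positivity
    · have h1 : ∑ i ∈ Finset.range (m + 1), r ^ i ≤ ((m + 1 : ℕ) : ℝ) * r ^ m := by
        refine (Finset.sum_le_card_nsmul _ _ (r ^ m) fun i hi => ?_).trans ?_
        · exact pow_le_pow_right₀ hr1 (by have := Finset.mem_range.1 hi; omega)
        · rw [Finset.card_range, nsmul_eq_mul]
      have h2 : C * ((m + 1 : ℕ) : ℝ) ≤ ε * r := by
        rw [← div_le_iff₀' hε]
        exact (le_max_right _ _).trans h
      calc C * ∑ i ∈ Finset.range (m + 1), r ^ i ≤ C * (((m + 1 : ℕ) : ℝ) * r ^ m) := by gcongr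
        _ = C * ((m + 1 : ℕ) : ℝ) * r ^ m := by ring
        _ ≤ ε * r * r ^ m := by gcongr
        _ = ε * r ^ (m + 1) := by ring
        _ ≤ ε * (r ^ (m + 1) + max 1 (A / ε)) := by rw [mul_add]; linarith

variable [CompleteSpace E]

/-- Invertibility of `z + ∑_{|α| ≤ m} a_α ξ^α` for large `z` in the sector. -/
theorem exists_fullSymbol_inverse (m : ℕ) (hm : 1 ≤ m) (C κ θ : ℝ) (hC : 0 ≤ C) (hκ : 1 ≤ κ)
    (h0 : 0 ≤ θ) (hπ : θ ≤ Real.pi) :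
    ∃ ω : ℝ, 1 ≤ ω ∧ ∀ {n : ℕ} {E : Type*} [NormedAddCommGroup E] [NormedSpace ℂ E]
      [CompleteSpace E] (a : (Fin n → ℕ) → E →L[ℂ] E), coeffNorm m a ≤ C →
      SymbolElliptic m a κ θ → ∀ z ∈ sector θ, ω ≤ ‖z‖ → ∀ ξ : V n,
        IsUnit (z • (1 : E →L[ℂ] E) + fullSymbol m a ξ) ∧
          ‖Ring.inverse (z • (1 : E →L[ℂ] E) + fullSymbol m a ξ)‖ ≤
            2 * κ / (‖ξ‖ ^ m + ‖z‖) := by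
  -- With ε = 1/(2κ) the lower order part has relative size at most 1/2, as the Neumann series
  -- requires.
  obtain ⟨ω, hω, h⟩ := exists_lower_order_le m C (1 / (2 * κ)) hC (by positivity)
  refine ⟨ω, hω, fun {n E} _ _ _ a ha hell z hz hzω ξ => ?_⟩
  have hz0 : z ≠ 0 := norm_pos_iff.1 (by linarith)
  obtain ⟨h1, h2⟩ := hell.homogeneous hm hκ h0 hπ ξ hz hz0
  set b := ∑ i ∈ Finset.range m, principalSymbol i a ξ with hb
  have hden : 0 < ‖ξ‖ ^ m + ‖z‖ := by
    have : 0 ≤ ‖ξ‖ ^ m := by positivity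
    linarith
  have hbn : ‖b‖ ≤ C * ∑ i ∈ Finset.range m, ‖ξ‖ ^ i := by
    rw [Finset.mul_sum]
    refine (norm_sum_le _ _).trans (Finset.sum_le_sum fun i hi => ?_)
    refine (norm_principalSymbol_le i a ξ).trans ?_
    rw [mul_comm]
    refine mul_le_mul_of_nonneg_right (le_trans ?_ ha) (by positivity)
    exact Finset.single_le_sum (f := fun i => ∑ α ∈ multiIdx n i, ‖a α‖)
      (fun _ _ => Finset.sum_nonneg fun _ _ => norm_nonneg _)
      (Finset.mem_range.2 (by have := Finset.mem_range.1 hi; omega))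
  have e : z • (1 : E →L[ℂ] E) + fullSymbol m a ξ =
      (z • (1 : E →L[ℂ] E) + principalSymbol m a ξ) + b := by
    rw [fullSymbol, Finset.sum_range_succ, add_assoc, add_comm b]
  rw [e, mul_div_assoc]
  refine isUnit_add_of_inverse _ b h1 _ h2 ?_
  have h3 : ‖b‖ ≤ 1 / (2 * κ) * (‖ξ‖ ^ m + ‖z‖) :=
    (hbn.trans (h _ (norm_nonneg ξ))).trans (by gcongr)
  calc κ / (‖ξ‖ ^ m + ‖z‖) * ‖b‖ ≤ κ / (‖ξ‖ ^ m + ‖z‖) * (1 / (2 * κ) * (‖ξ‖ ^ m + ‖z‖)) := by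
        gcongr
    _ = 1 / 2 := by field_simp

/-- Ellipticity persists on a slightly larger sector. -/
theorem SymbolElliptic.enlarge {m : ℕ} {a : (Fin n → ℕ) → E →L[ℂ] E} {κ : ℝ} (hκ : 1 ≤ κ)
    (h : SymbolElliptic m a κ (Real.pi / 2)) {δ : ℝ} (hδ0 : 0 ≤ δ) (hδ : δ ≤ 1 / (4 * κ))
    (hδ' : δ ≤ Real.pi / 2) : SymbolElliptic m a (4 * κ) (Real.pi / 2 + δ) := by
  intro ξ hξ z hz
  have hpi := Real.pi_pos
  rw [mem_sector_iff (by linarith) (by linarith), add_comm, Real.cos_add_pi_div_two] at hz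
  have hs0 : 0 ≤ Real.sin δ := Real.sin_nonneg_of_nonneg_of_le_pi hδ0 (by linarith)
  have hs : Real.sin δ ≤ δ := Real.sin_le hδ0
  -- The point w is the projection of z onto the closed right half-plane, at distance at most sin δ
  -- · |z| ≤ δ|z|. With δ ≤ 1/(4κ) the perturbation (z - w) has relative size at most 1/2.
  obtain ⟨w, hw, hwd⟩ : ∃ w ∈ sector (Real.pi / 2), ‖z - w‖ ≤ δ * ‖z‖ := by
    by_cases hre : 0 ≤ z.re
    · refine ⟨z, ?_, by simpa using mul_nonneg hδ0 (norm_nonneg z)⟩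
      rw [mem_sector_iff (by linarith) (by linarith), Real.cos_pi_div_two, zero_mul]
      exact hre
    · refine ⟨z.im * Complex.I, ?_, ?_⟩
      · rw [mem_sector_iff (by linarith) (by linarith), Real.cos_pi_div_two, zero_mul]
        simp
      · have : z - z.im * Complex.I = (z.re : ℂ) := by
          apply Complex.ext <;> simp
        rw [this, Complex.norm_real, Real.norm_eq_abs, abs_of_neg (not_le.1 hre)]
        nlinarith [norm_nonneg z]
  obtain ⟨h1, h2⟩ := h ξ hξ w hw
  have e : z • (1 : E →L[ℂ] E) + principalSymbol m a ξ =
      (w • (1 : E →L[ℂ] E) + principalSymbol m a ξ) + (z - w) • (1 : E →L[ℂ] E) := by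
    rw [sub_smul]
    abel
  have hδ4 : δ ≤ 1 / 4 := hδ.trans (by
    rw [div_le_div_iff₀ (by positivity) (by positivity)]
    linarith)
  have hnw : 3 / 4 * ‖z‖ ≤ ‖w‖ := by
    have := norm_sub_norm_le z w
    nlinarith [norm_nonneg z]
  have h3 : κ / (1 + ‖w‖) * ‖(z - w) • (1 : E →L[ℂ] E)‖ ≤ 1 / 2 := by
    have h4 : ‖(z - w) • (1 : E →L[ℂ] E)‖ ≤ 1 / (4 * κ) * ‖z‖ := by
      rw [norm_smul]
      calc ‖z - w‖ * ‖(1 : E →L[ℂ] E)‖ ≤ ‖z - w‖ * 1 := by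
            gcongr
            exact ContinuousLinearMap.norm_id_le
        _ ≤ 1 / (4 * κ) * ‖z‖ := by
            rw [mul_one]
            exact hwd.trans (by gcongr)
    calc κ / (1 + ‖w‖) * ‖(z - w) • (1 : E →L[ℂ] E)‖ ≤ κ / (1 + ‖w‖) * (1 / (4 * κ) * ‖z‖) := by gcongr
      _ = (‖z‖ / 4) / (1 + ‖w‖) := by field_simp
      _ ≤ 1 / 2 := by
        rw [div_le_iff₀ (by positivity)]
        linarith [norm_nonneg z]
  obtain ⟨h5, h6⟩ := isUnit_add_of_inverse _ ((z - w) • (1 : E →L[ℂ] E)) h1 _ h2 h3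
  rw [e]
  refine ⟨h5, h6.trans ?_⟩
  rw [← mul_div_assoc, div_le_div_iff₀ (by positivity) (by positivity)]
  nlinarith [norm_nonneg z, norm_nonneg w]

/-- Derivative bounds for the rescaled full symbol. -/
theorem exists_norm_iteratedFDeriv_fullSymbol_le (n m N : ℕ) : ∃ P : ℝ, 0 ≤ P ∧
    ∀ {E : Type*} [NormedAddCommGroup E] [NormedSpace ℂ E] (a : (Fin n → ℕ) → E →L[ℂ] E),
      ContDiff ℝ (⊤ : ℕ∞) (fullSymbol m a) ∧
      ∀ (j : ℕ) (η : V n), ‖η‖ ≤ 2 → ∀ i ≤ N,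
        ‖iteratedFDeriv ℝ i (fun η => fullSymbol m a ((2 : ℝ) ^ j • η)) η‖ ≤
          P * coeffNorm m a * ((2 : ℝ) ^ j) ^ m := by
  let μ : (Fin n → ℕ) → V n → ℝ := fun α η => ∏ j, η j ^ α j
  have hμ : ∀ α, ContDiff ℝ (⊤ : ℕ∞) (μ α) := fun α =>
    contDiff_prod fun j _ => ((EuclideanSpace.proj (𝕜 := ℝ) j : V n →L[ℝ] ℝ).contDiff).pow _
  have hb : ∀ α i, ∃ B, ∀ η ∈ Metric.closedBall (0 : V n) 2, ‖iteratedFDeriv ℝ i (μ α) η‖ ≤ B :=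
    fun α i => (isCompact_closedBall (0 : V n) 2).exists_bound_of_continuousOn
      ((hμ α).continuous_iteratedFDeriv (by exact_mod_cast le_top)).continuousOn
  choose B hB using hb
  set P := ∑ l ∈ Finset.range (m + 1), ∑ α ∈ multiIdx n l, ∑ i ∈ Finset.range (N + 1), |B α i|
  have hP : ∀ l ∈ Finset.range (m + 1), ∀ α ∈ multiIdx n l, ∀ i ≤ N, B α i ≤ P := by
    intro l hl α hα i hi
    refine (le_abs_self _).trans ?_
    refine le_trans ?_ (Finset.single_le_sum (f := fun l => ∑ α ∈ multiIdx n l,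
      ∑ i ∈ Finset.range (N + 1), |B α i|) (fun _ _ => by positivity) hl)
    refine le_trans ?_ (Finset.single_le_sum (f := fun α =>
      ∑ i ∈ Finset.range (N + 1), |B α i|) (fun _ _ => by positivity) hα)
    exact Finset.single_le_sum (f := fun i => |B α i|) (fun _ _ => by positivity)
      (Finset.mem_range.2 (by omega))
  refine ⟨P, by positivity, fun {E} _ _ a => ?_⟩
  let L : (Fin n → ℕ) → ℝ →L[ℝ] (E →L[ℂ] E) := fun α =>
    ContinuousLinearMap.toSpanSingleton ℝ (a α)
  -- Homogeneity pulls the dilation out as powers c^l with l ≤ m. For c = 2^j ≥ 1 each is at most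
  -- 2^{jm}, and the remaining monomials are j-independent functions on a fixed ball.
  have hexp : ∀ c : ℝ, (fun η : V n => fullSymbol m a (c • η)) =
      fun η => ∑ l ∈ Finset.range (m + 1), ∑ α ∈ multiIdx n l, (c ^ l • L α) (μ α η) := by
    intro c
    funext η
    refine Finset.sum_congr rfl fun l _ => ?_
    rw [principalSymbol_smul, principalSymbol, Finset.smul_sum]
    rfl
  have hterm : ∀ (c : ℝ) l α, ContDiff ℝ (⊤ : ℕ∞) (fun η => (c ^ l • L α) (μ α η)) :=
    fun c l α => (c ^ l • L α).contDiff.comp (hμ α)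
  refine ⟨?_, fun j η hη i hi => ?_⟩
  · have h1 := hexp 1
    simp only [one_smul] at h1
    have h2 : fullSymbol m a = fun η => fullSymbol m a η := rfl
    rw [h2, h1]
    exact ContDiff.sum fun l _ => ContDiff.sum fun α _ => by simpa using hterm 1 l α
  · rw [hexp]
    have hi' : ((i : ℕ∞) : WithTop ℕ∞) ≤ (⊤ : ℕ∞) := by exact_mod_cast le_top
    rw [iteratedFDeriv_fun_sum_apply fun l _ =>
      ((ContDiff.sum fun α _ => hterm _ l α).of_le hi').contDiffAt]
    have hc1 : (1 : ℝ) ≤ 2 ^ j := one_le_pow₀ (by norm_num)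
    have : P * coeffNorm m a * ((2 : ℝ) ^ j) ^ m = ∑ l ∈ Finset.range (m + 1),
        ∑ α ∈ multiIdx n l, P * ‖a α‖ * ((2 : ℝ) ^ j) ^ m := by
      simp only [coeffNorm, Finset.mul_sum, Finset.sum_mul]
    rw [this]
    refine (norm_sum_le _ _).trans (Finset.sum_le_sum fun l hl => ?_)
    rw [iteratedFDeriv_fun_sum_apply fun α _ => ((hterm _ l α).of_le hi').contDiffAt]
    refine (norm_sum_le _ _).trans (Finset.sum_le_sum fun α hα => ?_)
    refine (ContinuousLinearMap.norm_iteratedFDeriv_comp_left _ (hμ α).contDiffAt hi').trans ?_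
    have h1 : ‖((2 : ℝ) ^ j) ^ l • L α‖ ≤ ((2 : ℝ) ^ j) ^ m * ‖a α‖ := by
      have hl' : l ≤ m := by
        have := Finset.mem_range.1 hl
        omega
      refine ContinuousLinearMap.opNorm_le_bound _ (by positivity) fun x => ?_
      change ‖((2 : ℝ) ^ j) ^ l • (x • a α)‖ ≤ _
      rw [norm_smul, norm_smul, Real.norm_of_nonneg (by positivity), mul_comm ‖x‖, ← mul_assoc]
      gcongr
    have h2 : ‖iteratedFDeriv ℝ i (μ α) η‖ ≤ P :=
      (hB α i η (by simpa using hη)).trans (hP l hl α hα i hi)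
    calc ‖((2 : ℝ) ^ j) ^ l • L α‖ * ‖iteratedFDeriv ℝ i (μ α) η‖
        ≤ ((2 : ℝ) ^ j) ^ m * ‖a α‖ * P := by gcongr
      _ = P * ‖a α‖ * ((2 : ℝ) ^ j) ^ m := by ring

end Symbols

/-! ### Block bounds for differential operators and their resolvents. -/

section SymbolMultipliers

variable {n : ℕ}

theorem iteratedFDeriv_const_add_apply {W F : Type*} [NormedAddCommGroup W] [NormedSpace ℝ W]
    [NormedAddCommGroup F] [NormedSpace ℝ F] (c : F) {f : W → F} {l : ℕ} {x : W}
    (hf : ContDiffAt ℝ l f x) (hl : l ≠ 0) :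
    iteratedFDeriv ℝ l (fun x => c + f x) x = iteratedFDeriv ℝ l f x := by
  have h := iteratedFDeriv_add_apply (𝕜 := ℝ) (i := l) (x := x) (f := fun _ : W => c)
    contDiffAt_const hf
  rw [iteratedFDeriv_const_of_ne hl] at h
  exact h.trans (zero_add _)

/-- The identity is a block multiplier. -/
theorem exists_isBlockMultiplier_one (φ : ResolutionOfUnity n) : ∃ K : ℝ, 0 ≤ K ∧
    ∀ {E : Type*} [NormedAddCommGroup E] [NormedSpace ℂ E] [CompleteSpace E] (p : ℝ≥0∞)
      [Fact (1 ≤ p)], IsBlockMultiplier φ p (fun _ => (1 : E →L[ℂ] E)) (fun _ => K) := by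
  obtain ⟨K, hK, h⟩ := exists_isBlockMultiplier_of_symbol φ
  refine ⟨K * 1, by positivity, fun {E} _ _ _ p _ => h p (fun _ => (1 : E →L[ℂ] E)) (fun _ => 1)
    contDiff_const (fun _ => zero_le_one) fun j η _ _ i _ => ?_⟩
  rcases Nat.eq_zero_or_pos i with rfl | hi
  · rw [norm_iteratedFDeriv_zero]
    exact ContinuousLinearMap.norm_id_le
  · rw [iteratedFDeriv_const_of_ne (by omega)]
    simp

/-- Differential operators with constant coefficients are block multipliers. -/
theorem exists_isBlockMultiplier_fullSymbol (φ : ResolutionOfUnity n) (m : ℕ) : ∃ K : ℝ, 0 ≤ K ∧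
    ∀ {E : Type*} [NormedAddCommGroup E] [NormedSpace ℂ E] [CompleteSpace E] (p : ℝ≥0∞)
      [Fact (1 ≤ p)] (a : (Fin n → ℕ) → E →L[ℂ] E),
      IsBlockMultiplier φ p (fun k => fullSymbol m a (latticePt k))
        (fun j => K * coeffNorm m a * ((2 : ℝ) ^ j) ^ m) := by
  obtain ⟨K, hK, h⟩ := exists_isBlockMultiplier_of_symbol φ
  obtain ⟨P, hP, hder⟩ := exists_norm_iteratedFDeriv_fullSymbol_le n m (n + 1)
  refine ⟨K * P, by positivity, fun {E} _ _ _ p _ a => ?_⟩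
  have := coeffNorm_nonneg m a
  refine (h p (fullSymbol m a) (fun j => P * coeffNorm m a * ((2 : ℝ) ^ j) ^ m) (hder a).1
    (fun j => by positivity) fun j η hη _ i hi => (hder a).2 j η hη i hi).mono_bound fun j => ?_
  exact le_of_eq (by ring)

/-- The resolvent multipliers `(z + ∑_{|α| ≤ m} a_α k^α)⁻¹`. -/
def resSymbol {E : Type*} [NormedAddCommGroup E] [NormedSpace ℂ E] (m : ℕ)
    (a : (Fin n → ℕ) → E →L[ℂ] E) (z : ℂ) (k : Fin n → ℤ) : E →L[ℂ] E :=
  Ring.inverse (z • (1 : E →L[ℂ] E) + fullSymbol m a (latticePt k))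

/-- Resolvent estimates for the multipliers `(z + ∑_{|α| ≤ m} a_α k^α)⁻¹`, uniform in the
coefficients. -/
theorem exists_isBlockMultiplier_resSymbol (φ : ResolutionOfUnity n) (E : Type*)
    [NormedAddCommGroup E] [NormedSpace ℂ E] [CompleteSpace E] (m : ℕ) (hm : 1 ≤ m) (C κ θ : ℝ)
    (hC : 0 ≤ C) (hκ : 1 ≤ κ) (h0 : 0 ≤ θ) (hπ : θ ≤ Real.pi) :
    ∃ ω : ℝ, 1 ≤ ω ∧ ∃ K : ℝ, 0 ≤ K ∧ ∀ (p : ℝ≥0∞) [Fact (1 ≤ p)] (a : (Fin n → ℕ) → E →L[ℂ] E),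
      coeffNorm m a ≤ C → SymbolElliptic m a κ θ → ∀ z ∈ sector θ, ω ≤ ‖z‖ →
        (∀ k, IsUnit (z • (1 : E →L[ℂ] E) + fullSymbol m a (latticePt k))) ∧
        (∀ k, ‖resSymbol m a z k‖ ≤ K / ‖z‖) ∧
        IsBlockMultiplier φ p (resSymbol m a z) (fun j => K / (((2 : ℝ) ^ j) ^ m + ‖z‖)) := by
  obtain ⟨K₁, hK₁, hmul⟩ := exists_isBlockMultiplier_of_symbol φ
  obtain ⟨P, hP, hder⟩ := exists_norm_iteratedFDeriv_fullSymbol_le n m (n + 1)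
  obtain ⟨ω, hω, hinv⟩ := exists_fullSymbol_inverse m hm C κ θ hC hκ h0 hπ
  -- The factor 2^m is the price for replacing |ξ|^m by 2^{jm} in the denominator on the j-th shell.
  set K₂ : ℝ := 2 * κ * 2 ^ m with hK₂
  have hK₂0 : 0 ≤ K₂ := by positivity
  -- The relative derivative bound is K₂PC; the summand 1 only serves to make it at least 1.
  obtain ⟨K₃, hK₃, hri⟩ := exists_norm_iteratedFDeriv_inverse_le (E →L[ℂ] E) (n + 1)
    (1 + K₂ * (P * C)) (le_add_of_nonneg_right (by positivity))
  refine ⟨ω, hω, K₁ * (K₃ * K₂) + 2 * κ, by positivity, fun p _ a ha hell z hz hzω => ?_⟩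
  have hz0 : 0 < ‖z‖ := by linarith
  have hi := hinv a ha hell z hz hzω
  refine ⟨fun k => (hi _).1, fun k => (hi _).2.trans ?_, ?_⟩
  · have : 0 ≤ ‖latticePt k‖ ^ m := by positivity
    have : 0 ≤ K₁ * (K₃ * K₂) := by positivity
    gcongr
    · linarith
    · linarith
  · set G : V n → E →L[ℂ] E := fun ξ => Ring.inverse (z • (1 : E →L[ℂ] E) + fullSymbol m a ξ)
    have hAs := (hder a).1
    have hTs : ContDiff ℝ (⊤ : ℕ∞) fun ξ => z • (1 : E →L[ℂ] E) + fullSymbol m a ξ :=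
      contDiff_const.add hAs
    have hGs : ContDiff ℝ (⊤ : ℕ∞) G := by
      rw [contDiff_iff_contDiffAt]
      intro ξ
      obtain ⟨u, hu⟩ := (hi ξ).1
      have h3 : ContDiffAt ℝ (⊤ : ℕ∞) (Ring.inverse : (E →L[ℂ] E) → E →L[ℂ] E)
          (z • (1 : E →L[ℂ] E) + fullSymbol m a ξ) := hu ▸ contDiffAt_ringInverse ℝ u
      exact h3.comp ξ hTs.contDiffAt
    refine (hmul p G (fun j => K₃ * (K₂ / (((2 : ℝ) ^ j) ^ m + ‖z‖))) hGs
      (fun j => by positivity) fun j η hη1 hη2 i hi' => ?_).mono_bound fun j => ?_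
    · have hTj : ContDiff ℝ (⊤ : ℕ∞) fun η : V n =>
          z • (1 : E →L[ℂ] E) + fullSymbol m a ((2 : ℝ) ^ j • η) := hTs.comp (contDiff_const_smul _)
      have hcoef : ‖Ring.inverse (z • (1 : E →L[ℂ] E) + fullSymbol m a ((2 : ℝ) ^ j • η))‖ ≤
          K₂ / (((2 : ℝ) ^ j) ^ m + ‖z‖) := by
        refine (hi _).2.trans ?_
        rw [norm_smul, Real.norm_of_nonneg (by positivity), mul_pow, hK₂]
        rw [div_le_div_iff₀ (by positivity) (by positivity)]
        have h2m : (1 : ℝ) ≤ 2 ^ m := one_le_pow₀ (by norm_num)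
        -- For j ≥ 1 this uses |η| ≥ 1/2. For j = 0 the point η may be 0, and |z| ≥ ω ≥ 1 takes
        -- over.
        have h5 : ((2 : ℝ) ^ j) ^ m + ‖z‖ ≤ 2 ^ m * (((2 : ℝ) ^ j) ^ m * ‖η‖ ^ m + ‖z‖) := by
          rcases Nat.eq_zero_or_pos j with rfl | hj
          · have h6 : (2 : ℝ) ≤ 2 ^ m := le_self_pow₀ (by norm_num) (by omega)
            have h7 : 0 ≤ ‖η‖ ^ m := by positivity
            simp only [pow_zero, one_pow, one_mul]
            nlinarith
          · have h6 : (1 / 2 : ℝ) ^ m ≤ ‖η‖ ^ m := pow_le_pow_left₀ (by norm_num) (hη2 hj) m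
            have h7 : (1 : ℝ) ≤ 2 ^ m * ‖η‖ ^ m := by
              calc (1 : ℝ) = 2 ^ m * (1 / 2) ^ m := by rw [← mul_pow]; norm_num
                _ ≤ _ := by gcongr
            have h8 : 0 ≤ ((2 : ℝ) ^ j) ^ m := by positivity
            nlinarith
        nlinarith
      have hrel : ∀ l, 1 ≤ l → l ≤ n + 1 →
          ‖Ring.inverse (z • (1 : E →L[ℂ] E) + fullSymbol m a ((2 : ℝ) ^ j • η))‖ *
          ‖iteratedFDeriv ℝ l (fun η : V n => z • (1 : E →L[ℂ] E) +
            fullSymbol m a ((2 : ℝ) ^ j • η)) η‖ ≤ 1 + K₂ * (P * C) := by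
        intro l hl1 hl
        have hl' : ((l : ℕ∞) : WithTop ℕ∞) ≤ (⊤ : ℕ∞) := by exact_mod_cast le_top
        have hsplit : iteratedFDeriv ℝ l (fun η : V n => z • (1 : E →L[ℂ] E) +
            fullSymbol m a ((2 : ℝ) ^ j • η)) η =
            iteratedFDeriv ℝ l (fun η : V n => fullSymbol m a ((2 : ℝ) ^ j • η)) η := by
          have h9 : ContDiff ℝ (⊤ : ℕ∞) fun η : V n => fullSymbol m a ((2 : ℝ) ^ j • η) :=
            hAs.comp (contDiff_const_smul _)
          exact iteratedFDeriv_const_add_apply _ (h9.contDiffAt.of_le hl') (by omega)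
        rw [hsplit]
        have h11 := (hder a).2 j η hη1 l hl
        -- The growth 2^{jm} of the derivatives is compensated by the size of the inverse, so the
        -- relative bound is uniform in j, z and the coefficients.
        calc _ ≤ K₂ / (((2 : ℝ) ^ j) ^ m + ‖z‖) * (P * C * ((2 : ℝ) ^ j) ^ m) := by
              refine mul_le_mul hcoef (h11.trans ?_) (norm_nonneg _) (by positivity)
              gcongr
          _ = K₂ * (P * C) * (((2 : ℝ) ^ j) ^ m / (((2 : ℝ) ^ j) ^ m + ‖z‖)) := by ring
          _ ≤ K₂ * (P * C) * 1 := by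
              gcongr
              rw [div_le_one (by positivity)]
              linarith
          _ ≤ 1 + K₂ * (P * C) := by linarith
      refine (hri _ hTj (fun η => (hi _).1) η hrel i hi').trans ?_
      gcongr
    · rw [← mul_div_assoc, ← mul_div_assoc]
      gcongr
      linarith

end SymbolMultipliers

/-! ### Multipliers on Besov spaces and the resolvent of the realization. -/

section BesovMultipliers

variable {n : ℕ} {E : Type*} [NormedAddCommGroup E] [NormedSpace ℂ E]
  {φ : ResolutionOfUnity n} {s : ℝ} {p q : ℝ≥0∞} [Fact (1 ≤ p)]

theorem Besov.ext_coef {u v : Besov E φ s p q}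
    (h : ∀ k, fourierCoef k u.1 = fourierCoef k v.1) : u = v :=
  Subtype.ext (Distr.ext_coef h)

variable [Fact (1 ≤ q)]

/-- A block multiplier has a bounded symbol. -/
theorem IsBlockMultiplier.norm_symbol_le {M : (Fin n → ℤ) → E →L[ℂ] E} {b : ℝ} (hb : 0 ≤ b)
    (h : IsBlockMultiplier φ p M fun _ => b) (k : Fin n → ℤ) : ‖M k‖ ≤ 5 * b := by
  refine ContinuousLinearMap.opNorm_le_bound _ (by positivity) fun x => ?_
  obtain ⟨j, hj⟩ : ∃ j, φ.fn j (latticePt k) ≠ 0 := by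
    by_contra! h0
    have := φ.sum_eq_one (latticePt k)
    simp only [h0] at this
    exact zero_ne_one (hasSum_zero.unique this)
  have e : M k x = ∑ i ∈ nbhd j, φ.fn i (latticePt k) • M k x := by
    rw [← Finset.sum_smul, φ.sum_nbhd hj, one_smul]
  rw [e, mul_assoc]
  refine (norm_sum_le _ _).trans (sum_nbhd_le _ _ (by positivity) j fun i _ => ?_)
  have h1 := h i {k} fun _ => x
  simpa only [Finset.sum_singleton, norm_mono] using h1

/-- The operator norm of a Fourier multiplier on a Besov space. -/
theorem IsBlockMultiplier.opNorm_le {M : (Fin n → ℤ) → E →L[ℂ] E} {b : ℝ} (hb : 0 ≤ b)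
    (h : IsBlockMultiplier φ p M fun _ => b) {R : Besov E φ s p q →L[ℂ] Besov E φ s p q}
    (hR : ∀ x k, fourierCoef k (R x).1 = M k (fourierCoef k x.1)) :
    ‖R‖ ≤ 25 * 2 ^ (2 * |s|) * b := by
  refine R.opNorm_le_bound (by positivity) fun x => ?_
  obtain ⟨hv, hle⟩ := h.exists_norm_le q (c := b) (s := s) (s' := s) (fun _ => hb) hb
    (fun j => le_of_eq (mul_comm _ _)) x (R x).1 (hR x)
  exact hle

theorem IsBlockMultiplier.exists_clm [CompleteSpace E] (s : ℝ) (q : ℝ≥0∞) [Fact (1 ≤ q)]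
    {M : (Fin n → ℤ) → E →L[ℂ] E} {b : ℝ} (hb : 0 ≤ b)
    (h : IsBlockMultiplier φ p M fun _ => b) :
    ∃ R : Besov E φ s p q →L[ℂ] Besov E φ s p q,
      ∀ x k, fourierCoef k (R x).1 = M k (fourierCoef k x.1) := by
  obtain ⟨T, hT⟩ := exists_multiplierOp M _ fun k => h.norm_symbol_le hb k
  have hx : ∀ x : Besov E φ s p q, ∃ hv : T x.1 ∈ Besov E φ s p q,
      ‖(⟨T x.1, hv⟩ : Besov E φ s p q)‖ ≤ 25 * 2 ^ (2 * |s|) * b * ‖x‖ := fun x =>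
    h.exists_norm_le q (fun _ => hb) hb (fun j => le_of_eq (mul_comm _ _)) x (T x.1) (hT x.1)
  refine ⟨LinearMap.mkContinuous
    { toFun := fun x => ⟨T x.1, (hx x).1⟩
      map_add' := fun x y => Subtype.ext (map_add T x.1 y.1)
      map_smul' := fun c x => Subtype.ext (map_smul T c x.1) } _ fun x => (hx x).2, fun x k => hT _ _⟩

theorem two_pow_pow_eq (j m : ℕ) : ((2 : ℝ) ^ j) ^ m = 2 ^ ((m : ℝ) * j) := by
  rw [← pow_mul, ← Real.rpow_natCast]
  push_cast
  rw [mul_comm]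

/-- `B^{s+m}_{p,q} ⊆ B^s_{p,q}`, and differential operators of order `m` map `B^{s+m}_{p,q}` to
`B^s_{p,q}`. -/
theorem diffOp_mem_besov [CompleteSpace E] (m : ℕ) (a : (Fin n → ℕ) → E →L[ℂ] E) {u : Distr n E}
    (hu : u ∈ Besov E φ (s + m) p q) :
    u ∈ Besov E φ s p q ∧ diffOp m a u ∈ Besov E φ s p q := by
  obtain ⟨K, hK, h1⟩ := exists_isBlockMultiplier_one φ
  obtain ⟨K', hK', h2⟩ := exists_isBlockMultiplier_fullSymbol φ m
  have ha := coeffNorm_nonneg m a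
  constructor
  · refine ((h1 (E := E) p).exists_norm_le q (c := K) (s := s + m) (s' := s) (fun _ => hK) hK
      (fun j => ?_) ⟨u, hu⟩ u fun k => rfl).1
    rw [mul_comm]
    refine mul_le_mul_of_nonneg_left (Real.rpow_le_rpow_of_exponent_le (by norm_num) ?_) hK
    have : (0 : ℝ) ≤ m * j := by positivity
    linarith
  · refine ((h2 p a).exists_norm_le q (c := K' * coeffNorm m a) (s := s + m) (s' := s)
      (fun j => by positivity) (by positivity) (fun j => le_of_eq ?_) ⟨u, hu⟩ _
      fun k => fourierCoef_diffOp m a u k).1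
    rw [two_pow_pow_eq, add_mul, Real.rpow_add (by norm_num)]
    ring

/-- R' inverts z - B from the left on the domain, which contains R x, so R x = R'(z - B)R x = R' x.
The argument is algebraic and gives genuine equality although X carries only a seminorm. -/
theorem IsResolvent.unique {X : Type*} [SeminormedAddCommGroup X] [NormedSpace ℂ X]
    {B : X →ₗ.[ℂ] X} {z : ℂ} {R R' : X →L[ℂ] X} (h : IsResolvent B z R) (h' : IsResolvent B z R') :
    R = R' := by
  ext x
  obtain ⟨hx, he⟩ := h.1 x
  have := h'.2 ⟨R x, hx⟩
  rw [he] at this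
  exact this.symm

/-- The resolvent of the realization of a differential operator is the multiplier with symbol
`(z + ∑_{|α| ≤ m} a_α k^α)⁻¹`. -/
theorem isResolvent_of_symbol [CompleteSpace E] (m : ℕ) (a : (Fin n → ℕ) → E →L[ℂ] E) (z : ℂ)
    (K : ℝ) (hK : 0 ≤ K)
    (hu : ∀ k, IsUnit (z • (1 : E →L[ℂ] E) + fullSymbol m a (latticePt k)))
    (hM : IsBlockMultiplier φ p (resSymbol m a z) (fun j => K / (((2 : ℝ) ^ j) ^ m + ‖z‖)))
    {R : Besov E φ s p q →L[ℂ] Besov E φ s p q}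
    (hR : ∀ x k, fourierCoef k (R x).1 = resSymbol m a z k (fourierCoef k x.1)) :
    IsResolvent (-realization φ s p q m a) z R := by
  -- The gain of m derivatives: the weight 2^{jm} times K/(2^{jm} + |z|) is at most K.
  have hdom : ∀ x : Besov E φ s p q, (R x).1 ∈ Besov E φ (s + m) p q := by
    intro x
    refine (hM.exists_norm_le q (c := K) (s := s) (s' := s + m) (fun j => by positivity) hK
      (fun j => ?_) x (R x).1 (hR x)).1
    rw [add_mul, Real.rpow_add (by norm_num), ← two_pow_pow_eq]
    have h1 : (0 : ℝ) < ((2 : ℝ) ^ j) ^ m := by positivity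
    have h2 : ((2 : ℝ) ^ j) ^ m / (((2 : ℝ) ^ j) ^ m + ‖z‖) ≤ 1 := by
      rw [div_le_one (by positivity)]
      linarith [norm_nonneg z]
    calc (2 : ℝ) ^ (s * j) * ((2 : ℝ) ^ j) ^ m * (K / (((2 : ℝ) ^ j) ^ m + ‖z‖))
        = K * 2 ^ (s * j) * (((2 : ℝ) ^ j) ^ m / (((2 : ℝ) ^ j) ^ m + ‖z‖)) := by ring
      _ ≤ K * 2 ^ (s * j) * 1 := by gcongr
      _ = K * 2 ^ (s * j) := mul_one _
  constructor
  · intro x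
    refine ⟨⟨hdom x, (diffOp_mem_besov m a (hdom x)).2⟩, Besov.ext_coef fun k => ?_⟩
    change fourierCoef k (z • (R x).1 - -(diffOp m a (R x).1)) = _
    rw [sub_neg_eq_add, map_add, map_smul, fourierCoef_diffOp, hR]
    have := congrArg (fun T : E →L[ℂ] E => T (fourierCoef k x.1)) (Ring.mul_inverse_cancel _ (hu k))
    exact this
  · intro u
    refine Besov.ext_coef fun k => ?_
    rw [hR]
    change resSymbol m a z k (fourierCoef k (z • u.1.1 - -(diffOp m a u.1.1))) = _
    rw [sub_neg_eq_add, map_add, map_smul, fourierCoef_diffOp]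
    have := congrArg (fun T : E →L[ℂ] E => T (fourierCoef k u.1.1)) (Ring.inverse_mul_cancel _ (hu k))
    exact this

end BesovMultipliers

/-- With α = 1 this restricts a holomorphic function to horizontal lines, with α = i to vertical
ones. -/
theorem _root_.HasDerivAt.comp_affine_ofReal {F : Type*} [NormedAddCommGroup F] [NormedSpace ℂ F]
    {f : ℂ → F} {f' : F} {α β : ℂ} {r : ℝ} (h : HasDerivAt f f' (β + r * α)) :
    HasDerivAt (fun r : ℝ => f (β + r * α)) (α • f') r := by
  have h1 : HasDerivAt (fun r : ℝ => β + (r : ℂ) * α) α r := by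
    simpa using (Complex.ofRealCLM.hasDerivAt.mul_const α).const_add β
  exact h.scomp r h1

/-! ### Exponentials in a Banach algebra and their Laplace transform. -/

section ExponentialFormula

variable {𝔸 : Type*} [NormedRing 𝔸] [NormedAlgebra ℂ 𝔸]

/-- The norm of 1 is not assumed to be 1, and the factor 1 + ‖1‖ takes care of the zeroth term of
the series. -/
theorem norm_exp_le_mul_exp_norm (x : 𝔸) :
    ‖NormedSpace.exp x‖ ≤ (1 + ‖(1 : 𝔸)‖) * Real.exp ‖x‖ := by
  have h1 : Summable fun n : ℕ => ‖((n.factorial : ℂ)⁻¹) • x ^ n‖ :=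
    NormedSpace.norm_expSeries_summable' (𝕂 := ℂ) x
  have h2 : HasSum (fun n : ℕ => (1 + ‖(1 : 𝔸)‖) * (‖x‖ ^ n / n.factorial))
      ((1 + ‖(1 : 𝔸)‖) * Real.exp ‖x‖) := by
    refine HasSum.mul_left _ ?_
    rw [Real.exp_eq_exp_ℝ]
    exact NormedSpace.expSeries_div_hasSum_exp ‖x‖
  rw [NormedSpace.exp_eq_tsum ℂ, ← h2.tsum_eq]
  refine (norm_tsum_le_tsum_norm h1).trans (h1.tsum_le_tsum (fun n => ?_) h2.summable)
  rw [norm_smul, norm_inv, Complex.norm_natCast, inv_mul_eq_div, ← mul_div_assoc]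
  gcongr
  rcases n with _ | n
  · simp
  · refine (norm_pow_le' x n.succ_pos).trans (le_mul_of_one_le_left (by positivity) ?_)
    linarith [norm_nonneg (1 : 𝔸)]

variable [CompleteSpace 𝔸]

theorem hasDerivAt_inverse_smul_one_add (B : 𝔸) (z : ℂ) (h : IsUnit (z • (1 : 𝔸) + B)) :
    HasDerivAt (fun z : ℂ => Ring.inverse (z • (1 : 𝔸) + B))
      (-(Ring.inverse (z • (1 : 𝔸) + B) * Ring.inverse (z • (1 : 𝔸) + B))) z := by
  obtain ⟨u, hu⟩ := h
  have h1 : HasDerivAt (fun z : ℂ => z • (1 : 𝔸) + B) 1 z := by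
    simpa using ((hasDerivAt_id z).smul_const (1 : 𝔸)).add_const B
  have h2 := hasFDerivAt_ringInverse (𝕜 := ℂ) u
  rw [hu] at h2
  have h3 := h2.comp_hasDerivAt z h1
  rw [← hu, Ring.inverse_unit]
  refine HasDerivAt.congr_deriv (f := fun z : ℂ => Ring.inverse (z • (1 : 𝔸) + B)) h3 ?_
  simp

/-- The derivative of `r ↦ -e^{-λr} (r R + R²) e^{-rB}`, with `R = (λ + B)⁻¹`. -/
theorem hasDerivAt_laplace_primitive (B : 𝔸) (z : ℂ) (h : IsUnit (z • (1 : 𝔸) + B)) (w : ℂ) :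
    HasDerivAt (fun w : ℂ => -(Complex.exp (-(z * w)) •
        ((w • Ring.inverse (z • (1 : 𝔸) + B) +
          Ring.inverse (z • (1 : 𝔸) + B) * Ring.inverse (z • (1 : 𝔸) + B)) *
            NormedSpace.exp (w • -B))))
      ((w * Complex.exp (-(z * w))) • NormedSpace.exp (w • -B)) w := by
  set R := Ring.inverse (z • (1 : 𝔸) + B)
  -- This identity eliminates B from the derivative of the exponential, after which all terms
  -- containing R cancel.
  have hR : R * B = 1 - z • R := by
    have := Ring.inverse_mul_cancel _ h
    rw [mul_add, mul_smul_comm, mul_one] at this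
    exact eq_sub_of_add_eq' this
  have h1 : HasDerivAt (fun w : ℂ => Complex.exp (-(z * w))) (Complex.exp (-(z * w)) * -z) w := by
    have : HasDerivAt (fun w : ℂ => -(z * w)) (-z) w := by
      simpa using ((hasDerivAt_id' w).const_mul z).fun_neg
    exact this.cexp
  have h2 : HasDerivAt (fun w : ℂ => w • R + R * R) R w := by
    simpa using ((hasDerivAt_id w).smul_const R).add_const (R * R)
  have h3 := hasDerivAt_exp_smul_const' (-B) w
  refine (h1.fun_smul (h2.fun_mul h3)).fun_neg.congr_deriv ?_
  set X := NormedSpace.exp (w • -B)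
  have e : (w • R + R * R) * (-B * X) = -((w • (1 : 𝔸) - (w * z) • R + R - z • (R * R)) * X) := by
    rw [← mul_assoc, mul_neg, neg_mul, add_mul, smul_mul_assoc, mul_assoc, hR]
    simp only [mul_sub, mul_one, mul_smul_comm, smul_sub, smul_smul]
    congr 2
    abel
  rw [e]
  simp only [add_mul, sub_mul, smul_mul_assoc, one_mul, smul_add, smul_sub, smul_smul,
    neg_add, neg_sub]
  module

/-- The Laplace transform of `r e^{-rB}` is `(λ + B)⁻²`. -/
theorem integral_laplace (B : 𝔸) (z : ℂ) (h : IsUnit (z • (1 : 𝔸) + B)) (hz : ‖B‖ < z.re) :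
    IntegrableOn (fun r : ℝ => ((r : ℂ) * Complex.exp (-(z * r))) •
        NormedSpace.exp ((r : ℂ) • -B)) (Ioi 0) ∧
      ∫ r in Ioi (0 : ℝ), ((r : ℂ) * Complex.exp (-(z * r))) • NormedSpace.exp ((r : ℂ) • -B) =
        Ring.inverse (z • (1 : 𝔸) + B) * Ring.inverse (z • (1 : 𝔸) + B) := by
  set R := Ring.inverse (z • (1 : 𝔸) + B)
  obtain ⟨b, hb⟩ : ∃ b, b = z.re - ‖B‖ := ⟨_, rfl⟩
  have hb0 : 0 < b := by linarith
  set M := 1 + ‖(1 : 𝔸)‖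
  have hM : 0 ≤ M := by positivity
  have hexp : ∀ r : ℝ, 0 ≤ r →
      ‖Complex.exp (-(z * r))‖ * ‖NormedSpace.exp ((r : ℂ) • -B)‖ ≤ M * Real.exp (-b * r) := by
    intro r hr
    have h1 := norm_exp_le_mul_exp_norm ((r : ℂ) • -B)
    rw [norm_smul, norm_neg, Complex.norm_real, Real.norm_of_nonneg hr] at h1
    have h2 : ‖Complex.exp (-(z * r))‖ = Real.exp (-(z.re * r)) := by
      rw [Complex.norm_exp]
      simp
    rw [h2]
    calc Real.exp (-(z.re * r)) * ‖NormedSpace.exp ((r : ℂ) • -B)‖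
        ≤ Real.exp (-(z.re * r)) * (M * Real.exp (r * ‖B‖)) := by gcongr
      _ = M * Real.exp (-b * r) := by
          rw [mul_left_comm, ← Real.exp_add, hb]
          ring_nf
  -- Half of the exponential decay is spent on the linear factor r.
  have hr : ∀ r : ℝ, 0 ≤ r → r * Real.exp (-b * r) ≤ 2 / b * Real.exp (-(b / 2) * r) := by
    intro r hr
    have h1 : b / 2 * r ≤ Real.exp (b / 2 * r) := by linarith [Real.add_one_le_exp (b / 2 * r)]
    have h2 : Real.exp (-b * r) = Real.exp (-(b / 2) * r) * Real.exp (-(b / 2 * r)) := by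
      rw [← Real.exp_add]
      ring_nf
    have h3 : b / 2 * r * Real.exp (-(b / 2 * r)) ≤ 1 := by
      rw [Real.exp_neg, ← div_eq_mul_inv, div_le_one (Real.exp_pos _)]
      exact h1
    have h4 : r * Real.exp (-(b / 2 * r)) ≤ 2 / b := by
      rw [le_div_iff₀ hb0]
      linarith
    rw [h2]
    calc r * (Real.exp (-(b / 2) * r) * Real.exp (-(b / 2 * r)))
        = r * Real.exp (-(b / 2 * r)) * Real.exp (-(b / 2) * r) := by ring
      _ ≤ 2 / b * Real.exp (-(b / 2) * r) := by gcongr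
  have hX : Continuous fun r : ℝ => NormedSpace.exp ((r : ℂ) • -B) := by
    have : Continuous fun w : ℂ => NormedSpace.exp (w • -B) :=
      continuous_iff_continuousAt.2 fun w => (hasDerivAt_exp_smul_const (-B) w).continuousAt
    exact this.comp Complex.continuous_ofReal
  have hcont : Continuous fun r : ℝ => ((r : ℂ) * Complex.exp (-(z * r))) •
      NormedSpace.exp ((r : ℂ) • -B) := by
    refine Continuous.smul ?_ hX
    fun_prop
  have hint : IntegrableOn (fun r : ℝ => ((r : ℂ) * Complex.exp (-(z * r))) •
      NormedSpace.exp ((r : ℂ) • -B)) (Ioi 0) := by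
    refine Integrable.mono' (g := fun r => M * (2 / b) * Real.exp (-(b / 2) * r))
      ((exp_neg_integrableOn_Ioi 0 (half_pos hb0)).const_mul _)
      hcont.aestronglyMeasurable ?_
    refine (ae_restrict_mem measurableSet_Ioi).mono fun r hr0 => ?_
    have hr0' : (0 : ℝ) ≤ r := (mem_Ioi.1 hr0).le
    rw [norm_smul, norm_mul, Complex.norm_real, Real.norm_of_nonneg hr0', mul_assoc]
    calc r * (‖Complex.exp (-(z * r))‖ * ‖NormedSpace.exp ((r : ℂ) • -B)‖)
        ≤ r * (M * Real.exp (-b * r)) := mul_le_mul_of_nonneg_left (hexp r hr0') hr0'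
      _ = M * (r * Real.exp (-b * r)) := by ring
      _ ≤ M * (2 / b * Real.exp (-(b / 2) * r)) := mul_le_mul_of_nonneg_left (hr r hr0') hM
      _ = _ := by ring
  refine ⟨hint, ?_⟩
  set F : ℝ → 𝔸 := fun r => -(Complex.exp (-(z * r)) •
    (((r : ℂ) • R + R * R) * NormedSpace.exp ((r : ℂ) • -B))) with hF
  have hlim : Tendsto F atTop (𝓝 0) := by
    have hg : Tendsto (fun r : ℝ => M * (2 / b * ‖R‖) * Real.exp (-(b / 2) * r) +
        M * (‖R‖ * ‖R‖) * Real.exp (-b * r)) atTop (𝓝 0) := by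
      have he : ∀ c : ℝ, 0 < c → Tendsto (fun r : ℝ => Real.exp (-c * r)) atTop (𝓝 0) :=
        fun c hc => Real.tendsto_exp_atBot.comp
          (tendsto_id.const_mul_atTop_of_neg (by linarith))
      simpa using ((he _ (half_pos hb0)).const_mul (M * (2 / b * ‖R‖))).add
        ((he _ hb0).const_mul (M * (‖R‖ * ‖R‖)))
    refine squeeze_zero_norm' ?_ hg
    filter_upwards [eventually_ge_atTop 0] with r hr0
    rw [hF, norm_neg, norm_smul]
    calc ‖Complex.exp (-(z * r))‖ * ‖((r : ℂ) • R + R * R) * NormedSpace.exp ((r : ℂ) • -B)‖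
        ≤ ‖Complex.exp (-(z * r))‖ * ((r * ‖R‖ + ‖R‖ * ‖R‖) * ‖NormedSpace.exp ((r : ℂ) • -B)‖) := by
          gcongr
          refine (norm_mul_le _ _).trans (mul_le_mul_of_nonneg_right ?_ (norm_nonneg _))
          refine (norm_add_le _ _).trans (add_le_add ?_ (norm_mul_le _ _))
          rw [norm_smul, Complex.norm_real, Real.norm_of_nonneg hr0]
      _ = (r * ‖R‖ + ‖R‖ * ‖R‖) * (‖Complex.exp (-(z * r))‖ *
            ‖NormedSpace.exp ((r : ℂ) • -B)‖) := by ring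
      _ ≤ (r * ‖R‖ + ‖R‖ * ‖R‖) * (M * Real.exp (-b * r)) :=
          mul_le_mul_of_nonneg_left (hexp r hr0) (by positivity)
      _ = M * ‖R‖ * (r * Real.exp (-b * r)) + M * (‖R‖ * ‖R‖) * Real.exp (-b * r) := by ring
      _ ≤ M * ‖R‖ * (2 / b * Real.exp (-(b / 2) * r)) + M * (‖R‖ * ‖R‖) * Real.exp (-b * r) :=
          add_le_add_left (mul_le_mul_of_nonneg_left (hr r hr0) (by positivity)) _
      _ = _ := by ring
  have hder : ∀ r : ℝ, HasDerivAt F (((r : ℂ) * Complex.exp (-(z * r))) •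
      NormedSpace.exp ((r : ℂ) • -B)) r := fun r =>
    by simpa only [zero_add, mul_one, one_smul] using
      (hasDerivAt_laplace_primitive B z h (0 + r * 1)).comp_affine_ofReal
  rw [integral_Ioi_of_hasDerivAt_of_tendsto' (fun r _ => hder r) hint hlim]
  simp [hF]

end ExponentialFormula

/-! ### Moving the line of integration. -/

section VerticalLines

variable {F : Type*} [NormedAddCommGroup F] [NormedSpace ℂ F]

/-- The integral of a holomorphic function over a vertical line does not depend on the line. -/
theorem integral_vertical_eq {f f' : ℂ → F} {c₀ : ℝ}
    (hd : ∀ z : ℂ, c₀ < z.re → HasDerivAt f (f' z) z)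
    (hc : ContinuousOn f' {z | c₀ < z.re})
    (hb : ∀ c₁ : ℝ, ∃ M : ℝ, ∀ z : ℂ, c₀ < z.re → z.re ≤ c₁ →
      ‖f z‖ ≤ M * (1 + z.im ^ 2)⁻¹ ∧ ‖f' z‖ ≤ M * (1 + z.im ^ 2)⁻¹)
    {c d : ℝ} (hc₀ : c₀ < c) (hd₀ : c₀ < d) :
    ∫ ξ : ℝ, f (c + ξ * Complex.I) = ∫ ξ : ℝ, f (d + ξ * Complex.I) := by
  have hline : ∀ c : ℝ, Continuous fun ξ : ℝ => (c : ℂ) + ξ * Complex.I := fun c => by fun_prop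
  have hre : ∀ c ξ : ℝ, ((c : ℂ) + ξ * Complex.I).re = c := fun c ξ => by simp
  have him : ∀ c ξ : ℝ, ((c : ℂ) + ξ * Complex.I).im = ξ := fun c ξ => by simp
  have hcf : ContinuousOn f {z | c₀ < z.re} := fun z hz => (hd z hz).continuousAt.continuousWithinAt
  have hmeas : ∀ g : ℂ → F, ContinuousOn g {z | c₀ < z.re} → ∀ c : ℝ, c₀ < c →
      AEStronglyMeasurable (fun ξ : ℝ => g (c + ξ * Complex.I)) volume := fun g hg c hc =>
    (hg.comp_continuous (hline c) fun ξ => by simpa using hc).aestronglyMeasurable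
  have hint : ∀ M : ℝ, Integrable fun ξ : ℝ => M * (1 + ξ ^ 2)⁻¹ := fun M =>
    integrable_inv_one_add_sq.const_mul M
  have hfint : ∀ c : ℝ, c₀ < c → Integrable fun ξ : ℝ => f (c + ξ * Complex.I) := by
    intro c hc'
    obtain ⟨M, hM⟩ := hb c
    refine (hint M).mono' (hmeas f hcf c hc') (ae_of_all _ fun ξ => ?_)
    simpa only [him] using (hM (c + ξ * Complex.I) (by rwa [hre]) (by rw [hre])).1
  have hder : ∀ c : ℝ, c₀ < c →
      HasDerivAt (fun c : ℝ => ∫ ξ : ℝ, f (c + ξ * Complex.I)) 0 c := by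
    intro c hc'
    obtain ⟨M, hM⟩ := hb (c + 1)
    have hs : Ioo c₀ (c + 1) ∈ 𝓝 c := Ioo_mem_nhds hc' (by linarith)
    obtain ⟨h1, h2⟩ := hasDerivAt_integral_of_dominated_loc_of_deriv_le
      (F := fun (c : ℝ) (ξ : ℝ) => f (c + ξ * Complex.I))
      (F' := fun (c : ℝ) (ξ : ℝ) => f' (c + ξ * Complex.I))
      (bound := fun ξ => M * (1 + ξ ^ 2)⁻¹) hs
      (by filter_upwards [hs] with x hx using hmeas f hcf x hx.1) (hfint c hc') (hmeas f' hc c hc')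
      (ae_of_all _ fun ξ x hx => by
        simpa only [him] using (hM (x + ξ * Complex.I) (by rw [hre]; exact hx.1)
          (by rw [hre]; exact hx.2.le)).2) (hint M)
      (ae_of_all _ fun ξ x hx => by
        have := (hd (ξ * Complex.I + x * 1) (by simpa using hx.1)).comp_affine_ofReal
        simpa only [mul_one, one_smul, add_comm] using this)
    -- By holomorphy, i f' is also the derivative of f along the vertical line, so its integral
    -- vanishes. Hence the derivative in c of the line integral, which is ∫ f', is 0.
    have h3 : ∫ ξ : ℝ, Complex.I • f' (c + ξ * Complex.I) = 0 :=
      integral_eq_zero_of_hasDerivAt_of_integrable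
        (fun ξ => (hd (c + ξ * Complex.I) (by rwa [hre])).comp_affine_ofReal)
        (h1.smul Complex.I) (hfint c hc')
    rw [integral_smul, smul_eq_zero_iff_right Complex.I_ne_zero] at h3
    rwa [h3] at h2
  exact isOpen_Ioi.is_const_of_deriv_eq_zero isPreconnected_Ioi
    (fun x hx => (hder x hx).differentiableAt.differentiableWithinAt)
    (fun x hx => (hder x hx).deriv) hc₀ hd₀

end VerticalLines

/-! ### Inversion of the Laplace transform with squared resolvents. -/

section ExponentialFormula

variable {𝔸 : Type*} [NormedRing 𝔸] [NormedAlgebra ℂ 𝔸] [CompleteSpace 𝔸]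

theorem inv_sq_norm_le {z : ℂ} (hz : 1 ≤ z.re) : (‖z‖ ^ 2)⁻¹ ≤ (1 + z.im ^ 2)⁻¹ := by
  rw [Complex.sq_norm, Complex.normSq_apply]
  gcongr
  · nlinarith
  · nlinarith

/-- A quadratic inversion formula for the Laplace transform, on a line far to the right. -/
theorem exp_eq_integral_of_norm_lt (B : 𝔸) {c K : ℝ} (hc : 1 ≤ c) (hB : ‖B‖ < c)
    (hu : ∀ z : ℂ, c ≤ z.re → IsUnit (z • (1 : 𝔸) + B))
    (hK : ∀ z : ℂ, c ≤ z.re → ‖Ring.inverse (z • (1 : 𝔸) + B)‖ ≤ K / ‖z‖) {r : ℝ} (hr : 0 < r) :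
    (r : ℂ) • NormedSpace.exp ((r : ℂ) • -B) = (2 * Real.pi : ℝ)⁻¹ • ∫ ξ : ℝ,
      Complex.exp ((c + ξ * Complex.I) * r) •
        (Ring.inverse (((c : ℂ) + ξ * Complex.I) • (1 : 𝔸) + B) *
          Ring.inverse (((c : ℂ) + ξ * Complex.I) • (1 : 𝔸) + B)) := by
  set Q : ℂ → 𝔸 := fun z => Ring.inverse (z • (1 : 𝔸) + B) * Ring.inverse (z • (1 : 𝔸) + B) with hQ
  -- The factor r is the reason for using the squared resolvent: extended by 0 to r < 0, g is
  -- continuous and its Fourier transform is integrable, so Fourier inversion holds pointwise.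
  let g : ℝ → 𝔸 := fun r => ((max r 0 : ℝ) * Complex.exp (-(c * r))) • NormedSpace.exp ((r : ℂ) • -B)
  have hX : Continuous fun r : ℝ => NormedSpace.exp ((r : ℂ) • -B) := by
    have : Continuous fun w : ℂ => NormedSpace.exp (w • -B) :=
      continuous_iff_continuousAt.2 fun w => (hasDerivAt_exp_smul_const (-B) w).continuousAt
    exact this.comp Complex.continuous_ofReal
  have hgc : Continuous g := by
    refine Continuous.smul ?_ hX
    fun_prop
  have hgind : ∀ h : ℝ → ℂ, (fun r : ℝ => h r • g r) = (Ioi (0 : ℝ)).indicator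
      fun r => h r • (((r : ℂ) * Complex.exp (-(c * r))) • NormedSpace.exp ((r : ℂ) • -B)) := by
    intro h
    funext r
    by_cases hr : 0 < r
    · rw [indicator_of_mem (mem_Ioi.2 hr)]
      simp only [g, max_eq_left hr.le]
    · rw [indicator_of_notMem (by simpa using hr)]
      simp only [g, max_eq_right (not_lt.1 hr), Complex.ofReal_zero, zero_mul, zero_smul, smul_zero]
  have hline : ∀ ξ : ℝ, ((c : ℂ) + ((2 * Real.pi * ξ : ℝ) : ℂ) * Complex.I).re = c := fun ξ => by
    simp
  have hgint : Integrable g := by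
    have h1 := hgind 1
    simp only [Pi.one_apply, one_smul] at h1
    change Integrable fun r => g r
    rw [h1, integrable_indicator_iff measurableSet_Ioi]
    exact (integral_laplace B c (hu c (by simp)) (by simpa using hB)).1
  -- The Fourier transform of g at ξ is the Laplace transform of r exp(-rB) at c + 2πiξ.
  have hfour : FourierTransform.fourier g =
      fun ξ : ℝ => Q (c + ((2 * Real.pi * ξ : ℝ) : ℂ) * Complex.I) := by
    funext ξ
    rw [Real.fourier_real_eq_integral_exp_smul, hgind, integral_indicator measurableSet_Ioi]
    obtain ⟨-, h2⟩ := integral_laplace B (c + ((2 * Real.pi * ξ : ℝ) : ℂ) * Complex.I)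
      (hu _ (hline ξ).ge) (by rw [hline]; exact hB)
    refine Eq.trans ?_ h2
    refine integral_congr_ae (ae_of_all _ fun r => ?_)
    simp only [smul_smul]
    congr 1
    rw [mul_left_comm, ← Complex.exp_add]
    congr 2
    push_cast
    ring
  have hQc : Continuous fun ξ : ℝ => Q (c + ((2 * Real.pi * ξ : ℝ) : ℂ) * Complex.I) := by
    refine continuous_iff_continuousAt.2 fun ξ => ?_
    have h1 := (hasDerivAt_inverse_smul_one_add B (c + ((2 * Real.pi * ξ : ℝ) : ℂ) * Complex.I)
      (hu _ (hline ξ).ge)).continuousAt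
    have h2 : ContinuousAt (fun ξ : ℝ => (c : ℂ) + ((2 * Real.pi * ξ : ℝ) : ℂ) * Complex.I) ξ := by
      fun_prop
    exact ContinuousAt.comp (f := fun ξ : ℝ => (c : ℂ) + ((2 * Real.pi * ξ : ℝ) : ℂ) * Complex.I)
      (h1.mul h1) h2
  have hQb : ∀ z : ℂ, c ≤ z.re → ‖Q z‖ ≤ K ^ 2 * (1 + z.im ^ 2)⁻¹ := by
    intro z hz
    refine (norm_mul_le _ _).trans ?_
    refine (mul_le_mul (hK z hz) (hK z hz) (norm_nonneg _) ((norm_nonneg _).trans (hK z hz))).trans ?_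
    rw [← pow_two, div_pow, div_eq_mul_inv]
    exact mul_le_mul_of_nonneg_left (inv_sq_norm_le (hc.trans hz)) (sq_nonneg K)
  have hfint : Integrable (FourierTransform.fourier g) := by
    rw [hfour]
    refine (integrable_inv_one_add_sq.const_mul (K ^ 2)).mono' hQc.aestronglyMeasurable
      (ae_of_all _ fun ξ => (hQb _ (hline ξ).ge).trans ?_)
    refine mul_le_mul_of_nonneg_left ?_ (sq_nonneg K)
    simp only [Complex.add_im, Complex.ofReal_im, Complex.mul_im, Complex.ofReal_re, Complex.I_im,
      Complex.I_re, mul_one, mul_zero, add_zero, zero_add]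
    have h2 : (1 : ℝ) ≤ (2 * Real.pi) ^ 2 := one_le_pow₀ (by linarith [Real.pi_gt_three])
    refine inv_anti₀ (by positivity) ?_
    rw [mul_pow]
    nlinarith [sq_nonneg ξ]
  have hinv := congrFun (hgc.fourierInv_fourier_eq hgint hfint) r
  rw [Real.fourierInv_eq', hfour] at hinv
  have h1 : (r : ℂ) • NormedSpace.exp ((r : ℂ) • -B) = Complex.exp (c * r) • g r := by
    simp only [g, max_eq_left hr.le, smul_smul]
    congr 1
    rw [mul_left_comm, ← Complex.exp_add, add_neg_cancel, Complex.exp_zero, mul_one]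
  have h2 := Measure.integral_comp_mul_left
    (fun ξ : ℝ => Complex.exp ((c + ξ * Complex.I) * r) • Q (c + ξ * Complex.I)) (2 * Real.pi)
  rw [abs_of_pos (by positivity)] at h2
  rw [h1, ← hinv, ← integral_smul]
  refine Eq.trans ?_ h2
  refine integral_congr_ae (ae_of_all _ fun ξ => ?_)
  simp only [smul_smul, ← Complex.exp_add]
  congr 2
  simp only [RCLike.inner_apply, conj_trivial]
  push_cast
  ring

/-- A quadratic inversion formula for the Laplace transform. -/
theorem exp_eq_integral (B : 𝔸) {c₀ K : ℝ} (hc₀ : 1 ≤ c₀)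
    (hu : ∀ z : ℂ, c₀ ≤ z.re → IsUnit (z • (1 : 𝔸) + B))
    (hK : ∀ z : ℂ, c₀ ≤ z.re → ‖Ring.inverse (z • (1 : 𝔸) + B)‖ ≤ K / ‖z‖)
    {c : ℝ} (hc : c₀ < c) {r : ℝ} (hr : 0 < r) :
    Integrable (fun ξ : ℝ => Complex.exp ((c + ξ * Complex.I) * r) •
        (Ring.inverse (((c : ℂ) + ξ * Complex.I) • (1 : 𝔸) + B) *
          Ring.inverse (((c : ℂ) + ξ * Complex.I) • (1 : 𝔸) + B))) ∧
    (r : ℂ) • NormedSpace.exp ((r : ℂ) • -B) = (2 * Real.pi : ℝ)⁻¹ • ∫ ξ : ℝ,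
      Complex.exp ((c + ξ * Complex.I) * r) •
        (Ring.inverse (((c : ℂ) + ξ * Complex.I) • (1 : 𝔸) + B) *
          Ring.inverse (((c : ℂ) + ξ * Complex.I) • (1 : 𝔸) + B)) := by
  set R : ℂ → 𝔸 := fun z => Ring.inverse (z • (1 : 𝔸) + B) with hR
  let f : ℂ → 𝔸 := fun z => Complex.exp (z * r) • (R z * R z)
  let f' : ℂ → 𝔸 := fun z => Complex.exp (z * r) • ((r : ℂ) • (R z * R z) -
    (R z * R z * R z + R z * R z * R z))
  have hRd : ∀ z : ℂ, c₀ < z.re → HasDerivAt R (-(R z * R z)) z := fun z hz =>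
    hasDerivAt_inverse_smul_one_add B z (hu z hz.le)
  have hRc : ContinuousOn R {z | c₀ < z.re} := fun z hz =>
    (hRd z hz).continuousAt.continuousWithinAt
  have hfd : ∀ z : ℂ, c₀ < z.re → HasDerivAt f (f' z) z := by
    intro z hz
    have h1 : HasDerivAt (fun z : ℂ => Complex.exp (z * r)) (Complex.exp (z * r) * r) z := by
      have : HasDerivAt (fun z : ℂ => z * (r : ℂ)) r z := by
        simpa using (hasDerivAt_id' z).mul_const (r : ℂ)
      exact this.cexp
    refine (h1.fun_smul ((hRd z hz).fun_mul (hRd z hz))).congr_deriv ?_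
    simp only [f', smul_sub, smul_add, smul_smul, neg_mul, mul_neg, smul_neg, ← mul_assoc]
    abel
  have hfc : ContinuousOn f {z | c₀ < z.re} := fun z hz =>
    (hfd z hz).continuousAt.continuousWithinAt
  have hfc' : ContinuousOn f' {z | c₀ < z.re} := by
    have h1 : ContinuousOn (fun z : ℂ => Complex.exp (z * r)) {z | c₀ < z.re} := by fun_prop
    exact h1.smul (((hRc.mul hRc).const_smul (r : ℂ)).sub
      (((hRc.mul hRc).mul hRc).add ((hRc.mul hRc).mul hRc)))
  have hb : ∀ c₁ : ℝ, ∃ M : ℝ, ∀ z : ℂ, c₀ < z.re → z.re ≤ c₁ →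
      ‖f z‖ ≤ M * (1 + z.im ^ 2)⁻¹ ∧ ‖f' z‖ ≤ M * (1 + z.im ^ 2)⁻¹ := by
    intro c₁
    refine ⟨Real.exp (c₁ * r) * (1 + r + 2 * |K|) * K ^ 2, fun z hz hz1 => ?_⟩
    have hz1' : 1 ≤ ‖z‖ := (hc₀.trans hz.le).trans (Complex.re_le_norm z)
    have h1 : ‖Complex.exp (z * r)‖ ≤ Real.exp (c₁ * r) := by
      rw [Complex.norm_exp, Complex.re_mul_ofReal]
      gcongr
    have h2 : ‖R z * R z‖ ≤ K ^ 2 * (1 + z.im ^ 2)⁻¹ := by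
      have h := hK z hz.le
      refine (norm_mul_le _ _).trans
        ((mul_le_mul h h (norm_nonneg _) ((norm_nonneg _).trans h)).trans ?_)
      rw [← pow_two, div_pow, div_eq_mul_inv]
      exact mul_le_mul_of_nonneg_left (inv_sq_norm_le (hc₀.trans hz.le)) (sq_nonneg K)
    have h3 : ‖R z‖ ≤ |K| := by
      refine (hK z hz.le).trans ((div_le_div_of_nonneg_right (le_abs_self K) (by positivity)).trans ?_)
      exact div_le_self (abs_nonneg K) hz1'
    have h4 : ‖R z * R z * R z‖ ≤ K ^ 2 * (1 + z.im ^ 2)⁻¹ * |K| :=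
      (norm_mul_le _ _).trans (mul_le_mul h2 h3 (norm_nonneg _) (by positivity))
    have h5 : 0 ≤ K ^ 2 * (1 + z.im ^ 2)⁻¹ := by positivity
    constructor
    · calc ‖f z‖ = ‖Complex.exp (z * r)‖ * ‖R z * R z‖ := norm_smul _ _
        _ ≤ Real.exp (c₁ * r) * (K ^ 2 * (1 + z.im ^ 2)⁻¹) := by gcongr
        _ ≤ Real.exp (c₁ * r) * ((1 + r + 2 * |K|) * (K ^ 2 * (1 + z.im ^ 2)⁻¹)) :=
            mul_le_mul_of_nonneg_left
              (le_mul_of_one_le_left h5 (by linarith [abs_nonneg K])) (Real.exp_pos _).le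
        _ = _ := by ring
    · have h6 : ‖(r : ℂ) • (R z * R z) - (R z * R z * R z + R z * R z * R z)‖ ≤
          (r + 2 * |K|) * (K ^ 2 * (1 + z.im ^ 2)⁻¹) := by
        refine (norm_sub_le _ _).trans ?_
        have h7 := norm_add_le (R z * R z * R z) (R z * R z * R z)
        rw [norm_smul, Complex.norm_real, Real.norm_of_nonneg hr.le]
        have h8 : r * ‖R z * R z‖ ≤ r * (K ^ 2 * (1 + z.im ^ 2)⁻¹) := by gcongr
        linarith
      calc ‖f' z‖ = _ := norm_smul _ _
        _ ≤ Real.exp (c₁ * r) * ((r + 2 * |K|) * (K ^ 2 * (1 + z.im ^ 2)⁻¹)) := by gcongr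
        _ ≤ Real.exp (c₁ * r) * ((1 + r + 2 * |K|) * (K ^ 2 * (1 + z.im ^ 2)⁻¹)) := by
            gcongr
            linarith
        _ = _ := by ring
  constructor
  · obtain ⟨M, hM⟩ := hb c
    have h1 : Continuous fun ξ : ℝ => (c : ℂ) + ξ * Complex.I := by fun_prop
    refine (integrable_inv_one_add_sq.const_mul M).mono' (f := fun ξ : ℝ => f (c + ξ * Complex.I))
      (hfc.comp_continuous h1 fun ξ => by simpa using hc).aestronglyMeasurable
      (ae_of_all _ fun ξ => ?_)
    simpa using (hM (c + ξ * Complex.I) (by simpa using hc) (by simp)).1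
  -- On a line to the right of ‖B‖ the formula is already known; the integral is then moved back to
  -- c. This removes the dependence of the line on ‖B‖, which is essential since B will be a symbol
  -- value, unbounded in k.
  · obtain ⟨d, hd⟩ : ∃ d, d = max c (‖B‖ + 1) := ⟨_, rfl⟩
    have hcd : c ≤ d := hd ▸ le_max_left _ _
    have hBd : ‖B‖ < d := by
      have := le_max_right c (‖B‖ + 1)
      linarith
    rw [exp_eq_integral_of_norm_lt B (c := d) (K := K) (by linarith) hBd
      (fun z hz => hu z (by linarith)) (fun z hz => hK z (by linarith)) hr]
    congr 1
    exact integral_vertical_eq hfd hfc' hb (hc.trans_le hcd) hc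

end ExponentialFormula

/-! ### Exponential multipliers on a sector. -/

section BlockCalculus

variable {n : ℕ} {E : Type*} [NormedAddCommGroup E] [NormedSpace ℂ E]
  {φ : ResolutionOfUnity n} {p : ℝ≥0∞} [Fact (1 ≤ p)]

variable (φ p) in
/-- One term of a block, as a function of the value of the symbol. -/
def blockTerm (j : ℕ) (k : Fin n → ℤ) (x : E) : (E →L[ℂ] E) →L[ℂ] Lp E p (torusMeasure n) :=
  (mono p k : E →L[ℂ] Lp E p (torusMeasure n)) ∘L
    (φ.fn j (latticePt k) • ContinuousLinearMap.apply ℂ E x)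

theorem blockTerm_apply (j : ℕ) (k : Fin n → ℤ) (x : E) (N : E →L[ℂ] E) :
    blockTerm φ p j k x N = mono p k (φ.fn j (latticePt k) • N x) := rfl

/-- For each finite set of frequencies the integral passes through the sum and the norm through the
integral. Integrability is therefore needed only for each k separately, and uniformity in k enters
through the block bounds. -/
theorem IsBlockMultiplier.integral [CompleteSpace E] {N : ℝ → (Fin n → ℤ) → E →L[ℂ] E} {b : ℝ → ℝ}
    (hN : ∀ k, Integrable fun ξ => N ξ k) (hb : Integrable b)
    (h : ∀ ξ, IsBlockMultiplier φ p (N ξ) fun _ => b ξ) :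
    IsBlockMultiplier φ p (fun k => ∫ ξ, N ξ k) fun _ => ∫ ξ, b ξ := by
  intro j S x
  have e : ∑ k ∈ S, mono p k (φ.fn j (latticePt k) • (∫ ξ, N ξ k) (x k)) =
      ∫ ξ, ∑ k ∈ S, mono p k (φ.fn j (latticePt k) • N ξ k (x k)) := by
    have h1 : ∀ k, Integrable fun ξ => blockTerm φ p j k (x k) (N ξ k) := fun k =>
      (blockTerm φ p j k (x k)).integrable_comp (hN k)
    simp only [← blockTerm_apply]
    rw [integral_finsetSum _ fun k _ => h1 k]
    exact Finset.sum_congr rfl fun k _ => ((blockTerm φ p j k (x k)).integral_comp_comm (hN k)).symm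
  rw [e, ← integral_mul_const]
  exact norm_integral_le_of_norm_le (hb.mul_const _) (ae_of_all _ fun ξ => h ξ j S x)

/-- Two Cauchy estimates, with radii ρ/2 and ρ/4, bound the second derivative near w by 8M/ρ². The
mean value inequality, applied to f' and then to f(z) - z f'(w), gives the remainder. -/
theorem norm_taylor_remainder_le {F : Type*} [NormedAddCommGroup F] [NormedSpace ℂ F]
    [CompleteSpace F] {f : ℂ → F}
    (hf : Differentiable ℂ f) {w : ℂ} {ρ M : ℝ} (hρ : 0 < ρ)
    (hM : ∀ z ∈ Metric.closedBall w ρ, ‖f z‖ ≤ M) :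
    ‖deriv f w‖ ≤ M / ρ ∧
      ∀ h : ℂ, ‖h‖ ≤ ρ / 4 → ‖f (w + h) - f w - h • deriv f w‖ ≤ 8 * M / ρ ^ 2 * ‖h‖ ^ 2 := by
  have hcauchy : ∀ (g : ℂ → F) (_ : Differentiable ℂ g) (C r r' : ℝ), 0 < r' →
      (∀ z ∈ Metric.closedBall w (r + r'), ‖g z‖ ≤ C) →
      ∀ z ∈ Metric.closedBall w r, ‖deriv g z‖ ≤ C / r' := by
    intro g hg C r r' hr' hC z hz
    refine Complex.norm_deriv_le_of_forall_mem_sphere_norm_le hr' hg.diffContOnCl fun y hy => hC y ?_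
    rw [Metric.mem_closedBall] at hz ⊢
    rw [Metric.mem_sphere] at hy
    linarith [dist_triangle y z w]
  have hf' : Differentiable ℂ (deriv f) := hf.deriv
  refine ⟨hcauchy f hf M 0 ρ hρ (by simpa using hM) w (by simp), fun h hh => ?_⟩
  have h1 := hcauchy f hf M (ρ / 2) (ρ / 2) (by positivity) (by rwa [add_halves])
  have h2 := hcauchy (deriv f) hf' _ (ρ / 4) (ρ / 4) (by positivity)
    (by rw [show ρ / 4 + ρ / 4 = ρ / 2 by ring]; exact h1)
  have hw : w ∈ Metric.closedBall w ‖h‖ := Metric.mem_closedBall_self (norm_nonneg h)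
  have hwh : w + h ∈ Metric.closedBall w ‖h‖ := by simp
  have hsub : Metric.closedBall w ‖h‖ ⊆ Metric.closedBall w (ρ / 4) :=
    Metric.closedBall_subset_closedBall hh
  set C := M / (ρ / 2) / (ρ / 4)
  have hC0 : 0 ≤ C := (norm_nonneg _).trans (h2 w (hsub hw))
  have h3 : ∀ z ∈ Metric.closedBall w ‖h‖, ‖deriv f z - deriv f w‖ ≤ C * ‖h‖ := by
    intro z hz
    refine ((convex_closedBall w ‖h‖).norm_image_sub_le_of_norm_deriv_le
      (fun y _ => hf' y) (fun y hy => h2 y (hsub hy)) hw hz).trans ?_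
    gcongr
    rwa [mem_closedBall_iff_norm] at hz
  have hg : ∀ z, HasDerivAt (fun z => f z - z • deriv f w) (deriv f z - deriv f w) z := fun z => by
    simpa using (hf z).hasDerivAt.fun_sub ((hasDerivAt_id' z).smul_const (deriv f w))
  have h4 := (convex_closedBall w ‖h‖).norm_image_sub_le_of_norm_hasDerivWithin_le
    (fun z _ => (hg z).hasDerivWithinAt) h3 hw hwh
  calc ‖f (w + h) - f w - h • deriv f w‖
      = ‖f (w + h) - (w + h) • deriv f w - (f w - w • deriv f w)‖ := by
        congr 1
        module
    _ ≤ C * ‖h‖ * ‖w + h - w‖ := h4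
    _ = 8 * M / ρ ^ 2 * ‖h‖ ^ 2 := by
        rw [add_sub_cancel_left]
        simp only [C]
        field_simp
        ring

/-- The symbol `exp(-z ∑_{|α| ≤ m} a_α k^α)`. -/
def expSymbol (m : ℕ) (a : (Fin n → ℕ) → E →L[ℂ] E) (z : ℂ) (k : Fin n → ℤ) : E →L[ℂ] E :=
  NormedSpace.exp (z • -fullSymbol m a (latticePt k))

theorem expSymbol_zero (m : ℕ) (a : (Fin n → ℕ) → E →L[ℂ] E) (k : Fin n → ℤ) :
    expSymbol m a 0 k = 1 := by
  rw [expSymbol, zero_smul, NormedSpace.exp_zero]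

theorem expSymbol_add [CompleteSpace E] (m : ℕ) (a : (Fin n → ℕ) → E →L[ℂ] E) (z w : ℂ)
    (k : Fin n → ℤ) : expSymbol m a (z + w) k = expSymbol m a z k * expSymbol m a w k := by
  let _ : NormedAlgebra ℚ (E →L[ℂ] E) := NormedAlgebra.restrictScalars ℚ ℂ _
  rw [expSymbol, add_smul]
  exact NormedSpace.exp_add_of_commute (((Commute.refl _).smul_left z).smul_right w)

theorem hasDerivAt_expSymbol [CompleteSpace E] (m : ℕ) (a : (Fin n → ℕ) → E →L[ℂ] E) (z : ℂ)
    (k : Fin n → ℤ) : HasDerivAt (fun z => expSymbol m a z k)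
      (expSymbol m a z k * -fullSymbol m a (latticePt k)) z :=
  hasDerivAt_exp_smul_const (𝕂 := ℂ) (-fullSymbol m a (latticePt k) : E →L[ℂ] E) z

/-- Cauchy estimates for the exponential multipliers. -/
theorem IsBlockMultiplier.expSymbol_taylor [CompleteSpace E] {m : ℕ} {a : (Fin n → ℕ) → E →L[ℂ] E}
    {w : ℂ} {ρ M : ℝ} (hρ : 0 < ρ)
    (hM : ∀ z ∈ Metric.closedBall w ρ, IsBlockMultiplier φ p (expSymbol m a z) fun _ => M) :
    IsBlockMultiplier φ p (fun k => expSymbol m a w k * -fullSymbol m a (latticePt k))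
        (fun _ => M / ρ) ∧
      ∀ h : ℂ, ‖h‖ ≤ ρ / 4 → IsBlockMultiplier φ p (fun k => expSymbol m a (w + h) k -
        expSymbol m a w k - h • (expSymbol m a w k * -fullSymbol m a (latticePt k)))
        (fun _ => 8 * M / ρ ^ 2 * ‖h‖ ^ 2) := by
  -- For fixed j, S and x the block is an entire function of z with values in L^p. Cauchy estimates
  -- there have constants proportional to the norm of the polynomial, so they are again block
  -- bounds.
  have key : ∀ (j : ℕ) (S : Finset (Fin n → ℤ)) (x : (Fin n → ℤ) → E),
      (∀ z, HasDerivAt (fun z => ∑ k ∈ S, blockTerm φ p j k (x k) (expSymbol m a z k))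
        (∑ k ∈ S, blockTerm φ p j k (x k)
          (expSymbol m a z k * -fullSymbol m a (latticePt k))) z) ∧
      ∀ z ∈ Metric.closedBall w ρ,
        ‖∑ k ∈ S, blockTerm φ p j k (x k) (expSymbol m a z k)‖ ≤
          M * ‖∑ k ∈ S, mono p k (x k)‖ := fun j S x =>
    ⟨fun z => HasDerivAt.fun_sum fun k _ =>
      (blockTerm φ p j k (x k)).hasFDerivAt.comp_hasDerivAt z (hasDerivAt_expSymbol m a z k),
      fun z hz => hM z hz j S x⟩
  constructor
  · intro j S x
    obtain ⟨h1, h2⟩ := key j S x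
    have h3 := (norm_taylor_remainder_le (fun z => (h1 z).differentiableAt) hρ h2).1
    rw [(h1 w).deriv] at h3
    refine h3.trans (le_of_eq ?_)
    ring
  · intro h hh j S x
    obtain ⟨h1, h2⟩ := key j S x
    have h3 := (norm_taylor_remainder_le (fun z => (h1 z).differentiableAt) hρ h2).2 h hh
    rw [(h1 w).deriv, Finset.smul_sum, ← Finset.sum_sub_distrib, ← Finset.sum_sub_distrib] at h3
    simp only [← map_smul, ← map_sub] at h3
    refine h3.trans (le_of_eq ?_)
    ring

theorem integral_inv_sq_add_sq {c : ℝ} (hc : 0 < c) :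
    Integrable (fun ξ : ℝ => (c ^ 2 + ξ ^ 2)⁻¹) ∧ ∫ ξ : ℝ, (c ^ 2 + ξ ^ 2)⁻¹ = Real.pi / c := by
  have e : (fun ξ : ℝ => (c ^ 2 + ξ ^ 2)⁻¹) = fun ξ => (c ^ 2)⁻¹ * (1 + (c⁻¹ * ξ) ^ 2)⁻¹ := by
    funext ξ
    rw [← mul_inv, mul_pow, inv_pow, mul_add, mul_one, mul_inv_cancel_left₀ (by positivity)]
  rw [e]
  constructor
  · exact (integrable_inv_one_add_sq.comp_mul_left' (inv_ne_zero hc.ne')).const_mul _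
  · rw [integral_const_mul, Measure.integral_comp_mul_left (fun x : ℝ => (1 + x ^ 2)⁻¹),
      integral_univ_inv_one_add_sq, inv_inv, abs_of_pos hc, smul_eq_mul]
    field_simp

/-- Dividing a point of the right half-plane by a unit vector of the sector `Σ_δ` gives a point of the
sector `Σ_{π/2 + δ}`. -/
theorem mul_inv_mem_sector {δ : ℝ} (hδ0 : 0 ≤ δ) (hδ : δ ≤ Real.pi / 2) {u z : ℂ}
    (hu : ‖u‖ = 1) (hur : 0 ≤ u.re) (hui : |u.im| ≤ Real.sin δ) (hz : 0 ≤ z.re) :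
    z * u⁻¹ ∈ sector (Real.pi / 2 + δ) := by
  have hpi := Real.pi_pos
  have hu' : u⁻¹ = (starRingEnd ℂ) u := by
    rw [Complex.inv_def, Complex.normSq_eq_norm_sq, hu]
    simp
  rw [mem_sector_iff (by linarith) (by linarith), add_comm, Real.cos_add_pi_div_two, hu', norm_mul,
    RCLike.norm_conj, hu, mul_one]
  simp only [Complex.mul_re, Complex.conj_re, Complex.conj_im, mul_neg, sub_neg_eq_add]
  have h1 : |z.im * u.im| ≤ ‖z‖ * Real.sin δ := by
    rw [abs_mul]
    exact mul_le_mul (Complex.abs_im_le_norm z) hui (abs_nonneg _) (norm_nonneg z)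
  have h2 := neg_abs_le (z.im * u.im)
  have h3 : 0 ≤ z.re * u.re := mul_nonneg hz hur
  linarith

/-- The exponential multipliers on a sector. -/
theorem exists_isBlockMultiplier_expSymbol (φ : ResolutionOfUnity n) [CompleteSpace E] {m : ℕ}
    (hm : 1 ≤ m) (a : (Fin n → ℕ) → E →L[ℂ] E) {κ δ : ℝ} (hκ : 1 ≤ κ) (hδ0 : 0 ≤ δ)
    (hδ : δ ≤ Real.pi / 2) (hell : SymbolElliptic m a κ (Real.pi / 2 + δ)) :
    ∃ ω M : ℝ, 0 ≤ M ∧ ∀ z : ℂ, z ≠ 0 → 0 ≤ z.re → |z.im| ≤ Real.sin δ * ‖z‖ →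
      IsBlockMultiplier φ p (expSymbol m a z) fun _ => M * Real.exp (ω * ‖z‖) := by
  have hpi := Real.pi_pos
  obtain ⟨ω, hω, K, hK, hres⟩ := exists_isBlockMultiplier_resSymbol φ E m hm (coeffNorm m a) κ
    (Real.pi / 2 + δ) (coeffNorm_nonneg m a) hκ (by linarith) (by linarith)
  refine ⟨ω, 5 * K ^ 2 * Real.exp 1 / 2, by positivity, fun ζ hζ0 hζre hζim => ?_⟩
  obtain ⟨r, hr⟩ : ∃ r, r = ‖ζ‖ := ⟨_, rfl⟩
  have hr0 : 0 < r := hr ▸ norm_pos_iff.2 hζ0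
  have hrc : (r : ℂ) ≠ 0 := by exact_mod_cast hr0.ne'
  -- Complex time ζ = r u is reduced to real time r for the rotated symbol u a(k). Its resolvent at
  -- z is u⁻¹ times that of a(k) at z/u, a point of the larger sector.
  obtain ⟨u, hu⟩ : ∃ u : ℂ, u = (r⁻¹ : ℝ) * ζ := ⟨_, rfl⟩
  have huζ : (r : ℂ) * u = ζ := by
    rw [hu, Complex.ofReal_inv, mul_inv_cancel_left₀ hrc]
  have hun : ‖u‖ = 1 := by
    rw [hu, norm_mul, Complex.norm_real, Real.norm_of_nonneg (by positivity), ← hr,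
      inv_mul_cancel₀ hr0.ne']
  have hu0 : u ≠ 0 := norm_pos_iff.1 (by rw [hun]; exact one_pos)
  have hure : 0 ≤ u.re := by
    rw [hu, Complex.re_ofReal_mul]
    positivity
  have huim : |u.im| ≤ Real.sin δ := by
    rw [hu, Complex.im_ofReal_mul, abs_mul, abs_of_pos (inv_pos.2 hr0), inv_mul_le_iff₀ hr0, hr,
      mul_comm]
    exact hζim
  have hmem : ∀ z : ℂ, ω ≤ z.re → z * u⁻¹ ∈ sector (Real.pi / 2 + δ) ∧ ω ≤ ‖z * u⁻¹‖ := by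
    intro z hz
    refine ⟨mul_inv_mem_sector hδ0 hδ hun hure huim (by linarith), ?_⟩
    rw [norm_mul, norm_inv, hun, inv_one, mul_one]
    exact hz.trans (Complex.re_le_norm z)
  have hnorm : ∀ z : ℂ, ‖z * u⁻¹‖ = ‖z‖ := fun z => by
    rw [norm_mul, norm_inv, hun, inv_one, mul_one]
  have hinv : ∀ (z : ℂ), ω ≤ z.re → ∀ k,
      IsUnit (z • (1 : E →L[ℂ] E) + u • fullSymbol m a (latticePt k)) ∧
      Ring.inverse (z • (1 : E →L[ℂ] E) + u • fullSymbol m a (latticePt k)) =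
        u⁻¹ • resSymbol m a (z * u⁻¹) k := by
    intro z hz k
    have h1 := (hres p a le_rfl hell _ (hmem z hz).1 (hmem z hz).2).1 k
    have e : z • (1 : E →L[ℂ] E) + u • fullSymbol m a (latticePt k) =
        u • ((z * u⁻¹) • (1 : E →L[ℂ] E) + fullSymbol m a (latticePt k)) := by
      rw [smul_add, smul_smul, mul_comm z, mul_inv_cancel_left₀ hu0]
    rw [e]
    exact ring_inverse_smul u hu0 _ h1
  -- This line balances exp(cr) = e · exp(ωr) against ∫ (c² + ξ²)⁻¹ = π/c. Together with the
  -- prefactor 1/(2πr) and rc ≥ 1, the bound stays finite as r → 0 and has the constant 5K²e/2.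
  obtain ⟨c, hc⟩ : ∃ c, c = ω + 1 / r := ⟨_, rfl⟩
  have hωc : ω < c := by
    rw [hc]
    have : 0 < 1 / r := by positivity
    linarith
  have hc0 : 0 < c := by linarith
  have hform := fun k => exp_eq_integral (u • fullSymbol m a (latticePt k)) (c₀ := ω) (K := K) hω
    (fun z hz => (hinv z hz k).1) (fun z hz => by
      rw [(hinv z hz k).2, norm_smul, norm_inv, hun, inv_one, one_mul, ← hnorm z]
      exact (hres p a le_rfl hell _ (hmem z hz).1 (hmem z hz).2).2.1 k) hωc hr0
  have hre : ∀ ξ : ℝ, ω ≤ ((c : ℂ) + ξ * Complex.I).re := fun ξ => by simpa using hωc.le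
  have hsq : ∀ ξ : ℝ, ‖(c : ℂ) + ξ * Complex.I‖ ^ 2 = c ^ 2 + ξ ^ 2 := fun ξ => by
    rw [Complex.sq_norm, Complex.normSq_apply]
    simp
    ring
  have hblock : ∀ ξ : ℝ, IsBlockMultiplier φ p (fun k => Complex.exp ((c + ξ * Complex.I) * r) •
      (Ring.inverse (((c : ℂ) + ξ * Complex.I) • (1 : E →L[ℂ] E) +
          u • fullSymbol m a (latticePt k)) *
        Ring.inverse (((c : ℂ) + ξ * Complex.I) • (1 : E →L[ℂ] E) +
          u • fullSymbol m a (latticePt k))))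
      (fun _ => Real.exp (c * r) * (5 * K ^ 2) * (c ^ 2 + ξ ^ 2)⁻¹) := by
    intro ξ
    set z : ℂ := (c : ℂ) + ξ * Complex.I with hz
    have hzn : 0 < ‖z‖ := (hc0.trans_le (by simp [hz])).trans_le (Complex.re_le_norm z)
    have h1 := ((hres p a le_rfl hell _ (hmem z (hre ξ)).1 (hmem z (hre ξ)).2).2.2.mono_bound
      (c := fun _ => K / ‖z‖) fun j => by
        rw [hnorm]
        have : (0 : ℝ) ≤ ((2 : ℝ) ^ j) ^ m := by positivity
        gcongr
        linarith).smul u⁻¹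
    have h2 := (IsBlockMultiplier.mul (by positivity) (fun j => by positivity) h1 h1).smul
      (Complex.exp (z * r))
    have h3 : (fun k => Complex.exp (z * r) •
        (Ring.inverse (z • (1 : E →L[ℂ] E) + u • fullSymbol m a (latticePt k)) *
          Ring.inverse (z • (1 : E →L[ℂ] E) + u • fullSymbol m a (latticePt k)))) =
        fun k => Complex.exp (z * r) • (u⁻¹ • resSymbol m a (z * u⁻¹) k *
          u⁻¹ • resSymbol m a (z * u⁻¹) k) := by
      funext k
      rw [(hinv z (hre ξ) k).2]
    rw [h3]
    refine h2.mono_bound fun j => le_of_eq ?_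
    have h4 : ‖Complex.exp (z * r)‖ = Real.exp (c * r) := by
      rw [Complex.norm_exp, Complex.re_mul_ofReal, hz]
      simp
    rw [h4, norm_inv, hun, inv_one, one_mul, ← hsq ξ, ← hz]
    field_simp
  obtain ⟨hI1, hI2⟩ := integral_inv_sq_add_sq hc0
  have h5 := (IsBlockMultiplier.integral (fun k => (hform k).1) (hI1.const_mul _) hblock).smul
    ((r : ℂ)⁻¹ * ((2 * Real.pi : ℝ)⁻¹ : ℝ))
  have h6 : expSymbol m a ζ = fun k => ((r : ℂ)⁻¹ * ((2 * Real.pi : ℝ)⁻¹ : ℝ)) • ∫ ξ : ℝ,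
      Complex.exp ((c + ξ * Complex.I) * r) •
      (Ring.inverse (((c : ℂ) + ξ * Complex.I) • (1 : E →L[ℂ] E) +
          u • fullSymbol m a (latticePt k)) *
        Ring.inverse (((c : ℂ) + ξ * Complex.I) • (1 : E →L[ℂ] E) +
          u • fullSymbol m a (latticePt k))) := by
    funext k
    have h7 := (hform k).2
    rw [mul_smul, Complex.coe_smul, ← h7, smul_smul, inv_mul_cancel₀ hrc, one_smul, expSymbol,
      ← huζ, mul_smul, smul_neg, smul_neg]
  rw [h6]
  refine h5.mono_bound fun j => ?_
  rw [integral_const_mul, hI2, norm_mul, norm_inv, Complex.norm_real, Complex.norm_real,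
    Real.norm_of_nonneg hr0.le, Real.norm_of_nonneg (by positivity), ← hr]
  have h8 : Real.exp (c * r) = Real.exp 1 * Real.exp (ω * r) := by
    rw [← Real.exp_add, hc]
    congr 1
    field_simp
    ring
  have h9 : r⁻¹ / c ≤ 1 := by
    rw [div_le_one hc0, hc, one_div]
    linarith
  rw [h8]
  calc r⁻¹ * (2 * Real.pi)⁻¹ * (Real.exp 1 * Real.exp (ω * r) * (5 * K ^ 2) * (Real.pi / c))
      = 5 * K ^ 2 * Real.exp 1 / 2 * Real.exp (ω * r) * (r⁻¹ / c) := by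
        field_simp
    _ ≤ 5 * K ^ 2 * Real.exp 1 / 2 * Real.exp (ω * r) * 1 := by gcongr
    _ = _ := mul_one _

end BlockCalculus

/-! ### Differentiability from a quadratic remainder. -/

section QuadraticRemainder

theorem hasFDerivAt_of_quadratic_remainder {F : Type*} [SeminormedAddCommGroup F] [NormedSpace ℂ F]
    {f : ℂ → F} {w : ℂ} {d : F} {ε C : ℝ} (hε : 0 < ε)
    (h : ∀ h : ℂ, ‖h‖ ≤ ε → ‖f (w + h) - f w - h • d‖ ≤ C * ‖h‖ ^ 2) :
    HasFDerivAt f (ContinuousLinearMap.toSpanSingleton ℂ d) w := by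
  refine HasFDerivAt.of_isLittleO ?_
  have h1 : (fun z : ℂ => f z - f w - ContinuousLinearMap.toSpanSingleton ℂ d (z - w)) =O[𝓝 w]
      fun z => ‖z - w‖ ^ 2 := by
    refine Asymptotics.IsBigO.of_bound C ?_
    filter_upwards [Metric.closedBall_mem_nhds w hε] with z hz
    have h2 := h (z - w) (by rwa [mem_closedBall_iff_norm] at hz)
    rw [add_sub_cancel] at h2
    rw [norm_pow, norm_norm]
    exact h2
  refine h1.trans_isLittleO ?_
  have h3 : Tendsto (fun z : ℂ => ‖z - w‖) (𝓝 w) (𝓝 0) := by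
    have : Continuous fun z : ℂ => ‖z - w‖ := by fun_prop
    simpa using this.tendsto w
  have h4 : (fun z : ℂ => ‖z - w‖ ^ 2) =o[𝓝 w] fun z => ‖z - w‖ := by
    simp only [pow_two]
    simpa using ((Asymptotics.isLittleO_one_iff ℝ).2 h3).mul_isBigO
      (Asymptotics.isBigO_refl (fun z : ℂ => ‖z - w‖) (𝓝 w))
  exact h4.of_norm_right

end QuadraticRemainder

/-! ### The semigroup as operators on the Besov space. -/

section Semigroup

variable {n : ℕ} {E : Type*} [NormedAddCommGroup E] [NormedSpace ℂ E]

open Classical in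
/-- The Fourier multiplier with symbol `exp(-z ∑_{|α| ≤ m} a_α k^α)`, where it exists. -/
def expOp (φ : ResolutionOfUnity n) (s : ℝ) (p q : ℝ≥0∞) [Fact (1 ≤ p)] [Fact (1 ≤ q)] (m : ℕ)
    (a : (Fin n → ℕ) → E →L[ℂ] E) (z : ℂ) : Besov E φ s p q →L[ℂ] Besov E φ s p q :=
  if h : ∃ R : Besov E φ s p q →L[ℂ] Besov E φ s p q,
    ∀ x k, fourierCoef k (R x).1 = expSymbol m a z k (fourierCoef k x.1) then h.choose else 0

variable {φ : ResolutionOfUnity n} {s : ℝ} {p q : ℝ≥0∞} [Fact (1 ≤ p)] [Fact (1 ≤ q)] {m : ℕ}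
  {a : (Fin n → ℕ) → E →L[ℂ] E}

theorem expOp_spec {z : ℂ} (h : ∃ R : Besov E φ s p q →L[ℂ] Besov E φ s p q,
    ∀ x k, fourierCoef k (R x).1 = expSymbol m a z k (fourierCoef k x.1)) (x : Besov E φ s p q)
    (k : Fin n → ℤ) :
    fourierCoef k (expOp φ s p q m a z x).1 = expSymbol m a z k (fourierCoef k x.1) := by
  rw [expOp, dif_pos h]
  exact h.choose_spec x k

theorem expOp_zero (x : Besov E φ s p q) : expOp φ s p q m a 0 x = x := by
  refine Besov.ext_coef fun k => ?_
  rw [expOp_spec ⟨ContinuousLinearMap.id ℂ _, fun x k => ?_⟩, expSymbol_zero]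
  · rfl
  · rw [expSymbol_zero]
    rfl

variable [CompleteSpace E]

theorem fourierCoef_expOp {z : ℂ} {M : ℝ} (hM : 0 ≤ M)
    (h : IsBlockMultiplier φ p (expSymbol m a z) fun _ => M) (x : Besov E φ s p q)
    (k : Fin n → ℤ) :
    fourierCoef k (expOp φ s p q m a z x).1 = expSymbol m a z k (fourierCoef k x.1) :=
  expOp_spec (h.exists_clm s q hM) x k

theorem norm_expOp_le {z : ℂ} {M : ℝ} (hM : 0 ≤ M)
    (h : IsBlockMultiplier φ p (expSymbol m a z) fun _ => M) :
    ‖expOp φ s p q m a z‖ ≤ 25 * 2 ^ (2 * |s|) * M :=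
  h.opNorm_le hM (fourierCoef_expOp hM h)

/-- No bound at z + w is needed: the composition itself realizes the symbol at z + w, which places
`expOp` at z + w in the nontrivial case of its definition. -/
theorem expOp_add {z w : ℂ} {M N : ℝ} (hM : 0 ≤ M) (hN : 0 ≤ N)
    (hz : IsBlockMultiplier φ p (expSymbol m a z) fun _ => M)
    (hw : IsBlockMultiplier φ p (expSymbol m a w) fun _ => N) :
    expOp φ s p q m a (z + w) = expOp φ s p q m a z ∘L expOp φ s p q m a w := by
  have h1 : ∀ (x : Besov E φ s p q) (k : Fin n → ℤ),
      fourierCoef k ((expOp φ s p q m a z ∘L expOp φ s p q m a w) x).1 =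
        expSymbol m a (z + w) k (fourierCoef k x.1) := by
    intro x k
    rw [ContinuousLinearMap.comp_apply, fourierCoef_expOp hM hz, fourierCoef_expOp hN hw,
      expSymbol_add]
    rfl
  refine ContinuousLinearMap.ext fun x => ?_
  exact (Besov.ext_coef fun k => (expOp_spec ⟨_, h1⟩ x k).trans (h1 x k).symm)

/-- The exponential operators are complex differentiable, with a quadratic remainder in the
operator norm. -/
theorem exists_expOp_remainder_le {w : ℂ} {ρ M : ℝ} (hρ : 0 < ρ) (hM0 : 0 ≤ M)
    (hM : ∀ z ∈ Metric.closedBall w ρ, IsBlockMultiplier φ p (expSymbol m a z) fun _ => M) :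
    ∃ D : Besov E φ s p q →L[ℂ] Besov E φ s p q,
      (∀ x k, fourierCoef k (D x).1 =
        (expSymbol m a w k * -fullSymbol m a (latticePt k)) (fourierCoef k x.1)) ∧
      ∃ C, ∀ h : ℂ, ‖h‖ ≤ ρ / 4 →
        ‖expOp φ s p q m a (w + h) - expOp φ s p q m a w - h • D‖ ≤ C * ‖h‖ ^ 2 := by
  obtain ⟨h1, h2⟩ := IsBlockMultiplier.expSymbol_taylor hρ hM
  obtain ⟨D, hD⟩ := h1.exists_clm s q (by positivity)
  refine ⟨D, hD, 25 * 2 ^ (2 * |s|) * (8 * M / ρ ^ 2), fun h hh => ?_⟩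
  have h3 : w + h ∈ Metric.closedBall w ρ := by
    rw [mem_closedBall_iff_norm, add_sub_cancel_left]
    linarith
  refine ((h2 h hh).opNorm_le (by positivity) fun x k => ?_).trans (le_of_eq (by ring))
  change fourierCoef k ((expOp φ s p q m a (w + h) x).1 - (expOp φ s p q m a w x).1 -
    h • (D x).1) = _
  rw [map_sub, map_sub, map_smul, fourierCoef_expOp hM0 (hM _ h3),
    fourierCoef_expOp hM0 (hM _ (Metric.mem_closedBall_self hρ.le)), hD]
  rfl

theorem differentiableAt_expOp {w : ℂ} {ρ M : ℝ} (hρ : 0 < ρ) (hM0 : 0 ≤ M)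
    (hM : ∀ z ∈ Metric.closedBall w ρ, IsBlockMultiplier φ p (expSymbol m a z) fun _ => M) :
    DifferentiableAt ℂ (expOp φ s p q m a) w := by
  obtain ⟨D, -, C, hC⟩ := exists_expOp_remainder_le (s := s) (q := q) hρ hM0 hM
  exact (hasFDerivAt_of_quadratic_remainder (by positivity) hC).differentiableAt

/-- The weak derivative comes with its symbol, so that it can be compared with other multipliers by
Fourier coefficients when the Laplace transform is computed. -/
theorem exists_hasDerivAt_apply_expOp {w : ℂ} {ρ M : ℝ} (hρ : 0 < ρ) (hM0 : 0 ≤ M)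
    (hM : ∀ z ∈ Metric.closedBall w ρ, IsBlockMultiplier φ p (expSymbol m a z) fun _ => M) :
    ∃ D : Besov E φ s p q →L[ℂ] Besov E φ s p q,
      (∀ x k, fourierCoef k (D x).1 =
        (expSymbol m a w k * -fullSymbol m a (latticePt k)) (fourierCoef k x.1)) ∧
      ∀ (l : StrongDual ℂ (Besov E φ s p q)) (x : Besov E φ s p q),
        HasDerivAt (fun z => l (expOp φ s p q m a z x)) (l (D x)) w := by
  obtain ⟨D, hD, C, hC⟩ := exists_expOp_remainder_le (s := s) (q := q) hρ hM0 hM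
  refine ⟨D, hD, fun l x => ?_⟩
  have h1 := (hasFDerivAt_of_quadratic_remainder (f := fun z => l (expOp φ s p q m a z x)) (w := w)
    (d := l (D x)) (ε := ρ / 4) (C := ‖l‖ * (C * ‖x‖)) (by positivity) fun h hh => ?_).hasDerivAt
  · exact h1.congr_deriv (by simp)
  · have e : l (expOp φ s p q m a (w + h) x) - l (expOp φ s p q m a w x) - h • l (D x) =
        l ((expOp φ s p q m a (w + h) - expOp φ s p q m a w - h • D) x) := by
      simp only [sub_apply, smul_apply, map_sub, map_smul]
    rw [e]
    calc _ ≤ ‖l‖ * (C * ‖h‖ ^ 2 * ‖x‖) :=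
          (l.le_opNorm _).trans (mul_le_mul_of_nonneg_left
            (ContinuousLinearMap.le_of_opNorm_le _ (hC h hh) x) (norm_nonneg l))
      _ = _ := by ring

end Semigroup

/-! ### Open sectors in terms of real and imaginary parts. -/

section SectorGeometry

theorem openSector_re_im {δ : ℝ} (hδ : δ ≤ Real.pi / 2) {z : ℂ} (hz : z ∈ openSector δ) :
    0 < z.re ∧ |z.im| < Real.sin δ * ‖z‖ := by
  obtain ⟨hz0, harg⟩ := hz
  have hn : 0 < ‖z‖ := norm_pos_iff.2 hz0
  constructor
  · rcases Complex.abs_arg_lt_pi_div_two_iff.1 (harg.trans_le hδ) with h | h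
    · exact h
    · exact absurd h hz0
  · have h1 : |z.im| = Real.sin |z.arg| * ‖z‖ := by
      rw [← Real.abs_sin_eq_sin_abs_of_abs_le_pi (Complex.abs_arg_le_pi z), Complex.sin_arg, abs_div,
        abs_of_pos hn, div_mul_cancel₀ _ hn.ne']
    rw [h1]
    exact mul_lt_mul_of_pos_right (Real.sin_lt_sin_of_lt_of_le_pi_div_two
      (by linarith [abs_nonneg z.arg, Real.pi_pos]) hδ harg) hn

theorem ofReal_mem_openSector {δ r : ℝ} (hδ : 0 < δ) (hr : 0 < r) : (r : ℂ) ∈ openSector δ := by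
  refine ⟨by exact_mod_cast hr.ne', ?_⟩
  rw [Complex.arg_ofReal_of_nonneg hr.le, abs_zero]
  exact hδ

end SectorGeometry

theorem norm_sub_le_of_hasDerivAt_unitInterval {F : Type*} [NormedAddCommGroup F] [NormedSpace ℂ F]
    {f f' : ℂ → F} {C : ℝ} (hf : ∀ z, HasDerivAt f (f' z) z)
    (hC : ∀ t : ℝ, 0 ≤ t → t ≤ 1 → ‖f' t‖ ≤ C) {r : ℝ} (hr0 : 0 ≤ r) (hr1 : r ≤ 1) :
    ‖f r - f 0‖ ≤ C * r := by
  have hder : ∀ t : ℝ, HasDerivAt (fun t : ℝ => f t) (f' t) t := fun t => by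
    simpa only [zero_add, mul_one, one_smul] using (hf (0 + t * 1)).comp_affine_ofReal
  have := (convex_Icc (0 : ℝ) 1).norm_image_sub_le_of_norm_hasDerivWithin_le
    (fun t _ => (hder t).hasDerivWithinAt) (fun t ht => hC t ht.1 ht.2)
    (⟨le_rfl, zero_le_one⟩ : (0 : ℝ) ∈ Icc (0 : ℝ) 1) ⟨hr0, hr1⟩
  simpa only [Complex.ofReal_zero, sub_zero, Real.norm_of_nonneg hr0] using this

/-! ### Behaviour at the origin and the Laplace transform of the semigroup. -/

section Laplace

variable {n : ℕ} {E : Type*} [NormedAddCommGroup E] [NormedSpace ℂ E]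
  {φ : ResolutionOfUnity n} {s : ℝ} {p q : ℝ≥0∞} [Fact (1 ≤ p)] [Fact (1 ≤ q)] {m : ℕ}
  {a : (Fin n → ℕ) → E →L[ℂ] E}

/-- The sector is open and the exponential factor is bounded on balls. The uniform bound on a ball
is the input of the Cauchy estimates. -/
theorem exists_closedBall_isBlockMultiplier {δ ω M : ℝ} (hM : 0 ≤ M) (hδ : δ ≤ Real.pi / 2)
    (h : ∀ z : ℂ, z ≠ 0 → 0 ≤ z.re → |z.im| ≤ Real.sin δ * ‖z‖ →
      IsBlockMultiplier φ p (expSymbol m a z) fun _ => M * Real.exp (ω * ‖z‖))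
    {w : ℂ} (hw : w ∈ openSector δ) : ∃ ρ > 0, ∃ M' ≥ 0, ∀ z ∈ Metric.closedBall w ρ,
      IsBlockMultiplier φ p (expSymbol m a z) fun _ => M' := by
  obtain ⟨h1, h2⟩ := openSector_re_im hδ hw
  have hopen : IsOpen {z : ℂ | 0 < z.re ∧ |z.im| < Real.sin δ * ‖z‖} :=
    (isOpen_lt continuous_const Complex.continuous_re).inter
      (isOpen_lt (continuous_abs.comp Complex.continuous_im) (continuous_const.mul continuous_norm))
  obtain ⟨ρ, hρ, hsub⟩ := Metric.nhds_basis_closedBall.mem_iff.1 (hopen.mem_nhds ⟨h1, h2⟩)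
  refine ⟨ρ, hρ, M * Real.exp (|ω| * (‖w‖ + ρ)), by positivity, fun z hz => ?_⟩
  obtain ⟨h3, h4⟩ := hsub hz
  refine (h z (fun h0 => by simp [h0] at h3) h3.le h4.le).mono_bound fun _ => ?_
  have h5 : ‖z‖ ≤ ‖w‖ + ρ := by
    rw [mem_closedBall_iff_norm] at hz
    have := norm_add_le w (z - w)
    rw [add_sub_cancel] at this
    linarith
  gcongr
  exact le_abs_self ω

variable [CompleteSpace E]

/-- `exp(-r A) R - R = O(r)` for a resolvent `R` of `-A`. -/
theorem IsBlockMultiplier.expSymbol_sub_one_mul_resSymbol {M K : ℝ} (hM0 : 0 ≤ M) (hK : 0 ≤ K)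
    (hM : ∀ r : ℝ, 0 ≤ r → r ≤ 1 → IsBlockMultiplier φ p (expSymbol m a (r : ℂ)) fun _ => M)
    {z : ℂ} (hu : ∀ k, IsUnit (z • (1 : E →L[ℂ] E) + fullSymbol m a (latticePt k)))
    (hR : IsBlockMultiplier φ p (resSymbol m a z) fun _ => K) :
    ∃ c : ℝ, 0 ≤ c ∧ ∀ r : ℝ, 0 ≤ r → r ≤ 1 → IsBlockMultiplier φ p
      (fun k => (expSymbol m a (r : ℂ) k - 1) * resSymbol m a z k) fun _ => c * r := by
  -- The identity -AR = zR - 1 shows that the derivative of exp(-rA)R is a bounded multiplier. The 1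
  -- is written as `expSymbol m a 0`, whose block bound is already available.
  have hAR : ∀ k, -fullSymbol m a (latticePt k) * resSymbol m a z k =
      z • resSymbol m a z k + (-1 : ℂ) • expSymbol m a 0 k := by
    intro k
    have h1 := Ring.mul_inverse_cancel _ (hu k)
    rw [add_mul, smul_mul_assoc, one_mul] at h1
    rw [expSymbol_zero, neg_mul, neg_smul, one_smul, ← h1, resSymbol]
    abel
  have h0 : IsBlockMultiplier φ p (expSymbol m a 0) fun _ => M := by
    simpa using hM 0 le_rfl zero_le_one
  have hb := (hR.smul z).add (h0.smul (-1))
  set K' := ‖z‖ * K + ‖(-1 : ℂ)‖ * M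
  have hK' : 0 ≤ K' := by positivity
  refine ⟨M * (5 * K'), by positivity, fun r hr0 hr1 j S x => ?_⟩
  have hder : ∀ w : ℂ, HasDerivAt (fun w : ℂ => ∑ k ∈ S, blockTerm φ p j k (x k)
      (expSymbol m a w k * resSymbol m a z k)) (∑ k ∈ S, blockTerm φ p j k (x k)
      (expSymbol m a w k * (z • resSymbol m a z k + (-1 : ℂ) • expSymbol m a 0 k))) w := by
    intro w
    refine HasDerivAt.fun_sum fun k _ =>
      (blockTerm φ p j k (x k)).hasFDerivAt.comp_hasDerivAt _ ?_
    rw [← hAR, ← mul_assoc]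
    exact (hasDerivAt_expSymbol m a w k).mul_const _
  have hmv := norm_sub_le_of_hasDerivAt_unitInterval hder
    (fun t ht0 ht1 => ((hM t ht0 ht1).mul hK' (fun _ => hM0) hb) j S x) hr0 hr1
  rw [← Finset.sum_sub_distrib] at hmv
  simp only [← map_sub, ← sub_mul, expSymbol_zero] at hmv
  refine hmv.trans (le_of_eq ?_)
  ring

/-- On the range of the resolvent the semigroup is continuous at the origin. -/
theorem continuousWithinAt_expOp_resolvent {M K : ℝ} (hM0 : 0 ≤ M) (hK : 0 ≤ K)
    (hM : ∀ r : ℝ, 0 ≤ r → r ≤ 1 → IsBlockMultiplier φ p (expSymbol m a (r : ℂ)) fun _ => M)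
    {z : ℂ} (hu : ∀ k, IsUnit (z • (1 : E →L[ℂ] E) + fullSymbol m a (latticePt k)))
    (hres : IsBlockMultiplier φ p (resSymbol m a z) fun _ => K)
    {R : Besov E φ s p q →L[ℂ] Besov E φ s p q}
    (hR : ∀ x k, fourierCoef k (R x).1 = resSymbol m a z k (fourierCoef k x.1))
    (x : Besov E φ s p q) (l : StrongDual ℂ (Besov E φ s p q)) :
    ContinuousWithinAt (fun r : ℝ => l (expOp φ s p q m a r (R x))) (Ici 0) 0 := by
  obtain ⟨c, hc, hblock⟩ := IsBlockMultiplier.expSymbol_sub_one_mul_resSymbol hM0 hK hM hu hres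
  rw [ContinuousWithinAt, Complex.ofReal_zero, expOp_zero, tendsto_iff_norm_sub_tendsto_zero]
  have h1 : Tendsto (fun r : ℝ => ‖l‖ * (25 * 2 ^ (2 * |s|) * c * ‖x‖) * r) (𝓝[≥] 0) (𝓝 0) := by
    have : Continuous fun r : ℝ => ‖l‖ * (25 * 2 ^ (2 * |s|) * c * ‖x‖) * r :=
      continuous_const.mul continuous_id
    simpa using (this.tendsto 0).mono_left nhdsWithin_le_nhds
  refine squeeze_zero' (Eventually.of_forall fun r => norm_nonneg _) ?_ h1
  filter_upwards [self_mem_nhdsWithin,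
    mem_nhdsWithin_of_mem_nhds (Iic_mem_nhds (zero_lt_one (α := ℝ)))] with r hr0 hr1
  have h2 : ‖expOp φ s p q m a r ∘L R - R‖ ≤ 25 * 2 ^ (2 * |s|) * (c * r) := by
    refine (hblock r hr0 hr1).opNorm_le (mul_nonneg hc hr0) fun y k => ?_
    change fourierCoef k ((expOp φ s p q m a r (R y)).1 - (R y).1) = _
    rw [map_sub, fourierCoef_expOp hM0 (hM r hr0 hr1), hR]
    rfl
  have h3 : l (expOp φ s p q m a r (R x)) - l (R x) = l ((expOp φ s p q m a r ∘L R - R) x) := by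
    rw [← map_sub]
    rfl
  rw [h3]
  calc _ ≤ ‖l‖ * (25 * 2 ^ (2 * |s|) * (c * r) * ‖x‖) :=
        (l.le_opNorm _).trans (mul_le_mul_of_nonneg_left
          (ContinuousLinearMap.le_of_opNorm_le _ h2 x) (norm_nonneg l))
    _ = _ := by ring

/-- The resolvent is the Laplace transform of the semigroup. -/
theorem laplace_expOp {M ω K : ℝ} (hM0 : 0 ≤ M) (hK : 0 ≤ K)
    (hM : ∀ r : ℝ, 0 ≤ r →
      IsBlockMultiplier φ p (expSymbol m a (r : ℂ)) fun _ => M * Real.exp (ω * r))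
    (hloc : ∀ r : ℝ, 0 < r → ∃ ρ > 0, ∃ M' ≥ 0, ∀ z ∈ Metric.closedBall (r : ℂ) ρ,
      IsBlockMultiplier φ p (expSymbol m a z) fun _ => M')
    {z : ℂ} (hz : ω < z.re)
    (hu : ∀ k, IsUnit (z • (1 : E →L[ℂ] E) + fullSymbol m a (latticePt k)))
    (hres : IsBlockMultiplier φ p (resSymbol m a z) fun _ => K)
    {R : Besov E φ s p q →L[ℂ] Besov E φ s p q}
    (hR : ∀ x k, fourierCoef k (R x).1 = resSymbol m a z k (fourierCoef k x.1))
    (x : Besov E φ s p q) (l : StrongDual ℂ (Besov E φ s p q)) :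
    IntegrableOn (fun r : ℝ => Complex.exp (-(z * r)) * l (expOp φ s p q m a r x)) (Ioi 0) ∧
      ∫ r in Ioi (0 : ℝ), Complex.exp (-(z * r)) * l (expOp φ s p q m a r x) = l (R x) := by
  set T : ℂ → Besov E φ s p q →L[ℂ] Besov E φ s p q := expOp φ s p q m a with hT
  have hTcoef : ∀ (r : ℝ) (_ : 0 ≤ r) (y : Besov E φ s p q) (k : Fin n → ℤ),
      fourierCoef k (T r y).1 = expSymbol m a (r : ℂ) k (fourierCoef k y.1) := fun r hr y k =>
    fourierCoef_expOp (by positivity) (hM r hr) y k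
  have hder : ∀ r : ℝ, 0 < r → ∀ y : Besov E φ s p q, ∃ d : Besov E φ s p q,
      (∀ k, fourierCoef k d.1 =
        (expSymbol m a (r : ℂ) k * -fullSymbol m a (latticePt k)) (fourierCoef k y.1)) ∧
      HasDerivAt (fun r : ℝ => l (T r y)) (l d) r := by
    intro r hr y
    obtain ⟨ρ, hρ, M', hM', hball⟩ := hloc r hr
    obtain ⟨D, hD, hD'⟩ := exists_hasDerivAt_apply_expOp (s := s) (q := q) hρ hM' hball
    exact ⟨D y, hD y, (hD' l y).comp_ofReal⟩
  have hbound : ∀ (r : ℝ) (_ : 0 ≤ r) (y : Besov E φ s p q),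
      ‖Complex.exp (-(z * r)) * l (T r y)‖ ≤
        ‖l‖ * (25 * 2 ^ (2 * |s|) * M * ‖y‖) * Real.exp (-(z.re - ω) * r) := by
    intro r hr y
    have h1 : ‖Complex.exp (-(z * r))‖ = Real.exp (-(z.re * r)) := by
      rw [Complex.norm_exp, Complex.neg_re, Complex.re_mul_ofReal]
    have h2 : ‖T r y‖ ≤ 25 * 2 ^ (2 * |s|) * (M * Real.exp (ω * r)) * ‖y‖ :=
      ContinuousLinearMap.le_of_opNorm_le _ (norm_expOp_le (by positivity) (hM r hr)) y
    have h3 : Real.exp (-(z.re - ω) * r) = Real.exp (-(z.re * r)) * Real.exp (ω * r) := by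
      rw [← Real.exp_add]
      ring_nf
    rw [norm_mul, h1, h3]
    calc Real.exp (-(z.re * r)) * ‖l (T r y)‖
        ≤ Real.exp (-(z.re * r)) *
          (‖l‖ * (25 * 2 ^ (2 * |s|) * (M * Real.exp (ω * r)) * ‖y‖)) := by
          gcongr
          exact (l.le_opNorm _).trans (by gcongr)
      _ = _ := by ring
  have hlt : 0 < z.re - ω := by linarith
  have hint : IntegrableOn (fun r : ℝ => Complex.exp (-(z * r)) * l (T r x)) (Ioi 0) := by
    have hc : ContinuousOn (fun r : ℝ => Complex.exp (-(z * r)) * l (T r x)) (Ioi 0) := by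
      refine ContinuousOn.mul (by fun_prop) fun r hr => ?_
      obtain ⟨d, -, hd⟩ := hder r hr x
      exact hd.continuousAt.continuousWithinAt
    refine Integrable.mono' (g := fun r => ‖l‖ * (25 * 2 ^ (2 * |s|) * M * ‖x‖) *
      Real.exp (-(z.re - ω) * r)) ((exp_neg_integrableOn_Ioi 0 hlt).const_mul _)
      (hc.aestronglyMeasurable measurableSet_Ioi) ?_
    exact (ae_restrict_mem measurableSet_Ioi).mono fun r hr => hbound r (mem_Ioi.1 hr).le x
  refine ⟨hint, ?_⟩
  have hexpd : ∀ r : ℝ, HasDerivAt (fun r : ℝ => Complex.exp (-(z * r)))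
      (Complex.exp (-(z * r)) * -z) r := by
    intro r
    have : HasDerivAt (fun w : ℂ => -(z * w)) (-z) r := by
      simpa using ((hasDerivAt_id' (r : ℂ)).const_mul z).fun_neg
    exact this.cexp.comp_ofReal
  -- A primitive of the Laplace integrand is -e^{-zr} l(T(r)Rx), since T'(r)Rx = z T(r)Rx - T(r)x;
  -- the latter is an identity between symbols, checked on Fourier coefficients.
  have hH : ∀ r ∈ Ioi (0 : ℝ), HasDerivAt (fun r : ℝ => -(Complex.exp (-(z * r)) * l (T r (R x))))
      (Complex.exp (-(z * r)) * l (T r x)) r := by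
    intro r hr
    obtain ⟨d, hd, hd'⟩ := hder r hr (R x)
    have e : d = z • T r (R x) - T r x := by
      refine Besov.ext_coef fun k => ?_
      change _ = fourierCoef k (z • (T r (R x)).1 - (T r x).1)
      rw [map_sub, map_smul, hTcoef r (mem_Ioi.1 hr).le, hTcoef r (mem_Ioi.1 hr).le, hd, hR]
      have h1 := congrArg (fun B : E →L[ℂ] E => expSymbol m a (r : ℂ) k (B (fourierCoef k x.1)))
        (Ring.mul_inverse_cancel _ (hu k))
      change expSymbol m a (r : ℂ) k (z • resSymbol m a z k (fourierCoef k x.1) +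
        fullSymbol m a (latticePt k) (resSymbol m a z k (fourierCoef k x.1))) =
        expSymbol m a (r : ℂ) k (fourierCoef k x.1) at h1
      rw [map_add, map_smul] at h1
      rw [← h1]
      change expSymbol m a (r : ℂ) k (-(fullSymbol m a (latticePt k)
        (resSymbol m a z k (fourierCoef k x.1)))) = _
      rw [map_neg]
      abel
    refine (((hexpd r).fun_mul hd').fun_neg).congr_deriv ?_
    rw [e, map_sub, map_smul, smul_eq_mul]
    ring
  -- Continuity at the endpoint 0 is asked for only on the range of the resolvent, where it holds
  -- for every q, including q = ∞.
  have hcont : ContinuousWithinAt (fun r : ℝ => -(Complex.exp (-(z * r)) * l (T r (R x))))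
      (Ici 0) 0 := by
    have hM1 : ∀ r : ℝ, 0 ≤ r → r ≤ 1 → IsBlockMultiplier φ p (expSymbol m a (r : ℂ))
        fun _ => M * Real.exp |ω| := fun r hr hr1 => (hM r hr).mono_bound fun _ => by
      gcongr
      nlinarith [le_abs_self ω, abs_nonneg ω]
    exact ((hexpd 0).continuousAt.continuousWithinAt.mul
      (continuousWithinAt_expOp_resolvent (by positivity) hK hM1 hu hres hR x l)).neg
  have hlim : Tendsto (fun r : ℝ => -(Complex.exp (-(z * r)) * l (T r (R x)))) atTop (𝓝 0) := by
    have h1 : Tendsto (fun r : ℝ => ‖l‖ * (25 * 2 ^ (2 * |s|) * M * ‖R x‖) *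
        Real.exp (-(z.re - ω) * r)) atTop (𝓝 0) := by
      simpa using (Real.tendsto_exp_atBot.comp
        (tendsto_id.const_mul_atTop_of_neg (neg_lt_zero.2 hlt))).const_mul
          (‖l‖ * (25 * 2 ^ (2 * |s|) * M * ‖R x‖))
    refine squeeze_zero_norm' ?_ h1
    filter_upwards [eventually_ge_atTop 0] with r hr
    rw [norm_neg]
    exact hbound r hr (R x)
  rw [integral_Ioi_of_hasDerivAt_of_tendsto hcont hH hint hlim]
  simp [hT, expOp_zero]

/-- Strong continuity at the origin for `q < ∞`. -/
theorem tendsto_expOp {M : ℝ} (hM0 : 0 ≤ M) (hq : q ≠ ∞)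
    (hM : ∀ r : ℝ, 0 ≤ r → r ≤ 1 → IsBlockMultiplier φ p (expSymbol m a (r : ℂ)) fun _ => M)
    (f : Besov E φ s p q) :
    Tendsto (fun r : ℝ => expOp φ s p q m a r f) (𝓝[>] 0) (𝓝 f) := by
  have hq1 : 0 < q.toReal := lt_of_lt_of_le one_pos (rpow_toReal_exponent hq)
  have h0 : IsBlockMultiplier φ p (expSymbol m a 0) fun _ => M := by
    simpa using hM 0 le_rfl zero_le_one
  set u : ℝ → Besov E φ s p q := fun r => expOp φ s p q m a r f - f with hudef
  have hIcc : ∀ᶠ r : ℝ in 𝓝[>] 0, 0 ≤ r ∧ r ≤ 1 := by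
    filter_upwards [self_mem_nhdsWithin,
      mem_nhdsWithin_of_mem_nhds (Iic_mem_nhds (zero_lt_one (α := ℝ)))] with r hr0 hr1
    exact ⟨(mem_Ioi.1 hr0).le, hr1⟩
  have hcoef : ∀ r : ℝ, 0 ≤ r → r ≤ 1 → ∀ k, fourierCoef k (u r).1 =
      (expSymbol m a (r : ℂ) k + (-1 : ℂ) • expSymbol m a 0 k) (fourierCoef k f.1) := by
    intro r hr0 hr1 k
    change fourierCoef k ((expOp φ s p q m a r f).1 - f.1) = _
    rw [map_sub, fourierCoef_expOp hM0 (hM r hr0 hr1), expSymbol_zero, neg_smul, one_smul,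
      ← sub_eq_add_neg]
    rfl
  obtain ⟨c, hc⟩ : ∃ c, c = (M + ‖(-1 : ℂ)‖ * M) * 2 ^ (2 * |s|) := ⟨_, rfl⟩
  have hc0 : 0 ≤ c := hc ▸ by positivity
  -- The majorant for dominated convergence: it bounds the blocks of T(r)f - f for all r in [0, 1],
  -- and it lies in ℓ^q because f is in the Besov space.
  let g : ℕ → ℝ := fun j => c * ∑ i ∈ nbhd j, ‖besovSeq φ s p f.1 i‖
  have hg0 : ∀ j, 0 ≤ g j := fun j => mul_nonneg hc0 (Finset.sum_nonneg fun _ _ => norm_nonneg _)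
  have hgsum : Summable fun j => g j ^ q.toReal := by
    obtain ⟨h1, -⟩ := memℓp_of_le_sum_nbhd q (besovToLp φ s p q f) g c hc0
      fun j => by rw [Real.norm_of_nonneg (hg0 j)]; rfl
    simpa only [Real.norm_of_nonneg (hg0 _)] using h1.summable hq1
  have hdom : ∀ r : ℝ, 0 ≤ r → r ≤ 1 → ∀ j, ‖besovSeq φ s p (u r).1 j‖ ≤ g j := by
    intro r hr0 hr1 j
    have h1 := ((hM r hr0 hr1).add (h0.smul (-1))).norm_besovSeq_le (s := s) (s' := s)
      (c := M + ‖(-1 : ℂ)‖ * M) (fun _ => by positivity) (by positivity)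
      (fun j => le_of_eq (mul_comm _ _)) (hcoef r hr0 hr1) j
    rwa [← hc] at h1
  -- Each single block involves finitely many frequencies, for which exp(-r a(k)) → 1 in L(E).
  have hterm : ∀ j, Tendsto (fun r : ℝ => ‖besovSeq φ s p (u r).1 j‖ ^ q.toReal) (𝓝[>] 0) (𝓝 0) := by
    intro j
    have h1 : Tendsto (fun r : ℝ => ∑ k ∈ box n j, blockTerm φ p j k (fourierCoef k f.1)
        (expSymbol m a (r : ℂ) k + (-1 : ℂ) • expSymbol m a 0 k)) (𝓝[>] 0) (𝓝 0) := by
      have h2 : Continuous fun r : ℝ => ∑ k ∈ box n j, blockTerm φ p j k (fourierCoef k f.1)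
          (expSymbol m a (r : ℂ) k + (-1 : ℂ) • expSymbol m a 0 k) := by
        refine continuous_finsetSum _ fun k _ => (blockTerm φ p j k _).continuous.comp ?_
        refine Continuous.add ?_ continuous_const
        have : Continuous fun w : ℂ => expSymbol m a w k :=
          continuous_iff_continuousAt.2 fun w => (hasDerivAt_expSymbol m a w k).continuousAt
        exact this.comp Complex.continuous_ofReal
      have h3 := (h2.tendsto 0).mono_left (nhdsWithin_le_nhds (s := Ioi 0))
      simpa only [Complex.ofReal_zero, neg_smul, one_smul, add_neg_cancel, map_zero,
        Finset.sum_const_zero] using h3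
    have h4 : Tendsto (fun r : ℝ => ‖besovSeq φ s p (u r).1 j‖) (𝓝[>] 0) (𝓝 0) := by
      have h5 := h1.norm.const_mul ((2 : ℝ) ^ (s * j))
      rw [norm_zero, mul_zero] at h5
      refine h5.congr' ?_
      filter_upwards [hIcc] with r hr
      rw [norm_besovSeq, blockLp_eq_sum φ p j _ _ subset_rfl]
      congr 2
      refine Finset.sum_congr rfl fun k _ => ?_
      rw [blockTerm_apply, hcoef r hr.1 hr.2]
    have h6 := h4.rpow_const (Or.inr hq1.le)
    rwa [Real.zero_rpow hq1.ne'] at h6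
  have hsum := tendsto_tsum_of_dominated_convergence (𝓕 := 𝓝[>] (0 : ℝ)) hgsum hterm (by
    filter_upwards [hIcc] with r hr j
    rw [Real.norm_of_nonneg (by positivity)]
    exact Real.rpow_le_rpow (norm_nonneg _) (hdom r hr.1 hr.2 j) hq1.le)
  rw [tsum_zero] at hsum
  rw [tendsto_iff_norm_sub_tendsto_zero]
  have h7 := hsum.rpow_const (p := 1 / q.toReal) (Or.inr (by positivity))
  rw [Real.zero_rpow (by positivity)] at h7
  refine h7.congr fun r => ?_
  change _ = ‖besovToLp φ s p q (u r)‖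
  rw [lp.norm_eq_tsum_rpow hq1]
  rfl

end Laplace

/-! ### Resolvent estimate and generation for the realizations. -/

section Realization

variable {n : ℕ} {E : Type*} [NormedAddCommGroup E] [NormedSpace ℂ E]

theorem coeffNorm_le_of_iSup {m : ℕ} {a : (Fin n → ℕ) → ℝ≥0 → E →L[ℂ] E} {C : ℝ≥0}
    (hC : ∑ i ∈ Finset.range (m + 1), ∑ α ∈ multiIdx n i, ⨆ t : ℝ≥0, ‖a α t‖ₑ ≤ C) (t : ℝ≥0) :
    coeffNorm m (fun α => a α t) ≤ C := by
  have h1 : ∑ i ∈ Finset.range (m + 1), ∑ α ∈ multiIdx n i, ‖a α t‖ₑ ≤ C :=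
    (Finset.sum_le_sum fun i _ => Finset.sum_le_sum fun α _ =>
      le_iSup (fun t : ℝ≥0 => ‖a α t‖ₑ) t).trans hC
  have h2 : ∑ i ∈ Finset.range (m + 1), ∑ α ∈ multiIdx n i, ‖a α t‖₊ ≤ C := by
    simp only [enorm_eq_nnnorm] at h1
    exact_mod_cast h1
  have h3 := NNReal.coe_le_coe.2 h2
  push_cast at h3
  exact h3

variable [CompleteSpace E] (φ : ResolutionOfUnity n) (s : ℝ) (p q : ℝ≥0∞) [Fact (1 ≤ p)]
  [Fact (1 ≤ q)]

/-- The resolvent estimate for the realizations, uniform in the coefficients. -/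
theorem exists_resolvent_bound {m : ℕ} (hm : 1 ≤ m) {C κ₀ θ : ℝ} (hC : 0 ≤ C) (hκ : 1 ≤ κ₀)
    (h0 : 0 ≤ θ) (hπ : θ < Real.pi) :
    ∃ κ : ℝ, 1 ≤ κ ∧ ∃ ω₀ : ℝ, 0 < ω₀ ∧ ∀ a : (Fin n → ℕ) → E →L[ℂ] E, coeffNorm m a ≤ C →
      SymbolElliptic m a κ₀ θ → ∀ z ∈ (fun z : ℂ => (ω₀ : ℂ) + z) '' sector θ,
        ∃ R : Besov E φ s p q →L[ℂ] Besov E φ s p q,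
          IsResolvent (-realization φ s p q m a) z R ∧ ‖R‖ ≤ κ / (1 + ‖z‖) := by
  obtain ⟨ω, hω, K, hK, hres⟩ := exists_isBlockMultiplier_resSymbol φ E m hm C κ₀ θ hC hκ h0 hπ.le
  have hcos := one_add_cos_pos h0 hπ
  set c := (1 + Real.cos θ) / 2
  have hc0 : 0 < c := by positivity
  have hc1 : c ≤ 1 := by
    have := Real.cos_le_one θ
    simp only [c]
    linarith
  -- On the sector shifted by ω₀ = ω/c one has |z|² ≥ c ω₀² = ω²/c ≥ ω², as c ≤ 1. The factor 2 in κ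
  -- converts 1/|z| into 1/(1 + |z|), since |z| ≥ ω ≥ 1.
  refine ⟨max 1 (2 * (25 * 2 ^ (2 * |s|) * K)), le_max_left _ _, ω / c, by positivity,
    fun a ha hell z hz => ?_⟩
  obtain ⟨w, hw, rfl⟩ := hz
  obtain ⟨h1, h2⟩ := add_mem_sector h0 hπ (show 0 ≤ ω / c by positivity) hw
  have h3 : ω ≤ ‖((ω / c : ℝ) : ℂ) + w‖ := by
    refine le_of_sq_le_sq (le_trans ?_ h2) (norm_nonneg _)
    change ω ^ 2 ≤ c * (ω / c) ^ 2
    rw [div_pow, ← mul_div_assoc, le_div_iff₀ (by positivity)]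
    nlinarith [mul_nonneg (sq_nonneg ω) (mul_nonneg hc0.le (sub_nonneg.2 hc1))]
  simp only
  set z : ℂ := ((ω / c : ℝ) : ℂ) + w
  have hz0 : 0 < ‖z‖ := by linarith
  obtain ⟨hu, -, hM⟩ := hres p a ha hell z h1 h3
  have hM' := hM.mono_bound (c := fun _ => K / ‖z‖) fun j => by
    have : (0 : ℝ) ≤ ((2 : ℝ) ^ j) ^ m := by positivity
    gcongr
    linarith
  obtain ⟨R, hR⟩ := hM'.exists_clm s q (by positivity)
  refine ⟨R, isResolvent_of_symbol m a z K hK hu hM hR, ?_⟩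
  refine (hM'.opNorm_le (by positivity) hR).trans ?_
  rw [← mul_div_assoc, div_le_div_iff₀ hz0 (by positivity)]
  have h4 : 0 ≤ 25 * 2 ^ (2 * |s|) * K := by positivity
  have h5 : 25 * 2 ^ (2 * |s|) * K * (1 + ‖z‖) ≤ 2 * (25 * 2 ^ (2 * |s|) * K) * ‖z‖ := by
    nlinarith
  exact h5.trans (mul_le_mul_of_nonneg_right (le_max_right _ _) hz0.le)

/-- Generation of an analytic semigroup by the realization of a normally elliptic operator. -/
theorem exists_isAnalyticSemigroup {m : ℕ} (hm : 1 ≤ m) (a : (Fin n → ℕ) → E →L[ℂ] E) {κ δ : ℝ}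
    (hκ : 1 ≤ κ) (hδ0 : 0 < δ) (hδ : δ ≤ Real.pi / 2)
    (hell : SymbolElliptic m a κ (Real.pi / 2 + δ)) :
    IsAnalyticSemigroup (-realization φ s p q m a) δ (expOp φ s p q m a) ∧
      (q ≠ ∞ → ∀ f : Besov E φ s p q,
        Tendsto (fun r : ℝ => expOp φ s p q m a r f) (𝓝[>] 0) (𝓝 f)) := by
  have hpi := Real.pi_pos
  obtain ⟨ω, M, hM0, hM⟩ := exists_isBlockMultiplier_expSymbol (p := p) φ hm a hκ hδ0.le hδ hell
  obtain ⟨ω', -, K, hK, hres⟩ := exists_isBlockMultiplier_resSymbol φ E m hm (coeffNorm m a) κ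
    (Real.pi / 2 + δ) (coeffNorm_nonneg m a) hκ (by linarith) (by linarith)
  obtain ⟨K₁, hK₁, hone⟩ := exists_isBlockMultiplier_one φ
  have hsec : ∀ z ∈ openSector δ,
      IsBlockMultiplier φ p (expSymbol m a z) fun _ => M * Real.exp (ω * ‖z‖) := fun z hz =>
    hM z hz.1 (openSector_re_im hδ hz).1.le (openSector_re_im hδ hz).2.le
  have hsecM : ∀ z : ℂ, 0 ≤ M * Real.exp (ω * ‖z‖) := fun z => by positivity
  -- The bound on the sector excludes time 0, where the multiplier is the identity; its block
  -- constant K₁ is included through the maximum.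
  have hreal : ∀ r : ℝ, 0 ≤ r →
      IsBlockMultiplier φ p (expSymbol m a (r : ℂ)) fun _ => max M K₁ * Real.exp (ω * r) := by
    intro r hr
    rcases hr.eq_or_lt with rfl | hr
    · have e : expSymbol m a ((0 : ℝ) : ℂ) = fun _ => 1 := by
        funext k
        rw [Complex.ofReal_zero, expSymbol_zero]
      rw [e, mul_zero, Real.exp_zero, mul_one]
      exact (hone p).mono_bound fun _ => le_max_right _ _
    · refine (hsec r (ofReal_mem_openSector hδ0 hr)).mono_bound fun _ => ?_
      rw [Complex.norm_real, Real.norm_of_nonneg hr.le]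
      gcongr
      exact le_max_left _ _
  have hmax : 0 ≤ max M K₁ := hM0.trans (le_max_left _ _)
  refine ⟨⟨hδ0, hδ, fun w hw => ?_, fun z hz w hw => ?_, fun δ' hδ' => ?_, ?_⟩, fun hq f => ?_⟩
  · obtain ⟨ρ, hρ, M', hM', hball⟩ := exists_closedBall_isBlockMultiplier hM0 hδ hM hw
    exact (differentiableAt_expOp hρ hM' hball).differentiableWithinAt
  · exact expOp_add (hsecM z) (hsecM w) (hsec z hz) (hsec w hw)
  · refine ⟨25 * 2 ^ (2 * |s|) * (M * Real.exp |ω|), fun z hz hz1 => ?_⟩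
    refine (norm_expOp_le (hsecM z) (hsec z ⟨hz.1, hz.2.trans hδ'⟩)).trans ?_
    gcongr
    nlinarith [le_abs_self ω, abs_nonneg ω, norm_nonneg z]
  -- Here 0 places z in the right half-plane, inside the larger sector, ω makes the Laplace integral
  -- converge, and ω' makes the resolvent multiplier available.
  · refine ⟨max 0 (max ω ω'), fun z hz => ?_⟩
    have hz0 : 0 < z.re := (le_max_left _ _).trans_lt hz
    have hzω : ω < z.re := ((le_max_left _ _).trans (le_max_right _ _)).trans_lt hz
    have hzω' : ω' < z.re := ((le_max_right _ _).trans (le_max_right _ _)).trans_lt hz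
    have hzn : 0 < ‖z‖ := hz0.trans_le (Complex.re_le_norm z)
    have hmem : z ∈ sector (Real.pi / 2 + δ) := by
      rw [mem_sector_iff (by linarith) (by linarith), add_comm, Real.cos_add_pi_div_two]
      have := mul_nonneg (Real.sin_nonneg_of_nonneg_of_le_pi hδ0.le (by linarith)) hzn.le
      linarith
    obtain ⟨hu, -, hR⟩ := hres p a le_rfl hell z hmem (hzω'.le.trans (Complex.re_le_norm z))
    have hR' := hR.mono_bound (c := fun _ => K / ‖z‖) fun j => by
      have : (0 : ℝ) ≤ ((2 : ℝ) ^ j) ^ m := by positivity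
      gcongr
      linarith
    obtain ⟨R, hRs⟩ := hR'.exists_clm s q (by positivity)
    exact ⟨R, isResolvent_of_symbol m a z K hK hu hR hRs, fun x l =>
      laplace_expOp hmax (by positivity) hreal (fun r hr =>
        exists_closedBall_isBlockMultiplier hM0 hδ hM (ofReal_mem_openSector hδ0 hr))
        hzω hu hR' hRs x l⟩
  · refine tendsto_expOp (M := max M K₁ * Real.exp |ω|) (by positivity) hq
      (fun r hr0 hr1 => (hreal r hr0).mono_bound fun _ => ?_) f
    gcongr
    nlinarith [le_abs_self ω, abs_nonneg ω]

end Realization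

end TorusBesov

end

theorem proposition6 {n : ℕ} (hn : 1 ≤ n)
    {E : Type*} [NormedAddCommGroup E] [NormedSpace ℂ E] [CompleteSpace E] (hE : IsUMD n E)
    (φ : ResolutionOfUnity n) (s : ℝ) (p q : ℝ≥0∞) [Fact (1 ≤ p)] [Fact (1 ≤ q)]
    (hp1 : 1 < p) (hp : p < ∞) {m : ℕ} (hm : 1 ≤ m)
    (a : (Fin n → ℕ) → ℝ≥0 → E →L[ℂ] E) (κ₀ θ : ℝ) (hA : IsElliptic m a κ₀ θ)
    (C : ℝ≥0)
    (hC : ∑ i ∈ Finset.range (m + 1), ∑ α ∈ multiIdx n i, ⨆ t : ℝ≥0, ‖a α t‖ₑ ≤ C) :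
    -- the realization is defined on the whole of `B^{s+m}_{p,q}`
    (∀ (t : ℝ≥0) (u : Distr n E), u ∈ Besov E φ (s + m) p q →
      u ∈ Besov E φ s p q ∧ diffOp m (fun α => a α t) u ∈ Besov E φ s p q) ∧
    -- resolvent estimate, uniform in `t` and in the spectral parameter
    (∃ κ : ℝ, 1 ≤ κ ∧ ∃ ω₀ : ℝ, 0 < ω₀ ∧ ∀ t : ℝ≥0,
      (fun z : ℂ => (ω₀ : ℂ) + z) '' sector θ ⊆
        rho (-realization φ s p q m (fun α => a α t)) ∧
      ∀ z ∈ (fun z : ℂ => (ω₀ : ℂ) + z) '' sector θ,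
        ∀ R : Besov E φ s p q →L[ℂ] Besov E φ s p q,
          IsResolvent (-realization φ s p q m (fun α => a α t)) z R →
          ‖R‖ ≤ κ / (1 + ‖z‖)) ∧
    -- generation of analytic semigroups
    (IsNormallyElliptic m a → ∀ t : ℝ≥0, ∃ (δ : ℝ) (T : ℂ → Besov E φ s p q →L[ℂ] Besov E φ s p q),
      IsAnalyticSemigroup (-realization φ s p q m (fun α => a α t)) δ T ∧
      (q ≠ ∞ → ∀ f : Besov E φ s p q, Tendsto (fun r : ℝ => T r f) (𝓝[>] 0) (𝓝 f))) := by
  have hκ := hA.one_le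
  have hcoef := coeffNorm_le_of_iSup hC
  refine ⟨fun t u hu => diffOp_mem_besov m _ hu, ?_, ?_⟩
  · obtain ⟨κ, hκ1, ω₀, hω₀, h⟩ := exists_resolvent_bound φ s p q (E := E) hm C.2 hκ
      hA.angle_nonneg hA.angle_lt
    refine ⟨κ, hκ1, ω₀, hω₀, fun t => ⟨fun z hz => ?_, fun z hz R hR => ?_⟩⟩
    · obtain ⟨R, hR, -⟩ := h _ (hcoef t) (hA.symbolElliptic t) z hz
      exact ⟨R, hR⟩
    · obtain ⟨R', hR', hle⟩ := h _ (hcoef t) (hA.symbolElliptic t) z hz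
      -- The estimate is claimed for every bounded inverse; by uniqueness it is the multiplier
      -- already estimated.
      rwa [hR.unique hR']
  · rintro ⟨κ, hκ'⟩ t
    have hκ1 := hκ'.one_le
    have hδ : 1 / (4 * κ) ≤ Real.pi / 2 := by
      have h1 : 1 / (4 * κ) ≤ 1 := by
        rw [div_le_one (by positivity)]
        linarith
      linarith [Real.pi_gt_three]
    -- The angle 1/(4κ) is the amount by which the sector of ellipticity can be enlarged, at the
    -- cost of replacing κ by 4κ.
    exact ⟨1 / (4 * κ), _, exists_isAnalyticSemigroup φ s p q hm _ (by linarith) (by positivity) hδ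
      ((hκ'.symbolElliptic t).enlarge hκ1 (by positivity) le_rfl hδ)⟩
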